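/- **Theorem (Generalized Graph Reconstruction).** *Setting.* Let $d>1$. A *straight-line embedded graph* in $\mathbb R^d$ is a finite simple graph $G=(V,E)$ whose vertices are distinct points of $\mathbb R^d$ and whose edges are the straight segments between their end points, such that a vertex lies on an edge only if it is an end point of it and two distinct edges meet at most in a common end point. It is in *general position* if any two distinct vertices $x,y$ satisfy $x_i\neq y_i$ for all $i\in\{1,\dots,d\}$, and no three distinct vertices are collinear after orthogonal projection onto the span of $e_1,e_2$. For a direction $s\in\mathbb S^{d-1}$, a simplex $\sigma$ (vertex or edge) of $G$ has height $h_s(\sigma)=\max_{v\in\sigma}\langle v,s\rangle$. Order the simplices $\sigma_1,\dots,\sigma_N$ by nondecreasing height with faces before cofaces. The *directional augmented persistence diagram* $\mathcal D(s)$ is the finite multiset that contains, for every $k\in\{0,1\}$ and every $k$-dimensional homology class (coefficients in $\mathbb Z/2$) of the filtration adding $\sigma_1,\dots,\sigma_N$ one at a time that is born with $\sigma_i$ and dies with $\sigma_j$ (respectively never dies), the $k$-dimensional point $(h_s(\sigma_i),h_s(\sigma_j))$ (respectively $(h_s(\sigma_i),\infty)$); points on the diagonal are retained. *Model of computation.*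 A real RAM: a finite program, with no real constants besides $0$ and $1$, working on variables and two-dimensional arrays of natural and of real numbers, in which addition and (truncated) subtraction of natural numbers, $+,-,\times,/,\sqrt{\phantom{x}}$ on real numbers, comparisons, memory accesses and assignments have unit cost. It receives $d$ as input, and it may send a unit vector $s\in\mathbb S^{d-1}$ to an oracle, which writes the list of the points of $\mathcal D(s)$, in arbitrary order, into memory; each such query takes $T_G$ steps, where $T_G\ge 1$ is an arbitrary natural number. *Claim.* There are one such program and one absolute constant $C$ such that for every $d>1$, every straight-line embedded graph $G=(V,E)$ in $\mathbb R^d$ in general position, with $n=|V|$, every oracle for the diagrams of $G$ and every $T_G\geq 1$, the program halts, having consulted the oracle in exactly $n^2-n+d+1$ pairwise different directions, and outputs $V$, $E$ and the embedding of $G$ (the list of the coordinate vectors of all vertices, and the list of all edges as pairs of indices of vertices, each vertex and each edge once), after at most $$C\left(d\,n^{d+1}+n^4+(d+n^2)\,T_G\right)$$ steps. -/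

import Mathlib

noncomputable section

namespace GraphReconstruction

/-! ### Straight-line embedded graphs -/

/-- A straight-line embedded (finite, simple) graph in `ℝ^d`, regarded as a one-dimensional
geometric simplicial complex: the simplices are the vertices and the edges, an edge `vw` is realized
by the segment from `pos v` to `pos w`, and two realized simplices meet exactly in the realization
of the simplex spanned by their common vertices. -/
structure EmbeddedGraph (V : Type*) (d : ℕ) where
  graph : SimpleGraph V
  pos : V → EuclideanSpace ℝ (Fin d)
  pos_injective : Function.Injective pos
  vertex_edge : ∀ u v w, graph.Adj v w → pos u ∈ segment ℝ (pos v) (pos w) → u = v ∨ u = w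
  edge_edge : ∀ a b v w, graph.Adj a b → graph.Adj v w → s(a, b) ≠ s(v, w) →
    ∀ x ∈ segment ℝ (pos a) (pos b) ∩ segment ℝ (pos v) (pos w),
      ∃ u, (u = a ∨ u = b) ∧ (u = v ∨ u = w) ∧ x = pos u

/-- The orthogonal projection of `ℝ^d` onto the plane of the first two coordinates. -/
def planeProj {d : ℕ} (hd : 2 ≤ d) (x : EuclideanSpace ℝ (Fin d)) : EuclideanSpace ℝ (Fin 2) :=
  !₂[x ⟨0, by omega⟩, x ⟨1, by omega⟩]

/-- General position: distinct vertices differ in every coordinate, and no three distinct vertices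
become collinear when projected onto the span of `e₁` and `e₂`. -/
def EmbeddedGraph.GeneralPosition {V : Type*} {d : ℕ} (K : EmbeddedGraph V d) (hd : 2 ≤ d) : Prop :=
  (∀ v w, v ≠ w → ∀ i, K.pos v i ≠ K.pos w i) ∧
  ∀ u v w, u ≠ v → u ≠ w → v ≠ w →
    ¬ Collinear ℝ {planeProj hd (K.pos u), planeProj hd (K.pos v), planeProj hd (K.pos w)}

/-! ### Persistent homology over `ℤ/2` of filtered finite complexes -/

/-- Formal sums of simplices, a simplex being the finite set of its vertices. -/
abbrev Chain (V : Type*) := Finset V →₀ ZMod 2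

open Classical in
/-- The simplicial boundary map (unaugmented: the boundary of a vertex is `0`). -/
def boundary (V : Type*) : Chain V →ₗ[ZMod 2] Chain V :=
  Finsupp.linearCombination (ZMod 2) fun σ : Finset V =>
    if σ.card ≤ 1 then 0 else ∑ v ∈ σ, Finsupp.single (σ.erase v) 1

/-- The `k`-chains of the complex with set of simplices `S`. -/
def chains {V : Type*} (k : ℕ) (S : Set (Finset V)) : Submodule (ZMod 2) (Chain V) :=
  Finsupp.supported (ZMod 2) (ZMod 2) {σ | σ ∈ S ∧ σ.card = k + 1}

/-- The `k`-cycles. -/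
def cycles {V : Type*} (k : ℕ) (S : Set (Finset V)) : Submodule (ZMod 2) (Chain V) :=
  chains k S ⊓ LinearMap.ker (boundary V)

/-- The `k`-boundaries. -/
def boundaries {V : Type*} (k : ℕ) (S : Set (Finset V)) : Submodule (ZMod 2) (Chain V) :=
  (chains (k + 1) S).map (boundary V)

/-- The `k`-th persistent Betti number of `S ⊆ S'`: the rank of `H_k(S) → H_k(S')`, that is, the
dimension of `Z_k(S) / (Z_k(S) ∩ B_k(S'))`. -/
def persistentBetti {V : Type*} (k : ℕ) (S S' : Set (Finset V)) : ℤ :=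
  (Module.finrank (ZMod 2) (cycles k S) : ℤ) -
    Module.finrank (ZMod 2) (cycles k S ⊓ boundaries k S' : Submodule (ZMod 2) (Chain V))

/-- A point of an augmented persistence diagram. -/
structure DiagramPoint where
  dim : ℕ
  birth : ℝ
  death : WithTop ℝ

/-- The complex formed by the first `i` simplices of a list. -/
def stage {V : Type*} (L : List (Finset V)) (i : ℕ) : Set (Finset V) :=
  {σ | σ ∈ L.take i}

/-- The number of `k`-classes born with the simplex `L[i]` that die with the simplex `L[j]`. -/
def pairMult {V : Type*} (L : List (Finset V)) (k i j : ℕ) : ℕ :=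
  ((persistentBetti k (stage L (i + 1)) (stage L j) -
      persistentBetti k (stage L (i + 1)) (stage L (j + 1))) -
    (persistentBetti k (stage L i) (stage L j) -
      persistentBetti k (stage L i) (stage L (j + 1)))).toNat

/-- The number of `k`-classes born with the simplex `L[i]` that never die. -/
def essentialMult {V : Type*} (L : List (Finset V)) (k i : ℕ) : ℕ :=
  (persistentBetti k (stage L (i + 1)) (stage L L.length) -
    persistentBetti k (stage L i) (stage L L.length)).toNat

/-- The augmented persistence diagram, in dimensions `0` and `1`, of the filtration that adds the
simplices of `L` one at a time, with the simplex `σ` entering at height `f σ`. Pairs of simplices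
of equal height are kept: they are the (finitely many, explicitly recorded) points of the
diagram on the diagonal. -/
def diagramOfOrder {V : Type*} (L : List (Finset V)) (f : Finset V → ℝ) : Multiset DiagramPoint :=
  ∑ k : Fin 2, ∑ i : Fin L.length,
    (Multiset.replicate (essentialMult L k i) ⟨k, f L[i], ⊤⟩ +
      ∑ j ∈ Finset.univ.filter (fun j : Fin L.length => i < j),
        Multiset.replicate (pairMult L k i j) ⟨k, f L[i], (f L[j] : ℝ)⟩)

/-! ### Directional augmented persistence diagrams of embedded graphs -/

namespace EmbeddedGraph

variable {V : Type*} {d : ℕ}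

open Classical in
/-- The simplices of the graph: its vertices and edges. -/
def faces (K : EmbeddedGraph V d) : Set (Finset V) :=
  {σ | (∃ v, σ = {v}) ∨ ∃ v w, K.graph.Adj v w ∧ σ = {v, w}}

/-- The height of a simplex in direction `s`: the maximum of the heights of its vertices. -/
def height (K : EmbeddedGraph V d) (s : EuclideanSpace ℝ (Fin d)) (σ : Finset V) : ℝ :=
  sSup ((fun v => inner ℝ (K.pos v) s) '' (σ : Set V))

/-- `L` lists all simplices, each once, by nondecreasing height and with faces before cofaces; that
is, `L` refines the lower-star filtration in direction `s`. -/
def IsFiltrationOrder (K : EmbeddedGraph V d) (s : EuclideanSpace ℝ (Fin d))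
    (L : List (Finset V)) : Prop :=
  L.Nodup ∧ (∀ σ, σ ∈ L ↔ σ ∈ K.faces) ∧
    L.Pairwise fun σ τ => K.height s σ ≤ K.height s τ ∧ ¬ τ ⊂ σ

/-- `D` is the augmented persistence diagram of the height filtration in direction `s`, computed
from a simplexwise refinement of the filtration (ties in height are broken arbitrarily). -/
def IsDiagram (K : EmbeddedGraph V d) (s : EuclideanSpace ℝ (Fin d))
    (D : Multiset DiagramPoint) : Prop :=
  ∃ L, K.IsFiltrationOrder s L ∧ D = diagramOfOrder L (K.height s)

/-- `O` is an oracle for the directional augmented persistence diagrams of `K`: it lists, in an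
arbitrary order, the points of the diagram in every direction of the unit sphere. -/
def IsOracle (K : EmbeddedGraph V d)
    (O : EuclideanSpace ℝ (Fin d) → List DiagramPoint) : Prop :=
  ∀ s, ‖s‖ = 1 → K.IsDiagram s (O s : Multiset DiagramPoint)

end EmbeddedGraph

/-! ### The real RAM with a diagram oracle

Programs are finite, contain no real constants besides `0` and `1`, and work on natural and real
variables and on two-dimensional natural and real arrays. Every operation has unit cost. -/

/-- A memory state. -/
structure State where
  natVar : ℕ → ℕ
  realVar : ℕ → ℝ
  natArr : ℕ → ℕ → ℕ → ℕ
  realArr : ℕ → ℕ → ℕ → ℝ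

/-- Expressions for natural numbers; subtraction is truncated. -/
inductive NatExp
  | const (c : ℕ)
  | var (x : ℕ)
  | arr (a : ℕ) (i j : NatExp)
  | add (e e' : NatExp)
  | sub (e e' : NatExp)

/-- Expressions for real numbers. -/
inductive RealExp
  | zero
  | one
  | var (x : ℕ)
  | arr (a : ℕ) (i j : NatExp)
  | add (e e' : RealExp)
  | sub (e e' : RealExp)
  | mul (e e' : RealExp)
  | div (e e' : RealExp)
  | sqrt (e : RealExp)

/-- Tests. -/
inductive Test
  | natLt (e e' : NatExp)
  | realLt (e e' : RealExp)
  | not (b : Test)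
  | and (b b' : Test)

/-- The value of an expression. -/
def NatExp.eval (m : State) : NatExp → ℕ
  | const c => c
  | var x => m.natVar x
  | arr a i j => m.natArr a (i.eval m) (j.eval m)
  | add e e' => e.eval m + e'.eval m
  | sub e e' => e.eval m - e'.eval m

/-- The number of operations in an expression. -/
def NatExp.cost : NatExp → ℕ
  | const _ => 1
  | var _ => 1
  | arr _ i j => 1 + i.cost + j.cost
  | add e e' => 1 + e.cost + e'.cost
  | sub e e' => 1 + e.cost + e'.cost

/-- The value of an expression. Division by zero and roots of negative numbers give `0`, which a
program could also arrange by a test. -/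
def RealExp.eval (m : State) : RealExp → ℝ
  | zero => 0
  | one => 1
  | var x => m.realVar x
  | arr a i j => m.realArr a (i.eval m) (j.eval m)
  | add e e' => e.eval m + e'.eval m
  | sub e e' => e.eval m - e'.eval m
  | mul e e' => e.eval m * e'.eval m
  | div e e' => e.eval m / e'.eval m
  | sqrt e => Real.sqrt (e.eval m)

/-- The number of operations in an expression. -/
def RealExp.cost : RealExp → ℕ
  | zero => 1
  | one => 1
  | var _ => 1
  | arr _ i j => 1 + i.cost + j.cost
  | add e e' => 1 + e.cost + e'.cost
  | sub e e' => 1 + e.cost + e'.cost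
  | mul e e' => 1 + e.cost + e'.cost
  | div e e' => 1 + e.cost + e'.cost
  | sqrt e => 1 + e.cost

/-- The outcome of a test. -/
def Test.holds (m : State) : Test → Prop
  | natLt e e' => e.eval m < e'.eval m
  | realLt e e' => e.eval m < e'.eval m
  | not b => ¬ b.holds m
  | and b b' => b.holds m ∧ b'.holds m

/-- The number of operations in a test. -/
def Test.cost : Test → ℕ
  | natLt e e' => 1 + e.cost + e'.cost
  | realLt e e' => 1 + e.cost + e'.cost
  | not b => 1 + b.cost
  | and b b' => 1 + b.cost + b'.cost

/-- Programs. -/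
inductive Program
  | skip
  | setNat (x : ℕ) (e : NatExp)
  | setReal (x : ℕ) (e : RealExp)
  | storeNat (a : ℕ) (i j : NatExp) (e : NatExp)
  | storeReal (a : ℕ) (i j : NatExp) (e : RealExp)
  | seq (p q : Program)
  | branch (b : Test) (p q : Program)
  | loop (b : Test) (p : Program)
  | query

namespace State

/-- The initial memory: the dimension `d` is in the natural variable `0`, all else is `0`. -/
def init (d : ℕ) : State where
  natVar x := if x = 0 then d else 0
  realVar _ := 0
  natArr _ _ _ := 0
  realArr _ _ _ := 0

def setNat (m : State) (x c : ℕ) : State :=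
  { m with natVar := Function.update m.natVar x c }

def setReal (m : State) (x : ℕ) (r : ℝ) : State :=
  { m with realVar := Function.update m.realVar x r }

def storeNat (m : State) (a i j c : ℕ) : State :=
  { m with natArr := fun a' i' j' => if a' = a ∧ i' = i ∧ j' = j then c else m.natArr a' i' j' }

def storeReal (m : State) (a i j : ℕ) (r : ℝ) : State :=
  { m with realArr := fun a' i' j' => if a' = a ∧ i' = i ∧ j' = j then r else m.realArr a' i' j' }

/-- The vector to be sent to the oracle: the first `d` entries of row `0` of the real array `0`. -/
def direction (m : State) (d : ℕ) : EuclideanSpace ℝ (Fin d) :=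
  WithLp.toLp 2 fun j : Fin d => m.realArr 0 0 j

open Classical in
/-- The memory after the oracle's answer `D` has been received: the natural variable `1` holds the
number of points, and for the `k`-th point the entries `k` of rows `0` and `1` of the natural array
`0` hold its dimension and whether its death is infinite (`1`) or finite (`0`), and the entries `k`
of rows `1` and `2` of the real array `0` hold its birth and its death (`0` if infinite). -/
def receive (m : State) (D : List DiagramPoint) : State where
  natVar := Function.update m.natVar 1 D.length
  realVar := m.realVar
  natArr a i k :=
    if h : k < D.length then
      if a = 0 ∧ i = 0 then D[k].dim
      else if a = 0 ∧ i = 1 then (if D[k].death = ⊤ then 1 else 0)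
      else m.natArr a i k
    else m.natArr a i k
  realArr a i k :=
    if h : k < D.length then
      if a = 0 ∧ i = 1 then D[k].birth
      else if a = 0 ∧ i = 2 then D[k].death.untopD 0
      else m.realArr a i k
    else m.realArr a i k

end State

/-- `Exec d O T p m m' t Q`: started in memory `m`, the program `p` halts in memory `m'` after `t`
steps, having consulted the oracle `O` in the directions listed in `Q`, in this order. A query takes
`T` steps, and is possible only in a direction of the unit sphere (otherwise the program is stuck). -/
inductive Exec (d : ℕ) (O : EuclideanSpace ℝ (Fin d) → List DiagramPoint) (T : ℕ) :
    Program → State → State → ℕ → List (EuclideanSpace ℝ (Fin d)) → Prop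
  | skip (m : State) : Exec d O T .skip m m 1 []
  | setNat (m : State) (x : ℕ) (e : NatExp) :
      Exec d O T (.setNat x e) m (m.setNat x (e.eval m)) (1 + e.cost) []
  | setReal (m : State) (x : ℕ) (e : RealExp) :
      Exec d O T (.setReal x e) m (m.setReal x (e.eval m)) (1 + e.cost) []
  | storeNat (m : State) (a : ℕ) (i j e : NatExp) :
      Exec d O T (.storeNat a i j e) m (m.storeNat a (i.eval m) (j.eval m) (e.eval m))
        (1 + i.cost + j.cost + e.cost) []
  | storeReal (m : State) (a : ℕ) (i j : NatExp) (e : RealExp) :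
      Exec d O T (.storeReal a i j e) m (m.storeReal a (i.eval m) (j.eval m) (e.eval m))
        (1 + i.cost + j.cost + e.cost) []
  | seq {p q : Program} {m m' m'' : State} {t t' : ℕ} {Q Q' : List (EuclideanSpace ℝ (Fin d))} :
      Exec d O T p m m' t Q → Exec d O T q m' m'' t' Q' →
      Exec d O T (.seq p q) m m'' (t + t') (Q ++ Q')
  | branchTrue {b : Test} {p q : Program} {m m' : State} {t : ℕ}
      {Q : List (EuclideanSpace ℝ (Fin d))} :
      b.holds m → Exec d O T p m m' t Q → Exec d O T (.branch b p q) m m' (1 + b.cost + t) Q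
  | branchFalse {b : Test} {p q : Program} {m m' : State} {t : ℕ}
      {Q : List (EuclideanSpace ℝ (Fin d))} :
      ¬ b.holds m → Exec d O T q m m' t Q → Exec d O T (.branch b p q) m m' (1 + b.cost + t) Q
  | loopStop {b : Test} {p : Program} {m : State} :
      ¬ b.holds m → Exec d O T (.loop b p) m m (1 + b.cost) []
  | loopStep {b : Test} {p : Program} {m m' m'' : State} {t t' : ℕ}
      {Q Q' : List (EuclideanSpace ℝ (Fin d))} :
      b.holds m → Exec d O T p m m' t Q → Exec d O T (.loop b p) m' m'' t' Q' →
      Exec d O T (.loop b p) m m'' (1 + b.cost + t + t') (Q ++ Q')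
  | query (m : State) : ‖m.direction d‖ = 1 →
      Exec d O T .query m (m.receive (O (m.direction d))) T [m.direction d]

/-- The memory `m` holds a description of the embedded graph `K`: the natural variable `2` holds the
number of vertices, row `i` of the real array `1` the coordinates of the `i`-th vertex, the natural
variable `3` the number of edges, and row `k` of the natural array `1` the indices of the two
endpoints of the `k`-th edge. Vertices and edges are each listed exactly once. -/
def State.Describes {V : Type*} {d : ℕ} (m : State) (K : EmbeddedGraph V d) : Prop :=
  ∃ (vertex : Fin (m.natVar 2) ≃ V) (edge : Fin (m.natVar 3) ≃ K.graph.edgeSet),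
    (∀ (i : Fin (m.natVar 2)) (j : Fin d), K.pos (vertex i) j = m.realArr 1 i j) ∧
    ∀ k : Fin (m.natVar 3), ∃ a b : Fin (m.natVar 2),
      m.natArr 1 k 0 = (a : ℕ) ∧ m.natArr 1 k 1 = (b : ℕ) ∧
        (edge k : Sym2 V) = s(vertex a, vertex b)

end GraphReconstruction

end

/-! The reconstruction rests on two facts about the filtration of a graph. Every vertex creates a
0-class, so the births of the 0-dimensional points are exactly the heights of the vertices. Every
edge either merges two components or closes a cycle, so the finite deaths in dimension 0 together
with the births in dimension 1 are exactly the heights of the edges. Both hold with multiplicity for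
every tie-breaking order (`IsGraphFiltration.births_zero`,
`IsGraphFiltration.deaths_zero_add_births_one`); the second is rank–nullity for the boundary map.

Vertices, with d + 1 directions. The coordinate axes reveal, for every i, the unordered list of all
i-th coordinates. From these lists one computes R ≥ 1 bounding all |x_i| and all inverses of nonzero
differences of i-th coordinates. One more query, in the direction of (1, b, b², …) with b = 1/(1 +
4R²), gives for every vertex the number x_0 + b x_1 + b² x_2 + …. All terms but the first add up to
less than 1/(2R) in absolute value, while different candidates for x_0 are at least 1/R apart. Hence
x_0 is the only value in its list within 1/(2R) of this number; subtracting it and dividing by b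
continues with x_1 (`close_tailSum_iff`). Each coordinate is found by searching one list, so no
combinations of candidates are enumerated.

Edges, with n(n - 1) directions. In the plane of the first two coordinates use the directions of (t,
1). Two vertices v, w are equally high at one parameter, their `slope`; by general position the
slopes of v with different partners differ. When t passes just over the slope of v and w, only w
changes sides relative to v, so the number of lower neighbours of v changes if and only if vw is an
edge (`EmbeddedGraph.GeneralPosition.adj_iff`). That number is read off a diagram as the number of
edges having the height of v, provided no other vertex has this height
(`EmbeddedGraph.IsDiagram.countP_lower`).

Different directions. Let δ > 0 not exceed any distance between different slopes, nor between a
slope and 0 or 1/b when these differ. The successive pairs use the offsets ±δ/r with r = 3, 4, 5, ….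
Directions belonging to equal slopes differ because r does; those belonging to different slopes
differ because the offsets are at most δ/3. The parameters 0 and 1/b belong to the second axis and,
if d = 2, to the oblique direction.

The program is verified with a small Hoare logic that bounds the running time and records the
queries. -/

noncomputable section

namespace GraphReconstruction

/-! ### A program logic for the real RAM -/

namespace Program

/-- The natural variables a program may change. -/
def natW : Program → List ℕ
  | setNat x _ => [x]
  | seq p q => p.natW ++ q.natW
  | branch _ p q => p.natW ++ q.natW
  | loop _ p => p.natW
  | query => [1]
  | _ => []

/-- The real variables a program may change. -/
def realW : Program → List ℕ
  | setReal x _ => [x]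
  | seq p q => p.realW ++ q.realW
  | branch _ p q => p.realW ++ q.realW
  | loop _ p => p.realW
  | _ => []

/-- The natural arrays a program may change. -/
def natA : Program → List ℕ
  | storeNat a _ _ _ => [a]
  | seq p q => p.natA ++ q.natA
  | branch _ p q => p.natA ++ q.natA
  | loop _ p => p.natA
  | query => [0]
  | _ => []

/-- The real arrays a program may change. -/
def realA : Program → List ℕ
  | storeReal a _ _ _ => [a]
  | seq p q => p.realA ++ q.realA
  | branch _ p q => p.realA ++ q.realA
  | loop _ p => p.realA
  | query => [0]
  | _ => []

/-- A counting loop: `x` runs through the natural numbers below the value of the variable `y`. -/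
def forLoop (x y : ℕ) (p : Program) : Program :=
  .seq (.setNat x (.const 0))
    (.loop (.natLt (.var x) (.var y)) (.seq p (.setNat x (.add (.var x) (.const 1)))))

end Program

/-- The memories `m` and `m'` agree outside of what the program `p` may change. -/
structure Frame (p : Program) (m m' : State) : Prop where
  nat : ∀ x, x ∉ p.natW → m'.natVar x = m.natVar x
  real : ∀ x, x ∉ p.realW → m'.realVar x = m.realVar x
  natArr : ∀ x, x ∉ p.natA → m'.natArr x = m.natArr x
  realArr : ∀ x, x ∉ p.realA → m'.realArr x = m.realArr x

theorem Frame.refl (p : Program) (m : State) : Frame p m m :=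
  ⟨fun _ _ => rfl, fun _ _ => rfl, fun _ _ => rfl, fun _ _ => rfl⟩

theorem Frame.comp {p q r : Program} {m m' m'' : State} (h : Frame p m m') (h' : Frame q m' m'')
    (n : ∀ x, x ∉ r.natW → x ∉ p.natW ∧ x ∉ q.natW)
    (n' : ∀ x, x ∉ r.realW → x ∉ p.realW ∧ x ∉ q.realW)
    (a : ∀ x, x ∉ r.natA → x ∉ p.natA ∧ x ∉ q.natA)
    (a' : ∀ x, x ∉ r.realA → x ∉ p.realA ∧ x ∉ q.realA) : Frame r m m'' where
  nat x hx := (h'.nat x (n x hx).2).trans (h.nat x (n x hx).1)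
  real x hx := (h'.real x (n' x hx).2).trans (h.real x (n' x hx).1)
  natArr x hx := (h'.natArr x (a x hx).2).trans (h.natArr x (a x hx).1)
  realArr x hx := (h'.realArr x (a' x hx).2).trans (h.realArr x (a' x hx).1)

theorem Frame.trans {p : Program} {m m' m'' : State} (h : Frame p m m') (h' : Frame p m' m'') :
    Frame p m m'' :=
  h.comp h' (fun _ h => ⟨h, h⟩) (fun _ h => ⟨h, h⟩) (fun _ h => ⟨h, h⟩) (fun _ h => ⟨h, h⟩)

theorem Frame.weaken {p q : Program} {m m' : State} (h : Frame p m m')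
    (n : ∀ x, x ∉ q.natW → x ∉ p.natW) (n' : ∀ x, x ∉ q.realW → x ∉ p.realW)
    (a : ∀ x, x ∉ q.natA → x ∉ p.natA) (a' : ∀ x, x ∉ q.realA → x ∉ p.realA) : Frame q m m' :=
  ⟨fun x hx => h.nat x (n x hx), fun x hx => h.real x (n' x hx),
    fun x hx => h.natArr x (a x hx), fun x hx => h.realArr x (a' x hx)⟩

section

variable {d : ℕ} {O : EuclideanSpace ℝ (Fin d) → List DiagramPoint} {T : ℕ}

/-- Write sets are syntactic, so preservation of a memory cell becomes a decidable membership
question, and loop invariants need to mention only what the loop changes. -/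
theorem Exec.frame {p : Program} {m m' : State} {t : ℕ} {Q : List (EuclideanSpace ℝ (Fin d))}
    (h : Exec d O T p m m' t Q) : Frame p m m' := by
  induction h with
  | skip m => exact Frame.refl _ _
  | setNat m x e =>
    refine ⟨fun y hy => ?_, fun _ _ => rfl, fun _ _ => rfl, fun _ _ => rfl⟩
    simp only [Program.natW, List.mem_singleton] at hy
    simp [State.setNat, hy]
  | setReal m x e =>
    refine ⟨fun _ _ => rfl, fun y hy => ?_, fun _ _ => rfl, fun _ _ => rfl⟩
    simp only [Program.realW, List.mem_singleton] at hy
    simp [State.setReal, hy]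
  | storeNat m a i j e =>
    refine ⟨fun _ _ => rfl, fun _ _ => rfl, fun y hy => ?_, fun _ _ => rfl⟩
    simp only [Program.natA, List.mem_singleton] at hy
    simp [State.storeNat, hy]
  | storeReal m a i j e =>
    refine ⟨fun _ _ => rfl, fun _ _ => rfl, fun _ _ => rfl, fun y hy => ?_⟩
    simp only [Program.realA, List.mem_singleton] at hy
    simp [State.storeReal, hy]
  | seq _ _ ih ih' =>
    refine ih.comp ih' ?_ ?_ ?_ ?_ <;>
      simp [Program.natW, Program.realW, Program.natA, Program.realA]
  | branchTrue _ _ ih =>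
    refine ih.weaken ?_ ?_ ?_ ?_ <;>
      simp +contextual [Program.natW, Program.realW, Program.natA, Program.realA]
  | branchFalse _ _ ih =>
    refine ih.weaken ?_ ?_ ?_ ?_ <;>
      simp +contextual [Program.natW, Program.realW, Program.natA, Program.realA]
  | loopStop => exact Frame.refl _ _
  | loopStep _ _ _ ih ih' =>
    refine ih.comp ih' ?_ ?_ ?_ ?_ <;>
      simp [Program.natW, Program.realW, Program.natA, Program.realA]
  | query m h =>
    refine ⟨fun y hy => ?_, fun _ _ => rfl, fun y hy => ?_, fun y hy => ?_⟩
    · simp only [Program.natW, List.mem_singleton] at hy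
      simp [State.receive, hy]
    · simp only [Program.natA, List.mem_singleton] at hy
      simp [State.receive, hy]
    · simp only [Program.realA, List.mem_singleton] at hy
      simp [State.receive, hy]

variable (d O T) in
/-- Started in `m`, the program `p` halts after at most `c` steps, in a memory and with a list of
queries that satisfy `P`. -/
def Runs (p : Program) (m : State) (c : ℕ)
    (P : State → List (EuclideanSpace ℝ (Fin d)) → Prop) : Prop :=
  ∃ m' t Q, Exec d O T p m m' t Q ∧ t ≤ c ∧ P m' Q

variable (d O T) in
/-- Started in `m`, the program `p` halts without any query after at most `c` steps, in a memory
that satisfies `P`. -/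
def Computes (p : Program) (m : State) (c : ℕ) (P : State → Prop) : Prop :=
  Runs d O T p m c fun m' Q => Q = [] ∧ P m'

theorem Runs.mono {p : Program} {m : State} {c c' : ℕ}
    {P P' : State → List (EuclideanSpace ℝ (Fin d)) → Prop}
    (h : Runs d O T p m c P) (hc : c ≤ c') (hP : ∀ m' Q, Frame p m m' → P m' Q → P' m' Q) :
    Runs d O T p m c' P' := by
  obtain ⟨m', t, Q, he, ht, hp⟩ := h
  exact ⟨m', t, Q, he, ht.trans hc, hP _ _ he.frame hp⟩

theorem Computes.mono {p : Program} {m : State} {c c' : ℕ} {P P' : State → Prop}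
    (h : Computes d O T p m c P) (hc : c ≤ c') (hP : ∀ m', Frame p m m' → P m' → P' m') :
    Computes d O T p m c' P' :=
  Runs.mono h hc fun _ _ hf hp => ⟨hp.1, hP _ hf hp.2⟩

theorem Runs.seq {p q : Program} {m : State} {c c' c'' : ℕ}
    {P P' : State → List (EuclideanSpace ℝ (Fin d)) → Prop}
    (h : Runs d O T p m c P)
    (h' : ∀ m' Q, Frame p m m' → P m' Q → Runs d O T q m' c' fun m'' Q' => P' m'' (Q ++ Q'))
    (hc : c + c' ≤ c'') : Runs d O T (.seq p q) m c'' P' := by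
  obtain ⟨m', t, Q, he, ht, hp⟩ := h
  obtain ⟨m'', t', Q', he', ht', hp'⟩ := h' m' Q he.frame hp
  exact ⟨m'', t + t', Q ++ Q', he.seq he', by omega, hp'⟩

theorem Computes.seq_runs {p q : Program} {m : State} {c c' c'' : ℕ} {P : State → Prop}
    {P' : State → List (EuclideanSpace ℝ (Fin d)) → Prop}
    (h : Computes d O T p m c P) (h' : ∀ m', Frame p m m' → P m' → Runs d O T q m' c' P')
    (hc : c + c' ≤ c'') : Runs d O T (.seq p q) m c'' P' :=
  Runs.seq h (fun m' Q hf hp => by obtain ⟨rfl, hp⟩ := hp; exact h' m' hf hp) hc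

theorem Computes.seq {p q : Program} {m : State} {c c' c'' : ℕ} {P P' : State → Prop}
    (h : Computes d O T p m c P) (h' : ∀ m', Frame p m m' → P m' → Computes d O T q m' c' P')
    (hc : c + c' ≤ c'') : Computes d O T (.seq p q) m c'' P' :=
  Computes.seq_runs h h' hc

theorem Runs.seq_computes {p q : Program} {m : State} {c c' c'' : ℕ}
    {P P' : State → List (EuclideanSpace ℝ (Fin d)) → Prop}
    (h : Runs d O T p m c P)
    (h' : ∀ m' Q, Frame p m m' → P m' Q → Computes d O T q m' c' fun m'' => P' m'' Q)
    (hc : c + c' ≤ c'') : Runs d O T (.seq p q) m c'' P' :=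
  h.seq (fun m' Q hf hp => Runs.mono (h' m' Q hf hp) le_rfl fun m'' Q' _ h => by
    obtain ⟨rfl, h⟩ := h; simpa using h) hc

theorem computes_skip {m : State} {c : ℕ} {P : State → Prop} (h : P m) (hc : 1 ≤ c) :
    Computes d O T .skip m c P :=
  ⟨_, _, _, .skip m, hc, rfl, h⟩

theorem computes_setNat {m : State} {x c : ℕ} {e : NatExp} {P : State → Prop}
    (h : P (m.setNat x (e.eval m))) (hc : 1 + e.cost ≤ c) :
    Computes d O T (.setNat x e) m c P :=
  ⟨_, _, _, .setNat m x e, hc, rfl, h⟩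

theorem computes_setReal {m : State} {x c : ℕ} {e : RealExp} {P : State → Prop}
    (h : P (m.setReal x (e.eval m))) (hc : 1 + e.cost ≤ c) :
    Computes d O T (.setReal x e) m c P :=
  ⟨_, _, _, .setReal m x e, hc, rfl, h⟩

theorem computes_storeReal {m : State} {a c : ℕ} {i j : NatExp} {e : RealExp} {P : State → Prop}
    (h : P (m.storeReal a (i.eval m) (j.eval m) (e.eval m)))
    (hc : 1 + i.cost + j.cost + e.cost ≤ c) : Computes d O T (.storeReal a i j e) m c P :=
  ⟨_, _, _, .storeReal m a i j e, hc, rfl, h⟩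

theorem computes_branch {m : State} {b : Test} {p q : Program} {c c' : ℕ} {P : State → Prop}
    (h : b.holds m → Computes d O T p m c P) (h' : ¬ b.holds m → Computes d O T q m c P)
    (hc : 1 + b.cost + c ≤ c') : Computes d O T (.branch b p q) m c' P := by
  by_cases hb : b.holds m
  · obtain ⟨m', t, Q, he, ht, hp⟩ := h hb
    exact ⟨m', _, Q, .branchTrue hb he, by omega, hp⟩
  · obtain ⟨m', t, Q, he, ht, hp⟩ := h' hb
    exact ⟨m', _, Q, .branchFalse hb he, by omega, hp⟩

theorem runs_setNat_seq {m : State} {x c c' : ℕ} {e : NatExp} {q : Program}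
    {P : State → List (EuclideanSpace ℝ (Fin d)) → Prop}
    (h : Runs d O T q (m.setNat x (e.eval m)) c P) (hc : 1 + e.cost + c ≤ c') :
    Runs d O T (.seq (.setNat x e) q) m c' P :=
  have ⟨m', t, Q, he, ht, hp⟩ := h
  ⟨m', _, Q, .seq (.setNat _ _ _) he, by omega, hp⟩

theorem runs_setReal_seq {m : State} {x c c' : ℕ} {e : RealExp} {q : Program}
    {P : State → List (EuclideanSpace ℝ (Fin d)) → Prop}
    (h : Runs d O T q (m.setReal x (e.eval m)) c P) (hc : 1 + e.cost + c ≤ c') :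
    Runs d O T (.seq (.setReal x e) q) m c' P :=
  have ⟨m', t, Q, he, ht, hp⟩ := h
  ⟨m', _, Q, .seq (.setReal _ _ _) he, by omega, hp⟩

theorem runs_storeNat_seq {m : State} {a c c' : ℕ} {i j e : NatExp} {q : Program}
    {P : State → List (EuclideanSpace ℝ (Fin d)) → Prop}
    (h : Runs d O T q (m.storeNat a (i.eval m) (j.eval m) (e.eval m)) c P)
    (hc : 1 + i.cost + j.cost + e.cost + c ≤ c') :
    Runs d O T (.seq (.storeNat a i j e) q) m c' P :=
  have ⟨m', t, Q, he, ht, hp⟩ := h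
  ⟨m', _, Q, .seq (.storeNat _ _ _ _ _) he, by omega, hp⟩

theorem runs_storeReal_seq {m : State} {a c c' : ℕ} {i j : NatExp} {e : RealExp} {q : Program}
    {P : State → List (EuclideanSpace ℝ (Fin d)) → Prop}
    (h : Runs d O T q (m.storeReal a (i.eval m) (j.eval m) (e.eval m)) c P)
    (hc : 1 + i.cost + j.cost + e.cost + c ≤ c') :
    Runs d O T (.seq (.storeReal a i j e) q) m c' P :=
  have ⟨m', t, Q, he, ht, hp⟩ := h
  ⟨m', _, Q, .seq (.storeReal _ _ _ _ _) he, by omega, hp⟩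

theorem runs_query {m : State} {c : ℕ} {P : State → List (EuclideanSpace ℝ (Fin d)) → Prop}
    (hm : ‖m.direction d‖ = 1)
    (h : P (m.receive (O (m.direction d))) [m.direction d]) (hc : T ≤ c) :
    Runs d O T .query m c P :=
  ⟨_, _, _, .query m hm, hc, h⟩

/-- Induction on the number `r` of remaining rounds. A round costs 4 for the test and 4 for the
increment besides the body; the last, failing test costs 4. The invariant is required after the
increment, hence the `setNat` in `hstep`. -/
theorem runs_loop {x y : ℕ} {p : Program} {m₀ : State} {N c : ℕ}
    (hx : x ∉ p.natW) (hy : y ∉ p.natW) (hxy : y ≠ x)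
    (I : ℕ → State → List (EuclideanSpace ℝ (Fin d)) → Prop)
    (hstep : ∀ k < N, ∀ m Q, Frame (.forLoop x y p) m₀ m → m.natVar x = k → m.natVar y = N →
      I k m Q → Runs d O T p m c fun m' Q' => I (k + 1) (m'.setNat x (k + 1)) (Q ++ Q'))
    (r : ℕ) : ∀ k, k + r = N → ∀ m Q, Frame (.forLoop x y p) m₀ m → m.natVar x = k →
      m.natVar y = N → I k m Q →
      Runs d O T (.loop (.natLt (.var x) (.var y))
        (.seq p (.setNat x (.add (.var x) (.const 1))))) m (4 + r * (c + 8))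
        fun m' Q' => m'.natVar x = N ∧ I N m' (Q ++ Q') := by
  induction r with
  | zero =>
    rintro k rfl m Q - hmx hmy hI
    refine ⟨m, _, _, .loopStop ?_, ?_, hmx, by simpa using hI⟩
    · simp [Test.holds, NatExp.eval, hmx, hmy]
    · simp [Test.cost, NatExp.cost]
  | succ r ih =>
    intro k hk m Q hf hmx hmy hI
    obtain ⟨m', t, Q', he, ht, hp⟩ := hstep k (by omega) m Q hf hmx hmy hI
    have hx' : m'.natVar x = k := (he.frame.nat x hx).trans hmx
    have hy' : m'.natVar y = N := (he.frame.nat y hy).trans hmy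
    have he2 := he.seq (.setNat (O := O) (T := T) m' x (.add (.var x) (.const 1)))
    have hval : (NatExp.add (.var x) (.const 1)).eval m' = k + 1 := by simp [NatExp.eval, hx']
    rw [hval] at he2
    have hf2 : Frame (.forLoop x y p) m (m'.setNat x (k + 1)) := by
      refine he2.frame.weaken ?_ ?_ ?_ ?_ <;>
        simp [Program.forLoop, Program.natW, Program.realW, Program.natA, Program.realA]
    obtain ⟨m'', t'', Q'', he', ht', hp'⟩ := ih (k + 1) (by omega) (m'.setNat x (k + 1)) (Q ++ Q')
      (hf.trans hf2) (by simp [State.setNat]) (by simp [State.setNat, hxy, hy']) hp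
    refine ⟨m'', _, _, .loopStep ?_ he2 he', ?_, ?_⟩
    · simp only [Test.holds, NatExp.eval, hmx, hmy]; omega
    · simp only [Test.cost, NatExp.cost]
      have : (r + 1) * (c + 8) = r * (c + 8) + c + 8 := by ring
      omega
    · simpa using hp'

/-- The overhead 6 consists of 2 steps for the initialization of the counter and 4 for the last
test. -/
theorem runs_forLoop {x y : ℕ} {p : Program} {m₀ : State} {N c c' : ℕ}
    {P : State → List (EuclideanSpace ℝ (Fin d)) → Prop}
    (I : ℕ → State → List (EuclideanSpace ℝ (Fin d)) → Prop)
    (hN : m₀.natVar y = N) (hx : x ∉ p.natW) (hy : y ∉ p.natW) (hxy : y ≠ x)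
    (h0 : I 0 (m₀.setNat x 0) [])
    (hstep : ∀ k < N, ∀ m Q, Frame (.forLoop x y p) m₀ m → m.natVar x = k → m.natVar y = N →
      I k m Q → Runs d O T p m c fun m' Q' => I (k + 1) (m'.setNat x (k + 1)) (Q ++ Q'))
    (hP : ∀ m Q, Frame (.forLoop x y p) m₀ m → m.natVar x = N → I N m Q → P m Q)
    (hc : 6 + N * (c + 8) ≤ c') : Runs d O T (.forLoop x y p) m₀ c' P := by
  have h : Runs d O T (.forLoop x y p) m₀ (2 + (4 + N * (c + 8)))
      fun m' Q' => m'.natVar x = N ∧ I N m' Q' := by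
    refine Computes.seq_runs (c := 2) (P := fun m => m = m₀.setNat x 0)
      (computes_setNat rfl (by simp [NatExp.cost])) ?_ le_rfl
    rintro _ hf rfl
    refine (runs_loop hx hy hxy I hstep N 0 (by omega) _ [] ?_ ?_ ?_ h0).mono le_rfl
      fun _ _ _ h => by simpa using h
    · refine hf.weaken ?_ ?_ ?_ ?_ <;>
        simp +contextual [Program.forLoop, Program.natW, Program.realW, Program.natA, Program.realA]
    · simp [State.setNat]
    · simp [State.setNat, hxy, hN]
  exact h.mono (by omega) fun m' Q hf h => hP m' Q hf h.1 h.2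

theorem computes_forLoop {x y : ℕ} {p : Program} {m₀ : State} {N c c' : ℕ} {P : State → Prop}
    (I : ℕ → State → Prop)
    (hN : m₀.natVar y = N) (hx : x ∉ p.natW) (hy : y ∉ p.natW) (hxy : y ≠ x)
    (h0 : I 0 (m₀.setNat x 0))
    (hstep : ∀ k < N, ∀ m, Frame (.forLoop x y p) m₀ m → m.natVar x = k → m.natVar y = N →
      I k m → Computes d O T p m c fun m' => I (k + 1) (m'.setNat x (k + 1)))
    (hP : ∀ m, Frame (.forLoop x y p) m₀ m → m.natVar x = N → I N m → P m)
    (hc : 6 + N * (c + 8) ≤ c') : Computes d O T (.forLoop x y p) m₀ c' P := by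
  refine runs_forLoop (fun k m Q => Q = [] ∧ I k m) hN hx hy hxy ⟨rfl, h0⟩ ?_
    (fun m Q hf hm h => ⟨h.1, hP m hf hm h.2⟩) hc
  rintro k hk m Q hf hmx hmy ⟨rfl, h⟩
  exact Runs.mono (hstep k hk m hf hmx hmy h) le_rfl fun m' Q' _ h => h

/-- A loop that adds `f k` to a real variable in its `k`-th round. -/
theorem computes_sum {x y z : ℕ} {p : Program} {m₀ : State} {N c c' : ℕ} (f : ℕ → ℝ)
    (hN : m₀.natVar y = N) (hx : x ∉ p.natW) (hy : y ∉ p.natW) (hxy : y ≠ x)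
    (hstep : ∀ k < N, ∀ m, Frame (.forLoop x y p) m₀ m → m.natVar x = k → m.natVar y = N →
      Computes d O T p m c fun m' => m'.realVar z = m.realVar z + f k)
    (hc : 6 + N * (c + 8) ≤ c') :
    Computes d O T (.forLoop x y p) m₀ c'
      fun m' => m'.realVar z = m₀.realVar z + ∑ k ∈ Finset.range N, f k := by
  refine computes_forLoop
    (fun k m => m.realVar z = m₀.realVar z + ∑ k ∈ Finset.range k, f k) hN hx hy hxy ?_ ?_
    (fun m _ _ h => h) hc
  · simp [State.setNat]
  · intro k hk m hf hmx hmy h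
    refine (hstep k hk m hf hmx hmy).mono le_rfl fun m' _ h' => ?_
    change m'.realVar z = _
    rw [h', h, Finset.sum_range_succ, add_assoc]

end

/-! ### Memory cells after an update. -/

namespace State

@[simp] theorem setNat_natVar (m : State) (x c y : ℕ) :
    (m.setNat x c).natVar y = if y = x then c else m.natVar y := by
  simp [setNat, Function.update_apply]
@[simp] theorem setNat_realVar (m : State) (x c : ℕ) : (m.setNat x c).realVar = m.realVar := rfl
@[simp] theorem setNat_natArr (m : State) (x c : ℕ) : (m.setNat x c).natArr = m.natArr := rfl
@[simp] theorem setNat_realArr (m : State) (x c : ℕ) : (m.setNat x c).realArr = m.realArr := rfl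
@[simp] theorem setReal_realVar (m : State) (x : ℕ) (c : ℝ) (y : ℕ) :
    (m.setReal x c).realVar y = if y = x then c else m.realVar y := by
  simp [setReal, Function.update_apply]
@[simp] theorem setReal_natVar (m : State) (x : ℕ) (c : ℝ) :
    (m.setReal x c).natVar = m.natVar := rfl
@[simp] theorem setReal_realArr (m : State) (x : ℕ) (c : ℝ) :
    (m.setReal x c).realArr = m.realArr := rfl
@[simp] theorem storeNat_natArr (m : State) (a i j c a' i' j' : ℕ) :
    (m.storeNat a i j c).natArr a' i' j' =
      if a' = a ∧ i' = i ∧ j' = j then c else m.natArr a' i' j' := rfl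
@[simp] theorem storeNat_natVar (m : State) (a i j c : ℕ) :
    (m.storeNat a i j c).natVar = m.natVar := rfl
@[simp] theorem storeReal_realArr (m : State) (a i j : ℕ) (c : ℝ) (a' i' j' : ℕ) :
    (m.storeReal a i j c).realArr a' i' j' =
      if a' = a ∧ i' = i ∧ j' = j then c else m.realArr a' i' j' := rfl
@[simp] theorem storeReal_natVar (m : State) (a i j : ℕ) (c : ℝ) :
    (m.storeReal a i j c).natVar = m.natVar := rfl
@[simp] theorem storeReal_realVar (m : State) (a i j : ℕ) (c : ℝ) :
    (m.storeReal a i j c).realVar = m.realVar := rfl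

end State

attribute [simp] NatExp.eval NatExp.cost RealExp.eval RealExp.cost Test.holds Test.cost

/-! ### Counting the points of a diagram -/

section Homology

open Module

variable {V : Type*}

theorem pairwise_getElem_lt {α : Type*} {R : α → α → Prop} {L : List α} (h : L.Pairwise R)
    {i j : ℕ} (hi : i < L.length) (hj : j < L.length) (hij : i < j) : R L[i] L[j] :=
  List.pairwise_iff_getElem.1 h i j hi hj hij

/-- The list of simplices is a filtration of a graph: simplices have one or two vertices, and the
vertices of an edge precede it. -/
structure IsGraphFiltration (L : List (Finset V)) : Prop where
  nodup : L.Nodup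
  card : ∀ σ ∈ L, σ.card = 1 ∨ σ.card = 2
  face : ∀ (j : ℕ) (hj : j < L.length), L[j].card = 2 → ∀ τ : Finset V, τ.card = 1 → τ ⊆ L[j] →
    τ ∈ stage L j

variable {L : List (Finset V)}

theorem stage_mono (L : List (Finset V)) {i j : ℕ} (h : i ≤ j) : stage L i ⊆ stage L j :=
  fun _ hσ => List.take_subset_take_left L h hσ

theorem stage_succ {i : ℕ} (hi : i < L.length) : stage L (i + 1) = insert L[i] (stage L i) := by
  ext σ
  simp only [stage, Set.mem_ofPred_eq, Set.mem_insert_iff]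
  rw [List.take_succ_eq_append_getElem hi, List.mem_append, List.mem_singleton, or_comm]

theorem stage_zero : stage L 0 = ∅ := by
  ext σ; simp [stage]

theorem mem_of_mem_stage {i : ℕ} {σ : Finset V} (h : σ ∈ stage L i) : σ ∈ L :=
  List.mem_of_mem_take h

theorem IsGraphFiltration.notMem_stage (h : IsGraphFiltration L) {i : ℕ} (hi : i < L.length) :
    L[i] ∉ stage L i := by
  intro hm
  obtain ⟨k, hk, hk'⟩ := List.mem_take_iff_getElem.1 hm
  have := (List.Nodup.getElem_inj_iff h.nodup).1 hk'
  omega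

theorem chains_mono (k : ℕ) {S S' : Set (Finset V)} (h : S ⊆ S') : chains k S ≤ chains k S' :=
  Finsupp.supported_mono fun _ hσ => ⟨h hσ.1, hσ.2⟩

theorem cycles_mono (k : ℕ) {S S' : Set (Finset V)} (h : S ⊆ S') : cycles k S ≤ cycles k S' :=
  inf_le_inf_right _ (chains_mono k h)

theorem boundaries_mono (k : ℕ) {S S' : Set (Finset V)} (h : S ⊆ S') :
    boundaries k S ≤ boundaries k S' :=
  Submodule.map_mono (chains_mono _ h)

theorem finrank_chains (k : ℕ) (S : Set (Finset V)) [Finite V] :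
    finrank (ZMod 2) (chains k S) = {σ | σ ∈ S ∧ σ.card = k + 1}.ncard := by
  classical
  have := Fintype.ofFinite V
  rw [chains, (Finsupp.supportedEquivFinsupp _).finrank_eq, Set.ncard_eq_toFinset_card',
    Set.toFinset_card, finrank_finsupp_self]

theorem chains_insert_of_card_ne {k : ℕ} {S : Set (Finset V)} {σ : Finset V}
    (h : σ.card ≠ k + 1) : chains k (insert σ S) = chains k S := by
  unfold chains
  congr 1
  ext τ
  simp only [Set.mem_insert_iff, Set.mem_ofPred_eq]
  constructor
  · rintro ⟨rfl | h', h''⟩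
    · exact absurd h'' h
    · exact ⟨h', h''⟩
  · exact fun h' => ⟨.inr h'.1, h'.2⟩

theorem finrank_chains_insert [Finite V] {k : ℕ} {S : Set (Finset V)} {σ : Finset V}
    (h : σ.card = k + 1) (hσ : σ ∉ S) :
    finrank (ZMod 2) (chains k (insert σ S)) = finrank (ZMod 2) (chains k S) + 1 := by
  rw [finrank_chains, finrank_chains, ← Set.ncard_insert_of_notMem (a := σ) (fun h' => hσ h'.1)]
  congr 1
  ext τ
  simp only [Set.mem_insert_iff, Set.mem_ofPred_eq]
  constructor
  · rintro ⟨rfl | h', h''⟩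
    · exact .inl rfl
    · exact .inr ⟨h', h''⟩
  · rintro (rfl | h')
    · exact ⟨.inl rfl, h⟩
    · exact ⟨.inr h'.1, h'.2⟩

/-- The boundary map is unaugmented and kills vertices. -/
theorem cycles_zero (S : Set (Finset V)) : cycles 0 S = chains 0 S := by
  rw [cycles, inf_eq_left, chains, Finsupp.supported_eq_span_single, Submodule.span_le]
  rintro _ ⟨σ, hσ, rfl⟩
  have h : σ.card ≤ 1 := hσ.2.le
  simp [boundary, h]

theorem boundaries_zero_le {S S' : Set (Finset V)}
    (h : ∀ σ ∈ S, σ.card = 2 → ∀ τ : Finset V, τ.card = 1 → τ ⊆ σ → τ ∈ S') :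
    boundaries 0 S ≤ cycles 0 S' := by
  classical
  rw [cycles_zero, boundaries, Submodule.map_le_iff_le_comap, chains,
    Finsupp.supported_eq_span_single, Submodule.span_le]
  rintro _ ⟨σ, hσ, rfl⟩
  have h2 : σ.card = 2 := hσ.2
  have h1 : ¬ σ.card ≤ 1 := by omega
  simp only [boundary, Submodule.comap_coe, Set.mem_preimage, SetLike.mem_coe,
    Finsupp.linearCombination_single, h1, if_false, one_smul]
  refine Submodule.sum_mem _ fun v hv => ?_
  have hc : (σ.erase v).card = 1 := by rw [Finset.card_erase_of_mem hv, h2]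
  have := Finsupp.single_mem_supported (ZMod 2) (1 : ZMod 2)
    (s := {σ | σ ∈ S' ∧ σ.card = 0 + 1}) (a := σ.erase v) ⟨h σ hσ.1 h2 _ hc (σ.erase_subset v), hc⟩
  rw [chains]
  convert! this

/-- Rank–nullity for the boundary map restricted to the 1-chains. -/
theorem finrank_boundaries_add_finrank_cycles [Finite V] (S : Set (Finset V)) :
    finrank (ZMod 2) (boundaries 0 S) + finrank (ZMod 2) (cycles 1 S) =
      finrank (ZMod 2) (chains 1 S) := by
  have := Fintype.ofFinite V
  have h := LinearMap.finrank_range_add_finrank_ker (K := ZMod 2) (V := chains 1 S)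
    (V₂ := Chain V) ((boundary V).domRestrict (chains 1 S))
  have hle : cycles 1 S ≤ chains 1 S := inf_le_left
  have hker : LinearMap.ker ((boundary V).domRestrict (chains 1 S)) =
      Submodule.comap (chains 1 S).subtype (cycles 1 S) := by
    ext x
    simp [cycles]
  rw [LinearMap.range_domRestrict, hker, (Submodule.comapSubtypeEquivOfLe hle).finrank_eq] at h
  exact h

/-- A graph has no 2-simplices; consequently its 1-classes never die. -/
theorem boundaries_one_eq_bot {S : Set (Finset V)} (h : ∀ σ ∈ S, σ.card = 1 ∨ σ.card = 2) :
    boundaries 1 S = ⊥ := by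
  have : chains 2 S = ⊥ := by
    rw [chains, ← Finsupp.supported_empty]
    congr 1
    ext σ
    simp only [Set.mem_ofPred_eq, Set.mem_empty_iff_false, iff_false, not_and]
    intro hσ h'
    rcases h σ hσ with h'' | h'' <;> omega
  rw [boundaries, this, Submodule.map_bot]

/-! ### Persistent Betti numbers and pairing multiplicities of a graph filtration. -/

section Multiplicities

theorem persistentBetti_of_le {k : ℕ} {S S' : Set (Finset V)}
    (h : boundaries k S' ≤ cycles k S) : persistentBetti k S S' =
      (finrank (ZMod 2) (cycles k S) : ℤ) - finrank (ZMod 2) (boundaries k S') := by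
  rw [persistentBetti, inf_eq_right.2 h]

theorem persistentBetti_congr {k : ℕ} {S S₁ S' : Set (Finset V)}
    (h : cycles k S = cycles k S₁) : persistentBetti k S S' = persistentBetti k S₁ S' := by
  rw [persistentBetti, h, persistentBetti]

theorem IsGraphFiltration.boundaries_le (h : IsGraphFiltration L) {i : ℕ} (hi : i ≤ L.length) :
    boundaries 0 (stage L i) ≤ cycles 0 (stage L i) := by
  refine boundaries_zero_le fun σ hσ hc τ hτ hs => ?_
  obtain ⟨k, hk, rfl⟩ := List.mem_take_iff_getElem.1 hσ
  exact stage_mono L (by omega) (h.face k (by omega) hc τ hτ hs)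

/-- If `L[i]` is an edge, its end points come strictly before it, so its boundary is already a chain
of the previous stage. -/
theorem IsGraphFiltration.boundaries_succ_le (h : IsGraphFiltration L) {i : ℕ}
    (hi : i < L.length) : boundaries 0 (stage L (i + 1)) ≤ cycles 0 (stage L i) := by
  refine boundaries_zero_le fun σ hσ hc τ hτ hs => ?_
  obtain ⟨k, hk, rfl⟩ := List.mem_take_iff_getElem.1 hσ
  exact stage_mono L (by omega) (h.face k (by omega) hc τ hτ hs)

theorem IsGraphFiltration.persistentBetti_one (h : IsGraphFiltration L) (S : Set (Finset V))
    (j : ℕ) : persistentBetti 1 S (stage L j) = finrank (ZMod 2) (cycles 1 S) := by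
  rw [persistentBetti, boundaries_one_eq_bot fun σ hσ => h.card σ (mem_of_mem_stage hσ)]
  simp

variable [Finite V]

/-- The dimension of `Z ∩ B` is supermodular in `Z` and `B`. -/
theorem finrank_inf_supermodular {Z Z' B B' : Submodule (ZMod 2) (Chain V)} (hZ : Z ≤ Z')
    (hB : B ≤ B') :
    finrank (ZMod 2) (Z ⊓ B' : Submodule (ZMod 2) (Chain V)) +
      finrank (ZMod 2) (Z' ⊓ B : Submodule (ZMod 2) (Chain V)) ≤
    finrank (ZMod 2) (Z' ⊓ B' : Submodule (ZMod 2) (Chain V)) +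
      finrank (ZMod 2) (Z ⊓ B : Submodule (ZMod 2) (Chain V)) := by
  have := Fintype.ofFinite V
  -- The dimension formula for the subspaces Z ∩ B' and Z' ∩ B: their sum lies in Z' ∩ B', and their
  -- intersection is Z ∩ B.
  rw [← Submodule.finrank_sup_add_finrank_inf_eq]
  have h : (Z ⊓ B') ⊓ (Z' ⊓ B) = Z ⊓ B := by
    apply le_antisymm
    · exact le_inf (inf_le_left.trans inf_le_left) (inf_le_right.trans inf_le_right)
    · exact le_inf (inf_le_inf_left _ hB) (inf_le_inf_right _ hZ)
  rw [h]
  gcongr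
  exact Submodule.finrank_mono (sup_le (inf_le_inf_right _ hZ) (inf_le_inf_left _ hB))

/-- Supermodularity makes the alternating sum non-negative, so the truncation by `toNat` loses
nothing. -/
theorem pairMult_eq {k i j : ℕ} :
    (pairMult L k i j : ℤ) =
      ((persistentBetti k (stage L (i + 1)) (stage L j) -
        persistentBetti k (stage L (i + 1)) (stage L (j + 1))) -
      (persistentBetti k (stage L i) (stage L j) -
        persistentBetti k (stage L i) (stage L (j + 1)))) := by
  have := finrank_inf_supermodular (cycles_mono k (stage_mono L (Nat.le_succ i)))
    (boundaries_mono k (stage_mono L (Nat.le_succ j)))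
  rw [pairMult, Int.toNat_of_nonneg]
  simp only [persistentBetti, Nat.succ_eq_add_one] at *
  omega

theorem essentialMult_eq {k i : ℕ} :
    (essentialMult L k i : ℤ) =
      persistentBetti k (stage L (i + 1)) (stage L L.length) -
        persistentBetti k (stage L i) (stage L L.length) := by
  -- With `⊤` as the larger space, supermodularity says that Z ∩ B grows by at most as much as Z
  -- does.
  have h := finrank_inf_supermodular (cycles_mono k (stage_mono L (Nat.le_succ i)))
    (le_top : boundaries k (stage L L.length) ≤ ⊤)
  rw [inf_top_eq, inf_top_eq] at h
  rw [essentialMult, Int.toNat_of_nonneg]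
  simp only [persistentBetti, Nat.succ_eq_add_one] at *
  omega

/-- The number of classes born with `L[i]` that die with one of the simplices from `L[a]` up to
before `L[b]`. -/
theorem sum_pairMult_right {k i a b : ℕ} (h : a ≤ b) :
    ((∑ j ∈ Finset.Ico a b, pairMult L k i j : ℕ) : ℤ) =
      (persistentBetti k (stage L (i + 1)) (stage L a) -
        persistentBetti k (stage L (i + 1)) (stage L b)) -
      (persistentBetti k (stage L i) (stage L a) - persistentBetti k (stage L i) (stage L b)) := by
  induction b, h using Nat.le_induction with
  | base => simp
  | succ b hab ih => rw [Finset.sum_Ico_succ_top hab, Nat.cast_add, ih, pairMult_eq]; ring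

/-- Telescoping over the births: these are the classes killed by `L[j]` and born before `L[b]`. -/
theorem sum_pairMult_left {k j b : ℕ} :
    ((∑ i ∈ Finset.range b, pairMult L k i j : ℕ) : ℤ) =
      (persistentBetti k (stage L b) (stage L j) - persistentBetti k (stage L b) (stage L (j + 1))) -
      (persistentBetti k (stage L 0) (stage L j) -
        persistentBetti k (stage L 0) (stage L (j + 1))) := by
  induction b with
  | zero => simp
  | succ b ih => rw [Finset.sum_range_succ, Nat.cast_add, ih, pairMult_eq]; ring

/-- Every vertex gives birth to a `0`-class, and no edge does. -/
theorem IsGraphFiltration.births_zero (h : IsGraphFiltration L) {i : ℕ} (hi : i < L.length) :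
    essentialMult L 0 i + ∑ j ∈ Finset.Ico (i + 1) L.length, pairMult L 0 i j =
      if L[i].card = 1 then 1 else 0 := by
  apply Int.natCast_inj.1
  -- Writing β(a, b) for the persistent Betti number from stage a to stage b, the total is β(i + 1,
  -- i + 1) - β(i, i + 1). The boundaries in both terms are the same, so only the growth of the
  -- cycles remains.
  rw [Nat.cast_add, essentialMult_eq, sum_pairMult_right (by omega)]
  have hs := stage_succ hi
  rcases h.card _ (List.getElem_mem hi) with hc | hc
  · rw [if_pos hc]
    have hB : boundaries 0 (stage L (i + 1)) ≤ cycles 0 (stage L i) := h.boundaries_succ_le hi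
    have hZ := cycles_mono 0 (stage_mono L (Nat.le_succ i))
    rw [persistentBetti_of_le hB, persistentBetti_of_le (hB.trans hZ), cycles_zero, cycles_zero, hs, finrank_chains_insert (by omega) (h.notMem_stage hi)]
    push_cast
    ring
  · have hZ : cycles 0 (stage L (i + 1)) = cycles 0 (stage L i) := by
      rw [cycles_zero, cycles_zero, hs, chains_insert_of_card_ne (by omega)]
    rw [if_neg (by omega)]
    rw [persistentBetti_congr hZ, persistentBetti_congr hZ]
    simp

theorem IsGraphFiltration.pairMult_one (h : IsGraphFiltration L) (i j : ℕ) :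
    pairMult L 1 i j = 0 := by
  zify
  rw [pairMult_eq]
  simp [h.persistentBetti_one]

/-- Every edge either kills a `0`-class or gives birth to a `1`-class, and no vertex does either. -/
theorem IsGraphFiltration.deaths_zero_add_births_one (h : IsGraphFiltration L) {j : ℕ}
    (hj : j < L.length) :
    ∑ i ∈ Finset.range j, pairMult L 0 i j + essentialMult L 1 j =
      if L[j].card = 2 then 1 else 0 := by
  apply Int.natCast_inj.1
  rw [Nat.cast_add, essentialMult_eq, sum_pairMult_left, h.persistentBetti_one,
    h.persistentBetti_one]
  have h0 : cycles 0 (stage L 0) = ⊥ := by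
    rw [cycles_zero, stage_zero, chains]
    simp
  -- The deaths telescope to the growth of the 0-boundaries, the births are the growth of the
  -- 1-cycles; by rank–nullity they add up to the growth of the 1-chains.
  have e1 := finrank_boundaries_add_finrank_cycles (stage L j)
  have e2 := finrank_boundaries_add_finrank_cycles (stage L (j + 1))
  have e0 : ∀ S' : Set (Finset V), persistentBetti 0 (stage L 0) S' = 0 := by
    intro S'
    rw [persistentBetti, h0, bot_inf_eq, sub_self]
  rw [e0, e0, persistentBetti_of_le (h.boundaries_succ_le hj),
    persistentBetti_of_le (h.boundaries_le hj.le)]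
  have e3 : finrank (ZMod 2) (chains 1 (stage L (j + 1))) =
      finrank (ZMod 2) (chains 1 (stage L j)) + if L[j].card = 2 then 1 else 0 := by
    rw [stage_succ hj]
    split_ifs with hc
    · rw [finrank_chains_insert (by omega) (h.notMem_stage hj)]
    · rw [chains_insert_of_card_ne (by omega), add_zero]
  split_ifs at * <;> push_cast <;> omega

end Multiplicities

end Homology

/-! ### Counting diagram points by their values. -/

section Counting

variable {V : Type*} {d : ℕ}

theorem countP_diagramOfOrder (L : List (Finset V)) (f : Finset V → ℝ) (P : DiagramPoint → Prop)
    [DecidablePred P] :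
    (diagramOfOrder L f).countP P = ∑ k : Fin 2, ∑ i : Fin L.length,
      ((if P ⟨k, f L[i], ⊤⟩ then essentialMult L k i else 0) +
        ∑ j ∈ Finset.univ.filter (fun j : Fin L.length => i < j),
          if P ⟨k, f L[i], (f L[j] : ℝ)⟩ then pairMult L k i j else 0) := by
  have hs : ∀ {ι : Type} (s : Finset ι) (g : ι → Multiset DiagramPoint),
      (∑ i ∈ s, g i).countP P = ∑ i ∈ s, (g i).countP P :=
    fun s g => map_sum (Multiset.countPAddMonoidHom P) g s
  have hr : ∀ (n : ℕ) (x : DiagramPoint),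
      (Multiset.replicate n x).countP P = if P x then n else 0 := by
    intro n x
    induction n with
    | zero => simp
    | succ n ih => rw [Multiset.replicate_succ, Multiset.countP_cons, ih]; split_ifs <;> rfl
  simp only [diagramOfOrder, hs, Multiset.countP_add, hr]

theorem sum_getElem_eq_sum_toFinset [DecidableEq V] {L : List (Finset V)} (h : L.Nodup)
    (g : Finset V → ℕ) : ∑ i : Fin L.length, g L[i] = ∑ σ ∈ L.toFinset, g σ := by
  rw [List.sum_toFinset g h, ← Fin.sum_univ_fun_getElem]
  rfl

theorem sum_fin_filter_lt {N : ℕ} (i : Fin N) (g : ℕ → ℕ) :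
    ∑ j ∈ Finset.univ.filter (fun j : Fin N => i < j), g j =
      ∑ j ∈ Finset.Ico (i + 1 : ℕ) N, g j := by
  refine Finset.sum_bij (fun j _ => (j : ℕ)) ?_ ?_ ?_ ?_
  · intro j hj
    have := (Finset.mem_filter.1 hj).2
    simp only [Finset.mem_Ico]
    exact ⟨this, j.2⟩
  · intro a _ b _ h
    exact Fin.ext h
  · intro b hb
    rw [Finset.mem_Ico] at hb
    exact ⟨⟨b, hb.2⟩, Finset.mem_filter.2 ⟨Finset.mem_univ _, Fin.lt_def.2 hb.1⟩, rfl⟩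
  · intro _ _
    rfl

theorem sum_fin_filter_gt {N : ℕ} (j : Fin N) (g : ℕ → ℕ) :
    ∑ i ∈ Finset.univ.filter (fun i : Fin N => i < j), g i = ∑ i ∈ Finset.range j, g i := by
  refine Finset.sum_bij (fun j _ => (j : ℕ)) ?_ ?_ ?_ ?_
  · intro j hj
    have := (Finset.mem_filter.1 hj).2
    simp only [Finset.mem_range]
    exact this
  · intro a _ b _ h
    exact Fin.ext h
  · intro b hb
    rw [Finset.mem_range] at hb
    exact ⟨⟨b, hb.trans j.2⟩, Finset.mem_filter.2 ⟨Finset.mem_univ _, Fin.lt_def.2 hb⟩, rfl⟩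
  · intro _ _
    rfl

variable [Finite V] {L : List (Finset V)}

/-- The births of the `0`-dimensional points are the heights of the vertices. -/
theorem IsGraphFiltration.countP_births [DecidableEq V] (h : IsGraphFiltration L) (f : Finset V → ℝ) (c : ℝ) :
    (diagramOfOrder L f).countP (fun p => p.dim = 0 ∧ p.birth = c) =
      (L.toFinset.filter fun σ => σ.card = 1 ∧ f σ = c).card := by
  rw [countP_diagramOfOrder, Fin.sum_univ_two, Finset.card_filter,
    ← sum_getElem_eq_sum_toFinset h.nodup]
  simp only [Fin.val_zero, Fin.val_one, true_and, one_ne_zero, false_and, if_false,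
    Finset.sum_const_zero, add_zero]
  refine Finset.sum_congr rfl fun i _ => ?_
  have hb := h.births_zero i.2
  rw [← sum_fin_filter_lt i] at hb
  by_cases hc : f L[i] = c
  · simp only [hc, if_true, and_true]
    exact hb
  · have hc' : ¬ f (L[(i : ℕ)]) = c := hc
    simp [hc']

/-- The deaths of the `0`-dimensional points and the births of the `1`-dimensional points are
together the heights of the edges. -/
theorem IsGraphFiltration.countP_deaths [DecidableEq V] (h : IsGraphFiltration L) (f : Finset V → ℝ) (c : ℝ) :
    (diagramOfOrder L f).countP
        (fun p => (p.dim = 0 ∧ p.death = (c : WithTop ℝ)) ∨ (p.dim = 1 ∧ p.birth = c)) =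
      (L.toFinset.filter fun σ => σ.card = 2 ∧ f σ = c).card := by
  rw [countP_diagramOfOrder, Fin.sum_univ_two, Finset.card_filter,
    ← sum_getElem_eq_sum_toFinset h.nodup]
  simp only [Fin.val_zero, Fin.val_one, true_and, one_ne_zero, zero_ne_one, false_and, or_false,
    false_or, WithTop.top_ne_coe, if_false, zero_add, h.pairMult_one, ite_self,
    Finset.sum_const_zero, add_zero, WithTop.coe_inj, Finset.sum_filter]
  -- Exchanging the sums groups the deaths by the simplex `L[j]` that causes them.
  rw [Finset.sum_comm, ← Finset.sum_add_distrib]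
  refine Finset.sum_congr rfl fun j _ => ?_
  have hb := h.deaths_zero_add_births_one j.2
  rw [← sum_fin_filter_gt j, Finset.sum_filter] at hb
  by_cases hc : f L[j] = c
  · simp only [hc, if_true, and_true]
    exact hb
  · have hc' : ¬ f (L[(j : ℕ)]) = c := hc
    simp [hc']

/-- Every simplex gives birth to at most one class in each of the dimensions 0 and 1. -/
theorem IsGraphFiltration.card_diagramOfOrder_le (h : IsGraphFiltration L) (f : Finset V → ℝ) :
    (diagramOfOrder L f).card ≤ 2 * L.length := by
  have h1 := countP_diagramOfOrder L f (fun _ => True)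
  have hT : (diagramOfOrder L f).countP (fun _ => True) = (diagramOfOrder L f).card :=
    Multiset.countP_eq_card.2 fun _ _ => trivial
  rw [← hT, h1, Fin.sum_univ_two]
  simp only [Fin.val_zero, Fin.val_one, if_true, h.pairMult_one, Finset.sum_const_zero, add_zero]
  have h2 : ∀ i ∈ (Finset.univ : Finset (Fin L.length)), essentialMult L 0 i +
      ∑ j ∈ Finset.univ.filter (fun j : Fin L.length => i < j), pairMult L 0 i j ≤ 1 := by
    intro i _
    rw [sum_fin_filter_lt i, h.births_zero i.2]
    split_ifs <;> omega
  have h3 : ∀ i ∈ (Finset.univ : Finset (Fin L.length)), essentialMult L 1 i ≤ 1 := by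
    intro i _
    have := h.deaths_zero_add_births_one i.2
    split_ifs at this <;> omega
  have h2' := Finset.sum_le_sum h2
  have h3' := Finset.sum_le_sum h3
  simp only [Finset.sum_const, Finset.card_univ, Fintype.card_fin, smul_eq_mul, mul_one] at h2' h3'
  omega

end Counting

/-! ### Vertex heights and lower degrees read off the diagrams. -/

namespace EmbeddedGraph

variable {V : Type*} {d : ℕ} {K : EmbeddedGraph V d} {s : EuclideanSpace ℝ (Fin d)}

theorem IsFiltrationOrder.isGraphFiltration {L : List (Finset V)}
    (h : K.IsFiltrationOrder s L) : IsGraphFiltration L where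
  nodup := h.1
  card σ hσ := by
    classical
    rcases (h.2.1 σ).1 hσ with ⟨v, rfl⟩ | ⟨v, w, hvw, rfl⟩
    · exact .inl (Finset.card_singleton v)
    · refine .inr ?_
      convert Finset.card_pair hvw.ne
  face j hj hc τ hτ hs := by
    obtain ⟨v, rfl⟩ := Finset.card_eq_one.1 hτ
    obtain ⟨i, hi, hi'⟩ := List.getElem_of_mem ((h.2.1 {v}).2 (.inl ⟨v, rfl⟩))
    refine List.mem_take_iff_getElem.2 ⟨i, ?_, hi'⟩
    have hss : ({v} : Finset V) ⊂ L[j] :=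
      (Finset.ssubset_iff_of_subset hs).2 (by
        by_contra! hcon
        have := Finset.card_le_card (s := L[j]) (t := {v}) hcon
        simp [hc] at this)
    rcases lt_trichotomy i j with hij | rfl | hij
    · omega
    · rw [hi'] at hss
      exact absurd hss (ssubset_irrefl _)
    · have := (pairwise_getElem_lt h.2.2 hj hi hij).2
      rw [hi'] at this
      exact absurd hss this

theorem height_singleton (v : V) : K.height s {v} = inner ℝ (K.pos v) s := by
  simp [height]

open Classical in
theorem height_pair (v w : V) :
    K.height s {v, w} = max (inner ℝ (K.pos v) s) (inner ℝ (K.pos w) s) := by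
  rw [height, Finset.coe_pair, Set.image_pair, csSup_pair]

variable [Fintype V] {D : Multiset DiagramPoint}

/-- The simplices are images of ordered pairs of vertices, the diagonal pairs giving the vertices,
so there are at most n² of them. -/
theorem IsDiagram.card_le (h : K.IsDiagram s D) : D.card ≤ 2 * Fintype.card V ^ 2 := by
  classical
  obtain ⟨L, hL, rfl⟩ := h
  refine (hL.isGraphFiltration.card_diagramOfOrder_le _).trans (Nat.mul_le_mul_left _ ?_)
  rw [← List.toFinset_card_of_nodup hL.1, sq, ← Fintype.card_prod]
  refine (Finset.card_le_card (t := Finset.univ.image fun p : V × V => ({p.1, p.2} : Finset V))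
    ?_).trans Finset.card_image_le
  intro σ hσ
  rw [List.mem_toFinset, hL.2.1] at hσ
  rcases hσ with ⟨v, rfl⟩ | ⟨v, w, -, rfl⟩
  · exact Finset.mem_image.2 ⟨(v, v), Finset.mem_univ _, by simp⟩
  · exact Finset.mem_image.2 ⟨(v, w), Finset.mem_univ _, by congr⟩

/-- Comparing multiplicities value by value makes ties harmless, so every direction is admissible
here. -/
theorem IsDiagram.births (h : K.IsDiagram s D) :
    (D.filter fun p => p.dim = 0).map DiagramPoint.birth =
      (Finset.univ : Finset V).val.map fun v => inner ℝ (K.pos v) s := by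
  classical
  obtain ⟨L, hL, rfl⟩ := h
  ext c
  rw [Multiset.count_map, Multiset.count_map, Multiset.filter_filter, ← Multiset.countP_eq_card_filter]
  have h1 := hL.isGraphFiltration.countP_births (K.height s) c
  have h2 : (L.toFinset.filter fun σ => σ.card = 1 ∧ K.height s σ = c) =
      (Finset.univ.filter fun v => c = inner ℝ (K.pos v) s).image fun v => ({v} : Finset V) := by
    ext σ
    simp only [Finset.mem_filter, List.mem_toFinset, hL.2.1, Finset.mem_image, Finset.mem_univ,
      true_and]
    constructor
    · rintro ⟨-, h1, h2⟩
      obtain ⟨v, rfl⟩ := Finset.card_eq_one.1 h1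
      exact ⟨v, by rw [← h2, height_singleton], rfl⟩
    · rintro ⟨v, hv, rfl⟩
      exact ⟨.inl ⟨v, rfl⟩, by simp, by rw [hv, height_singleton]⟩
  rw [h2, Finset.card_image_of_injective _ Finset.singleton_injective] at h1
  rw [← Finset.filter_val, Finset.card_val, ← h1]
  exact Multiset.countP_congr rfl fun p _ => by rw [and_comm, @eq_comm _ c]

open Classical in
/-- The number of edges that enter the filtration with the vertex `v`, read off the diagram. -/
theorem IsDiagram.countP_lower (h : K.IsDiagram s D) (v : V)
    (hv : ∀ w, w ≠ v → inner ℝ (K.pos w) s ≠ inner ℝ (K.pos v) s) :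
    D.countP (fun p => (p.dim = 0 ∧ p.death = ((inner ℝ (K.pos v) s : ℝ) : WithTop ℝ)) ∨
      (p.dim = 1 ∧ p.birth = inner ℝ (K.pos v) s)) =
      (Finset.univ.filter fun w => K.graph.Adj v w ∧
        inner ℝ (K.pos w) s < inner ℝ (K.pos v) s).card := by
  obtain ⟨L, hL, rfl⟩ := h
  rw [← Finset.card_image_of_injOn (f := fun w => ({v, w} : Finset V))]
  · convert hL.isGraphFiltration.countP_deaths (K.height s) (inner ℝ (K.pos v) s) using 2
    ext σ
    simp only [Finset.mem_filter, List.mem_toFinset, hL.2.1, Finset.mem_image, Finset.mem_univ,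
      true_and]
    constructor
    · rintro ⟨w, ⟨h1, h2⟩, rfl⟩
      exact ⟨.inr ⟨v, w, h1, rfl⟩, Finset.card_pair h1.ne, by rw [height_pair, max_eq_left h2.le]⟩
    · rintro ⟨⟨a, rfl⟩ | ⟨a, b, hab, rfl⟩, h2, h3⟩
      · simp at h2
      · rw [height_pair] at h3
        -- The height of an edge is attained at one of its end points, which must be `v`, since no
        -- other vertex is at this height.
        rcases max_choice (inner ℝ (K.pos a) s) (inner ℝ (K.pos b) s) with h4 | h4
        · have : a = v := by_contra fun h => hv a h (h4.symm.trans h3)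
          subst this
          exact ⟨b, ⟨hab, lt_of_le_of_ne (max_eq_left_iff.1 h4) (hv b hab.ne')⟩, rfl⟩
        · have : b = v := by_contra fun h => hv b h (h4.symm.trans h3)
          subst this
          exact ⟨a, ⟨hab.symm, lt_of_le_of_ne (max_eq_right_iff.1 h4) (hv a hab.ne)⟩,
            Finset.pair_comm _ _⟩
  · intro a ha b hb hab
    have ha' := (Finset.mem_filter.1 ha).2.1.ne'
    have : a ∈ ({v, b} : Finset V) := by
      have h : ({v, a} : Finset V) = {v, b} := hab
      rw [← h]; simp
    simpa [ha'] using this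

end EmbeddedGraph

/-! ### Directions and heights -/

/-- The vector with the coordinates `a 0, …, a (d - 1)`. -/
def vectorOf (d : ℕ) (a : ℕ → ℝ) : EuclideanSpace ℝ (Fin d) :=
  WithLp.toLp 2 fun j : Fin d => a j

theorem norm_vectorOf_sq (d : ℕ) (a : ℕ → ℝ) :
    ‖vectorOf d a‖ ^ 2 = ∑ j ∈ Finset.range d, a j * a j := by
  rw [EuclideanSpace.norm_sq_eq, Finset.sum_range]
  refine Finset.sum_congr rfl fun j _ => ?_
  rw [Real.norm_eq_abs, sq_abs, sq]
  rfl

theorem norm_vectorOf_eq_one {d : ℕ} {a : ℕ → ℝ} (h : ∑ j ∈ Finset.range d, a j * a j = 1) :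
    ‖vectorOf d a‖ = 1 := by
  rw [← norm_vectorOf_sq] at h
  exact (pow_eq_one_iff_of_nonneg (norm_nonneg _) two_ne_zero).1 h

theorem vectorOf_apply_eq {d : ℕ} {a b : ℕ → ℝ} (h : vectorOf d a = vectorOf d b) {j : ℕ}
    (hj : j < d) : a j = b j :=
  congrArg (fun v : EuclideanSpace ℝ (Fin d) => v ⟨j, hj⟩) h

theorem vectorOf_congr {d : ℕ} {a b : ℕ → ℝ} (h : ∀ j < d, a j = b j) :
    vectorOf d a = vectorOf d b := by
  unfold vectorOf
  congr 1
  funext j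
  exact h j j.2

/-- The coordinates of the unit vector in the plane of the first two coordinates that is
proportional to `(t, 1)`. -/
def planeCoord (t : ℝ) (j : ℕ) : ℝ :=
  if j = 0 then t / √(t * t + 1) else if j = 1 then 1 / √(t * t + 1) else 0

theorem sqrt_planar_pos (t : ℝ) : 0 < √(t * t + 1) :=
  Real.sqrt_pos.2 (by nlinarith [mul_self_nonneg t])

theorem norm_planar {d : ℕ} (hd : 2 ≤ d) (t : ℝ) : ‖vectorOf d (planeCoord t)‖ = 1 := by
  obtain ⟨k, rfl⟩ := Nat.exists_eq_add_of_le' hd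
  apply norm_vectorOf_eq_one
  rw [Finset.sum_range_succ', Finset.sum_range_succ']
  simp only [planeCoord]
  have h := (sqrt_planar_pos t).ne'
  have h2 := Real.mul_self_sqrt (show 0 ≤ t * t + 1 by nlinarith [mul_self_nonneg t])
  simp
  field_simp
  rw [sq (√_), ← sq t] at *
  linarith

theorem planar_ratio (t : ℝ) : planeCoord t 0 = t * planeCoord t 1 := by
  simp [planeCoord, div_eq_mul_inv]

theorem planar_pos (t : ℝ) : 0 < planeCoord t 1 := by
  have h := sqrt_planar_pos t
  simp only [planeCoord, one_ne_zero, if_false, if_true]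
  positivity

/-- The parameter is the ratio of the first two coordinates. -/
theorem planar_injective {d : ℕ} (hd : 2 ≤ d) :
    Function.Injective fun t => vectorOf d (planeCoord t) := by
  intro t t' h
  have h0 := vectorOf_apply_eq h (j := 0) (by omega)
  have h1 := vectorOf_apply_eq h (j := 1) (by omega)
  rw [planar_ratio, planar_ratio t', ← h1] at h0
  exact mul_right_cancel₀ (planar_pos t).ne' h0

/-! ### Heights in planar directions and critical parameters. -/

namespace EmbeddedGraph

variable {V : Type*} {d : ℕ} (K : EmbeddedGraph V d)

/-- The coordinates of a vertex. -/
def coord (v : V) (j : ℕ) : ℝ := if h : j < d then K.pos v ⟨j, h⟩ else 0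

variable {K}

theorem coord_eq (v : V) (j : Fin d) : K.coord v j = K.pos v j := by
  simp [coord]

theorem inner_vectorOf (v : V) (a : ℕ → ℝ) :
    inner ℝ (K.pos v) (vectorOf d a) = ∑ j ∈ Finset.range d, K.coord v j * a j := by
  rw [Finset.sum_range]
  simp only [coord_eq]
  simp [PiLp.inner_apply, vectorOf, mul_comm]

theorem inner_planar (hd : 2 ≤ d) (v : V) (t : ℝ) :
    inner ℝ (K.pos v) (vectorOf d (planeCoord t)) =
      (t * K.coord v 0 + K.coord v 1) / √(t * t + 1) := by
  rw [inner_vectorOf]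
  obtain ⟨k, rfl⟩ := Nat.exists_eq_add_of_le' hd
  rw [Finset.sum_range_succ', Finset.sum_range_succ']
  simp [planeCoord]
  ring

theorem GeneralPosition.coord_ne {hd : 2 ≤ d} (h : K.GeneralPosition hd) {v w : V} (hvw : v ≠ w)
    {j : ℕ} (hj : j < d) : K.coord v j ≠ K.coord w j := by
  simpa [coord, hj] using h.1 v w hvw ⟨j, hj⟩

variable (K) in
/-- The parameter `t` for which `v` and `w` have the same height in the direction of `(t, 1)`. -/
def slope (v w : V) : ℝ := (K.coord w 1 - K.coord v 1) / (K.coord v 0 - K.coord w 0)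

/-- Seen from `u`, the projection of `z` lies on the line with direction (1, -slope). Equal slopes
would put three projected vertices on one line. -/
theorem GeneralPosition.slope_ne {hd : 2 ≤ d} (h : K.GeneralPosition hd) {u v w : V}
    (huv : u ≠ v) (huw : u ≠ w) (hvw : v ≠ w) : K.slope u v ≠ K.slope u w := by
  intro hs
  apply h.2 u v w huv huw hvw
  rw [collinear_iff_of_mem (p₀ := planeProj hd (K.pos u)) (by simp)]
  have key : ∀ z, u ≠ z → planeProj hd (K.pos z) =
      (K.coord z 0 - K.coord u 0) • (!₂[1, -K.slope u z] : EuclideanSpace ℝ (Fin 2)) +ᵥ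
        planeProj hd (K.pos u) := by
    intro z hz
    have h0 := h.coord_ne hz (j := 0) (by omega)
    have h0' : K.coord u 0 - K.coord z 0 ≠ 0 := sub_ne_zero.2 h0
    have c0 : ∀ z, K.pos z ⟨0, by omega⟩ = K.coord z 0 := fun z => (coord_eq z ⟨0, by omega⟩).symm
    have c1 : ∀ z, K.pos z ⟨1, by omega⟩ = K.coord z 1 := fun z => (coord_eq z ⟨1, by omega⟩).symm
    ext i
    fin_cases i
    · simp [planeProj, c0]
    · simp only [planeProj, c0, c1, slope]
      simp
      field_simp
      ring
  refine ⟨!₂[1, -K.slope u v], fun p hp => ?_⟩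
  simp only [Set.mem_insert_iff, Set.mem_singleton_iff] at hp
  rcases hp with rfl | rfl | rfl
  · exact ⟨0, by simp⟩
  · exact ⟨_, key v huv⟩
  · rw [hs]
    exact ⟨_, key w huw⟩

/-- Up to the positive normalizing factor, the difference of the heights is affine in `t` and
vanishes at the slope. -/
theorem GeneralPosition.inner_lt_iff {hd : 2 ≤ d} (h : K.GeneralPosition hd) {v w : V}
    (hvw : v ≠ w) (t : ℝ) :
    inner ℝ (K.pos w) (vectorOf d (planeCoord t)) < inner ℝ (K.pos v) (vectorOf d (planeCoord t)) ↔
      (K.coord w 0 - K.coord v 0) * (t - K.slope v w) < 0 := by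
  have h0 := sub_ne_zero.2 (h.coord_ne hvw (j := 0) (by omega))
  rw [inner_planar hd, inner_planar hd, div_lt_div_iff_of_pos_right (sqrt_planar_pos t), slope,
    ← sub_neg]
  have : (K.coord w 0 - K.coord v 0) *
      (t - (K.coord w 1 - K.coord v 1) / (K.coord v 0 - K.coord w 0)) =
      t * K.coord w 0 + K.coord w 1 - (t * K.coord v 0 + K.coord v 1) := by
    field_simp
    ring
  rw [this]

theorem GeneralPosition.inner_ne {hd : 2 ≤ d} (h : K.GeneralPosition hd) {v w : V}
    (hvw : v ≠ w) {t : ℝ} (ht : t ≠ K.slope v w) :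
    inner ℝ (K.pos w) (vectorOf d (planeCoord t)) ≠
      inner ℝ (K.pos v) (vectorOf d (planeCoord t)) := by
  have h0 := sub_ne_zero.2 (h.coord_ne hvw (j := 0) (by omega))
  rw [inner_planar hd, inner_planar hd, Ne, div_left_inj' (sqrt_planar_pos t).ne']
  intro he
  apply ht
  rw [slope, eq_div_iff h0]
  linarith

variable [Fintype V]

open Classical in
variable (K) in
/-- The number of neighbours of `v` that are lower than `v` in the direction of `(t, 1)`. -/
def lowerDegree (v : V) (t : ℝ) : ℕ :=
  (Finset.univ.filter fun w => K.graph.Adj v w ∧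
    inner ℝ (K.pos w) (vectorOf d (planeCoord t)) <
      inner ℝ (K.pos v) (vectorOf d (planeCoord t))).card

/-- The edge `vw` is recognized by the change of the lower degree of `v` when the direction turns
past the normal of the line through `v` and `w`. -/
theorem GeneralPosition.adj_iff {hd : 2 ≤ d} (h : K.GeneralPosition hd) {v w : V} (hvw : v ≠ w)
    {ε : ℝ} (hε : 0 < ε)
    (hsep : ∀ z, K.slope v z ≠ K.slope v w → ε < |K.slope v z - K.slope v w|) :
    K.graph.Adj v w ↔
      K.lowerDegree v (K.slope v w - ε) ≠ K.lowerDegree v (K.slope v w + ε) := by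
  classical
  have h0 := sub_ne_zero.2 (h.coord_ne hvw.symm (j := 0) (by omega))
  -- By `hsep`, both parameters lie on the same side of the slope of `v` and `z`.
  have same : ∀ z, v ≠ z → z ≠ w →
      (inner ℝ (K.pos z) (vectorOf d (planeCoord (K.slope v w - ε))) <
        inner ℝ (K.pos v) (vectorOf d (planeCoord (K.slope v w - ε))) ↔
      inner ℝ (K.pos z) (vectorOf d (planeCoord (K.slope v w + ε))) <
        inner ℝ (K.pos v) (vectorOf d (planeCoord (K.slope v w + ε)))) := by
    intro z hvz hzw
    rw [h.inner_lt_iff hvz, h.inner_lt_iff hvz]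
    have hs := hsep z (h.slope_ne hvz hvw hzw)
    rcases lt_abs.1 hs with hs | hs
    · rw [mul_neg_iff, mul_neg_iff]
      constructor <;> rintro (⟨h1, h2⟩ | ⟨h1, h2⟩) <;> first
        | exact .inl ⟨h1, by linarith⟩ | (exfalso; linarith)
    · rw [mul_neg_iff, mul_neg_iff]
      constructor <;> rintro (⟨h1, h2⟩ | ⟨h1, h2⟩) <;> first
        | exact .inr ⟨h1, by linarith⟩ | (exfalso; linarith)
  -- `A` collects the lower neighbours other than `w`, which are the same at both parameters; the
  -- lower degree is `A.card`, plus one if `w` is a lower neighbour.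
  set A := Finset.univ.filter fun z => z ≠ w ∧ K.graph.Adj v z ∧
    inner ℝ (K.pos z) (vectorOf d (planeCoord (K.slope v w + ε))) <
      inner ℝ (K.pos v) (vectorOf d (planeCoord (K.slope v w + ε))) with hA
  have hwA : w ∉ A := by simp [hA]
  have count : ∀ t, (∀ z, v ≠ z → z ≠ w →
      (inner ℝ (K.pos z) (vectorOf d (planeCoord t)) <
        inner ℝ (K.pos v) (vectorOf d (planeCoord t)) ↔
      inner ℝ (K.pos z) (vectorOf d (planeCoord (K.slope v w + ε))) <
        inner ℝ (K.pos v) (vectorOf d (planeCoord (K.slope v w + ε))))) →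
      K.lowerDegree v t = if K.graph.Adj v w ∧
        (K.coord w 0 - K.coord v 0) * (t - K.slope v w) < 0 then A.card + 1 else A.card := by
    intro t ht
    simp only [← h.inner_lt_iff hvw]
    rw [← Finset.card_insert_of_notMem hwA, ← apply_ite Finset.card,
      lowerDegree]
    congr 1
    ext z
    by_cases hz : z = w
    · subst hz
      split_ifs with hc <;> simp [hc, hA]
    · have : (if K.graph.Adj v w ∧ inner ℝ (K.pos w) (vectorOf d (planeCoord t)) <
          inner ℝ (K.pos v) (vectorOf d (planeCoord t)) then insert w A else A) ⊆ insert w A := by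
        split_ifs <;> simp
      have hz2 : z ∈ (if K.graph.Adj v w ∧ inner ℝ (K.pos w) (vectorOf d (planeCoord t)) <
          inner ℝ (K.pos v) (vectorOf d (planeCoord t)) then insert w A else A) ↔ z ∈ A := by
        split_ifs <;> simp [hz]
      rw [hz2, hA]
      simp only [Finset.mem_filter, Finset.mem_univ, true_and, hz, not_false_eq_true, ne_eq]
      refine and_congr_right fun hadj => ht z hadj.ne hz
  rw [count _ same, count _ fun _ _ _ => Iff.rfl]
  have e1 : (K.coord w 0 - K.coord v 0) * (K.slope v w - ε - K.slope v w) =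
    -((K.coord w 0 - K.coord v 0) * ε) := by ring
  have e2 : (K.coord w 0 - K.coord v 0) * (K.slope v w + ε - K.slope v w) =
    (K.coord w 0 - K.coord v 0) * ε := by ring
  rw [e1, e2]
  -- The two signs are opposite and nonzero, so `w` is lower than `v` at exactly one of the two
  -- parameters.
  by_cases hadj : K.graph.Adj v w
  · have hne : (K.coord w 0 - K.coord v 0) * ε ≠ 0 := mul_ne_zero h0 hε.ne'
    rcases hne.lt_or_gt with hl | hl
    · have : ¬ (-((K.coord w 0 - K.coord v 0) * ε) < 0) := by linarith
      simp [hadj, hl, this]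
    · have : -((K.coord w 0 - K.coord v 0) * ε) < 0 := by linarith
      have h' : ¬ ((K.coord w 0 - K.coord v 0) * ε < 0) := by linarith
      simp [hadj, h', this]
  · simp [hadj]

end EmbeddedGraph

/-! ### Decoding a vertex from its height in one direction -/

/-- The value of the power series with the coefficients `x i, x (i + 1), …, x (d - 1)` at `b`. -/
def tailSum (x : ℕ → ℝ) (b : ℝ) (d i : ℕ) : ℝ :=
  ∑ j ∈ Finset.range (d - i), x (i + j) * b ^ j

theorem tailSum_self (x : ℕ → ℝ) (b : ℝ) (d : ℕ) : tailSum x b d d = 0 := by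
  simp [tailSum]

theorem tailSum_zero (x : ℕ → ℝ) (b : ℝ) (d : ℕ) :
    tailSum x b d 0 = ∑ j ∈ Finset.range d, x j * b ^ j := by
  simp [tailSum]

theorem tailSum_succ (x : ℕ → ℝ) (b : ℝ) {d i : ℕ} (h : i < d) :
    tailSum x b d i = x i + b * tailSum x b d (i + 1) := by
  obtain ⟨k, rfl⟩ : ∃ k, d = i + 1 + k := ⟨d - i - 1, by omega⟩
  rw [tailSum, tailSum, show i + 1 + k - i = k + 1 by omega, show i + 1 + k - (i + 1) = k by omega,
    Finset.sum_range_succ', Finset.mul_sum, add_comm]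
  congr 1
  · simp
  · refine Finset.sum_congr rfl fun j _ => ?_
    rw [show i + (j + 1) = i + 1 + j by omega]
    ring

/-- By descending induction on `i`: R + b · 2R ≤ 2R. -/
theorem abs_tailSum_le {x : ℕ → ℝ} {b R : ℝ} {d : ℕ} (hR : 0 ≤ R) (hb : 0 ≤ b) (hb2 : b ≤ 1 / 2)
    (hx : ∀ i < d, |x i| ≤ R) {i : ℕ} (hi : i ≤ d) : |tailSum x b d i| ≤ 2 * R := by
  induction hi using Nat.decreasingInduction with
  | self => simp [tailSum_self, hR]
  | of_succ k hk ih =>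
    rw [tailSum_succ x b hk]
    refine (abs_add_le _ _).trans ?_
    rw [abs_mul, abs_of_nonneg hb]
    nlinarith [hx k hk, abs_nonneg (tailSum x b d (k + 1))]

/-- A candidate `y` for the coefficient `x i` is right if and only if it is close to the value of
the power series. -/
theorem close_tailSum_iff {x : ℕ → ℝ} {R : ℝ} {d : ℕ} (hR : 1 ≤ R)
    (hx : ∀ i < d, |x i| ≤ R) {i : ℕ} (hi : i < d) {y : ℝ} (hy : y ≠ x i → 1 / |y - x i| ≤ R) :
    ((tailSum x (1 / (1 + 4 * R * R)) d i - y) * (2 * R) < 1 ∧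
      (y - tailSum x (1 / (1 + 4 * R * R)) d i) * (2 * R) < 1) ↔ y = x i := by
  have hB : 0 < 1 + 4 * R * R := by nlinarith
  have hb : 0 ≤ 1 / (1 + 4 * R * R) := by positivity
  have hb2 : 1 / (1 + 4 * R * R) ≤ 1 / 2 := one_div_le_one_div_of_le (by norm_num) (by nlinarith)
  have htail := abs_tailSum_le (by linarith) hb hb2 hx (i := i + 1) hi
  set u := 1 / (1 + 4 * R * R) * tailSum x (1 / (1 + 4 * R * R)) d (i + 1) with hu
  -- The remainder is at most 2R/(1 + 4R²), which is less than 1/(2R); the base is chosen for this.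
  have hlt : |u| * (2 * R) < 1 := by
    rw [hu, abs_mul, abs_of_nonneg hb, div_mul_eq_mul_div, one_mul, div_mul_eq_mul_div, div_lt_one hB]
    nlinarith [mul_le_mul_of_nonneg_right htail (show 0 ≤ 2 * R by linarith)]
  rw [tailSum_succ x _ hi, ← hu]
  have hua := abs_le.1 (le_refl |u|)
  constructor
  · rintro ⟨h1, h2⟩
    by_contra hne
    -- A wrong candidate is at least 1/R away from `x i`, hence more than 1/(2R) away from `x i +
    -- u`.
    have h3 := hy hne
    have hpos : 0 < |y - x i| := abs_pos.2 (sub_ne_zero.2 hne)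
    rw [div_le_iff₀ hpos] at h3
    rcases abs_cases (y - x i) with ⟨h4, _⟩ | ⟨h4, _⟩
    · rw [h4] at h3
      nlinarith
    · rw [h4] at h3
      nlinarith
  · rintro rfl
    constructor <;> nlinarith

/-! ### Reading the answers of the oracle -/

/-- The test whether one of two tests succeeds. -/
def Test.or (b b' : Test) : Test := .not (.and (.not b) (.not b'))

/-- The test whether two real numbers are equal. -/
def Test.realEq (e e' : RealExp) : Test := .and (.not (.realLt e e')) (.not (.realLt e' e))

@[simp] theorem Test.holds_or {m : State} {b b' : Test} :
    (b.or b').holds m ↔ b.holds m ∨ b'.holds m := by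
  simp only [Test.or, Test.holds]; tauto

@[simp] theorem Test.holds_realEq {m : State} {e e' : RealExp} :
    (Test.realEq e e').holds m ↔ e.eval m = e'.eval m := by
  simp only [Test.realEq, Test.holds, not_lt, le_antisymm_iff, and_comm]

/-- The memory contains the answer `D` of the oracle. -/
structure Received (m : State) (D : List DiagramPoint) : Prop where
  length : m.natVar 1 = D.length
  dim : ∀ (k : ℕ) (h : k < D.length), m.natArr 0 0 k = D[k].dim
  infinite : ∀ (k : ℕ) (h : k < D.length), m.natArr 0 1 k < 1 ↔ D[k].death ≠ ⊤
  birth : ∀ (k : ℕ) (h : k < D.length), m.realArr 0 1 k = D[k].birth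
  death : ∀ (k : ℕ) (h : k < D.length), m.realArr 0 2 k = D[k].death.untopD 0

section

variable {d : ℕ} {O : EuclideanSpace ℝ (Fin d) → List DiagramPoint} {T : ℕ}

theorem runs_query_received {m : State} {a : ℕ → ℝ} (ha : ∀ j < d, m.realArr 0 0 j = a j)
    (h : ‖vectorOf d a‖ = 1) :
    Runs d O T .query m T fun m' Q => Q = [vectorOf d a] ∧ Received m' (O (vectorOf d a)) ∧
      m'.realArr 0 0 = m.realArr 0 0 := by
  have e : m.direction d = vectorOf d a := vectorOf_congr ha
  refine runs_query (by rwa [e]) ⟨by rw [e], ?_, ?_⟩ le_rfl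
  · rw [e]
    constructor <;> intros <;> simp_all [State.receive]
  · funext k
    simp [State.receive]

/-- Write the births of the `0`-dimensional points to the row of the real array `2` that is given by
the natural variable `x`, and their number to the natural variable `2`. -/
def gather (x : ℕ) : Program :=
  .seq (.setNat 2 (.const 0))
    (.forLoop 6 1
      (.branch (.natLt (.arr 0 (.const 0) (.var 6)) (.const 1))
        (.seq (.storeReal 2 (.var x) (.var 2) (.arr 0 (.const 1) (.var 6)))
          (.setNat 2 (.add (.var 2) (.const 1))))
        .skip))

/-- The equality of lists fixes the entries and also their number, which is how the program learns
the number of vertices. -/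
theorem computes_gather {x : ℕ} (hx2 : x ≠ 2) (hx6 : x ≠ 6) {m : State} {D : List DiagramPoint}
    (h : Received m D) :
    Computes d O T (gather x) m (8 + D.length * 30) fun m' =>
      (List.range (m'.natVar 2)).map (m'.realArr 2 (m.natVar x)) =
        (D.filter fun p => p.dim = 0).map DiagramPoint.birth ∧
      ∀ i, i ≠ m.natVar x → m'.realArr 2 i = m.realArr 2 i := by
  refine runs_setNat_seq (c := 6 + D.length * (22 + 8)) ?_ (by simp; omega)
  refine computes_forLoop (fun k m' =>
      (List.range (m'.natVar 2)).map (m'.realArr 2 (m.natVar x)) =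
        ((D.take k).filter fun p => p.dim = 0).map DiagramPoint.birth ∧
      ∀ i, i ≠ m.natVar x → m'.realArr 2 i = m.realArr 2 i)
    (by simpa using h.length) (by simp [Program.natW]) (by simp [Program.natW]) (by decide) (by simp) ?_ ?_ le_rfl
  · intro k hk m' hf hm hl hI
    have e1 : m'.natArr 0 0 k = D[k].dim := by
      rw [hf.natArr 0 (by simp [Program.forLoop, Program.natA])]
      exact h.dim k hk
    have e2 : m'.realArr 0 1 k = D[k].birth := by
      rw [hf.realArr 0 (by simp [Program.forLoop, Program.realA])]
      exact h.birth k hk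
    have e3 : m'.natVar x = m.natVar x := by
      rw [hf.nat x (by simp [Program.forLoop, Program.natW, hx2, hx6])]
      simp [hx2]
    refine computes_branch (c := 12) ?_ ?_ (by simp)
    · intro hb
      have hd : D[k].dim = 0 := by simpa [hm, e1] using hb
      refine runs_storeReal_seq (c := 4) (computes_setNat ?_ (by simp)) (by simp)
      simp only [NatExp.eval, RealExp.eval, hm, e2, e3, State.setNat_natVar, State.setNat_realArr,
        State.storeReal_natVar]
      rw [List.take_succ_eq_append_getElem hk, List.filter_append, List.map_append, ← hI.1]
      refine ⟨?_, fun i hi => ?_⟩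
      · simp only [Nat.reduceEqDiff, if_false, if_true, List.range_succ,
          List.map_append]
        congr 1
        · refine List.map_congr_left fun a ha => ?_
          have : a ≠ m'.natVar 2 := (List.mem_range.1 ha).ne
          simp [this]
        · simp [hd]
      · funext j
        rw [← hI.2 i hi]
        simp [hi]
    · intro hb
      have hd : D[k].dim ≠ 0 := by simpa [hm, e1] using hb
      refine computes_skip ?_ (by simp)
      rw [List.take_succ_eq_append_getElem hk, List.filter_append, List.map_append, ← hI.1]
      refine ⟨by simp [hd], hI.2⟩
  · intro m' _ _ hI
    simpa using hI

/-- Count the edges that enter at the height in the real variable `10`, in the natural variable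
`z`. -/
def countEdges (z : ℕ) : Program :=
  .seq (.setNat z (.const 0))
    (.forLoop 6 1
      (.branch
        (.or
          (.and (.natLt (.arr 0 (.const 0) (.var 6)) (.const 1))
            (.and (.natLt (.arr 0 (.const 1) (.var 6)) (.const 1))
              (.realEq (.arr 0 (.const 2) (.var 6)) (.var 10))))
          (.and (.and (.not (.natLt (.arr 0 (.const 0) (.var 6)) (.const 1)))
              (.natLt (.arr 0 (.const 0) (.var 6)) (.const 2)))
            (.realEq (.arr 0 (.const 1) (.var 6)) (.var 10))))
        (.setNat z (.add (.var z) (.const 1)))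
        .skip))

open Classical in
theorem computes_countEdges {z : ℕ} (hz1 : 1 ≠ z) (hz6 : 6 ≠ z) {m : State}
    {D : List DiagramPoint} (h : Received m D) :
    Computes d O T (countEdges z) m (8 + D.length * 100) fun m' => m'.natVar z =
      D.countP fun p => (p.dim = 0 ∧ p.death = ((m.realVar 10 : ℝ) : WithTop ℝ)) ∨
        (p.dim = 1 ∧ p.birth = m.realVar 10) := by
  refine runs_setNat_seq (c := 6 + D.length * (92 + 8)) ?_ (by simp; omega)
  refine computes_forLoop (fun k m' => m'.natVar z =
      (D.take k).countP fun p => (p.dim = 0 ∧ p.death = ((m.realVar 10 : ℝ) : WithTop ℝ)) ∨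
        (p.dim = 1 ∧ p.birth = m.realVar 10))
    (by simpa [hz1] using h.length) (by simp [Program.natW, hz6]) (by simp [Program.natW, hz1])
    (by decide) (by simp [hz6.symm]) ?_ ?_ le_rfl
  · intro k hk m' hf hm hl hI
    have e1 : m'.natArr 0 0 k = D[k].dim := by
      rw [hf.natArr 0 (by simp [Program.forLoop, Program.natA])]
      exact h.dim k hk
    have e1' : m'.natArr 0 1 k < 1 ↔ D[k].death ≠ ⊤ := by
      rw [hf.natArr 0 (by simp [Program.forLoop, Program.natA])]
      exact h.infinite k hk
    have e2 : m'.realArr 0 1 k = D[k].birth := by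
      rw [hf.realArr 0 (by simp [Program.forLoop, Program.realA])]
      exact h.birth k hk
    have e2' : m'.realArr 0 2 k = D[k].death.untopD 0 := by
      rw [hf.realArr 0 (by simp [Program.forLoop, Program.realA])]
      exact h.death k hk
    have e3 : m'.realVar 10 = m.realVar 10 := by
      rw [hf.real 10 (by simp [Program.forLoop, Program.realW])]
      rfl
    -- An infinite death is stored as 0, so the flag has to be tested in order not to mistake it for
    -- a death at height 0.
    have hdeath : D[k].death = ((m.realVar 10 : ℝ) : WithTop ℝ) ↔
        D[k].death ≠ ⊤ ∧ D[k].death.untopD 0 = m.realVar 10 := by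
      cases D[k].death <;> simp
    have key : ((D[k].dim = 0 ∧ D[k].death = ((m.realVar 10 : ℝ) : WithTop ℝ)) ∨
        (D[k].dim = 1 ∧ D[k].birth = m.realVar 10)) ↔
        (m'.natArr 0 0 k < 1 ∧ m'.natArr 0 1 k < 1 ∧ m'.realArr 0 2 k = m'.realVar 10) ∨
        ((¬ m'.natArr 0 0 k < 1 ∧ m'.natArr 0 0 k < 2) ∧ m'.realArr 0 1 k = m'.realVar 10) := by
      rw [hdeath, e1', e1, e2, e2', e3]
      refine or_congr (and_congr_left' (by omega)) (and_congr_left' (by omega))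
    rw [List.take_succ_eq_append_getElem hk, List.countP_append, ← hI, List.countP_singleton]
    simp only [decide_eq_true_eq, key]
    refine computes_branch (c := 4) ?_ ?_ (by simp [Test.or, Test.realEq])
    · intro hb
      simp only [Test.holds_or, Test.holds, Test.holds_realEq, NatExp.eval, RealExp.eval, hm] at hb
      refine computes_setNat ?_ (by simp)
      rw [if_pos hb]
      simp [hz6.symm]
    · intro hb
      simp only [Test.holds_or, Test.holds, Test.holds_realEq, NatExp.eval, RealExp.eval, hm] at hb
      refine computes_skip ?_ (by simp)
      rw [if_neg hb]
      simp [hz6.symm]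
  · intro m' _ _ hI
    simpa using hI

end

/-! ### Finding the vertices -/

/-- The coordinates of the `i`-th unit vector. -/
def axisCoord (i j : ℕ) : ℝ := if j = i then 1 else 0

theorem norm_axis {d i : ℕ} (hi : i < d) : ‖vectorOf d (axisCoord i)‖ = 1 := by
  apply norm_vectorOf_eq_one
  simp [axisCoord, hi]

theorem inner_axis {V : Type*} {d : ℕ} {K : EmbeddedGraph V d} (v : V) {i : ℕ} (hi : i < d) :
    inner ℝ (K.pos v) (vectorOf d (axisCoord i)) = K.coord v i := by
  rw [EmbeddedGraph.inner_vectorOf]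
  simp [axisCoord, hi]

section

variable {V : Type*} [Fintype V]

/-- The first entries of the sequence `f` list the values of `g`. -/
def Lists (f : ℕ → ℝ) (g : V → ℝ) : Prop :=
  (((List.range (Fintype.card V)).map f : List ℝ) : Multiset ℝ) = (Finset.univ : Finset V).val.map g

/-- Equal multisets of values have fibres of equal size; bijections of the fibres are glued
together. Repeated values are allowed. -/
theorem Lists.exists_equiv {f : ℕ → ℝ} {g : V → ℝ} (h : Lists f g) :
    ∃ e : Fin (Fintype.card V) ≃ V, ∀ k : Fin (Fintype.card V), f k = g (e k) := by
  classical
  have h1 : (Finset.univ : Finset (Fin (Fintype.card V))).val.map (fun k : Fin (Fintype.card V) => f k) =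
      (Finset.univ : Finset V).val.map g := by
    rw [← h, Fin.univ_val_map, List.ofFn_eq_map, ← List.map_coe_finRange_eq_range, List.map_map]
    rfl
  have h2 : ∀ c, Nonempty ({k : Fin (Fintype.card V) // f k = c} ≃ {v // g v = c}) := by
    intro c
    have := congrArg (Multiset.count c) h1
    rw [Multiset.count_map, Multiset.count_map, ← Finset.filter_val, ← Finset.filter_val,
      Finset.card_val, Finset.card_val] at this
    refine ⟨Fintype.equivOfCardEq ?_⟩
    rw [Fintype.card_subtype, Fintype.card_subtype]
    simpa only [eq_comm] using this
  have e := fun c => (h2 c).some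
  exact ⟨Equiv.ofFiberEquiv e, fun k => (Equiv.ofFiberEquiv_map e k).symm⟩

theorem Lists.congr {f f' : ℕ → ℝ} {g : V → ℝ} (h : Lists f g)
    (hf : ∀ k < Fintype.card V, f' k = f k) : Lists f' g := by
  unfold Lists at *
  rw [← h]
  congr 1
  exact List.map_congr_left fun k hk => hf k (List.mem_range.1 hk)

variable {d : ℕ} {O : EuclideanSpace ℝ (Fin d) → List DiagramPoint} {T : ℕ}
  {K : EmbeddedGraph V d}

theorem EmbeddedGraph.IsOracle.length_le (hO : K.IsOracle O) {s : EuclideanSpace ℝ (Fin d)}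
    (hs : ‖s‖ = 1) : (O s).length ≤ 2 * (Fintype.card V * Fintype.card V) := by
  have := (hO s hs).card_le
  rwa [sq] at this

theorem runs_observe (hO : K.IsOracle O) {x : ℕ} (hx1 : x ≠ 1) (hx2 : x ≠ 2) (hx6 : x ≠ 6)
    {m : State} {a : ℕ → ℝ} (ha : ∀ j < d, m.realArr 0 0 j = a j) (h : ‖vectorOf d a‖ = 1) :
    Runs d O T (.seq .query (gather x)) m (T + (8 + 60 * (Fintype.card V * Fintype.card V)))
      fun m' Q => Q = [vectorOf d a] ∧ m'.realArr 0 0 = m.realArr 0 0 ∧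
        m'.natVar 2 = Fintype.card V ∧
        Lists (m'.realArr 2 (m.natVar x)) (fun v => inner ℝ (K.pos v) (vectorOf d a)) ∧
        ∀ i, i ≠ m.natVar x → m'.realArr 2 i = m.realArr 2 i := by
  refine (runs_query_received ha h).seq_computes ?_ le_rfl
  rintro m₁ Q hf ⟨rfl, hr, h0⟩
  -- There are at most 2n² points, each read in 30 steps.
  have hl := hO.length_le h
  refine (computes_gather hx2 hx6 hr).mono (by omega) fun m₂ hf₂ ⟨h1, h2⟩ => ?_
  have e1 : m₁.natVar x = m.natVar x := hf.nat x (by simp [Program.natW, hx1])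
  have e2 : m₁.realArr 2 = m.realArr 2 := hf.realArr 2 (by simp [Program.realA])
  have e3 : m₂.realArr 0 = m₁.realArr 0 :=
    hf₂.realArr 0 (by simp [gather, Program.forLoop, Program.realA])
  have hb := (hO _ h).births
  rw [Multiset.filter_coe, Multiset.map_coe, ← h1] at hb
  have hn : m₂.natVar 2 = Fintype.card V := by
    have := congrArg Multiset.card hb
    simpa using this
  rw [e1, e2] at h2
  rw [e1, hn] at hb
  exact ⟨rfl, by rw [e3, h0], hn, hb, h2⟩

/-- Observe the directions of the coordinate axes. -/
def scanAxes : Program :=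
  .forLoop 4 0
    (.seq (.storeReal 0 (.const 0) (.var 4) .one)
      (.seq (.seq .query (gather 4)) (.storeReal 0 (.const 0) (.var 4) .zero)))

theorem runs_scanAxes (hO : K.IsOracle O) (hd : 0 < d) {m : State} (hm : m.natVar 0 = d)
    (hz : ∀ j, m.realArr 0 0 j = 0) :
    Runs d O T scanAxes m (6 + d * (T + 40 + 60 * (Fintype.card V * Fintype.card V)))
      fun m' Q => Q = (List.range d).map (fun i => vectorOf d (axisCoord i)) ∧
        m'.natVar 2 = Fintype.card V ∧
        ∀ i < d, Lists (m'.realArr 2 i) (fun v => K.coord v i) := by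
  refine runs_forLoop (c := T + 32 + 60 * (Fintype.card V * Fintype.card V))
    (fun k m' Q => Q = (List.range k).map (fun i => vectorOf d (axisCoord i)) ∧
      -- The number of vertices is unknown before the first query.
      (0 < k → m'.natVar 2 = Fintype.card V) ∧
      (∀ j, m'.realArr 0 0 j = 0) ∧
      ∀ i < k, Lists (m'.realArr 2 i) (fun v => K.coord v i))
    hm (by decide) (by decide) (by decide) (by simp [hz]) ?_ ?_ (by ring_nf; omega)
  · rintro k hk m₁ Q hf hx hy ⟨rfl, hn, hz, hL⟩
    refine runs_storeReal_seq (c := T + 28 + 60 * (Fintype.card V * Fintype.card V)) ?_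
      (by simp; omega)
    have hobs := runs_observe (T := T) hO (x := 4) (by decide) (by decide) (by decide)
      (m := m₁.storeReal 0 0 k 1) (a := axisCoord k) (by simp [axisCoord, hz]) (norm_axis hk)
    simp only [NatExp.eval, RealExp.eval, hx]
    refine hobs.seq_computes ?_
      (show _ + 10 ≤ _ by omega)
    rintro m₂ Q' hf₂ ⟨rfl, h0, hn₂, hL₂, hrest⟩
    simp only [State.storeReal_natVar, hx] at hL₂ hrest
    have h4 : m₂.natVar 4 = k := (hf₂.nat 4 (by decide)).trans hx
    refine computes_storeReal ?_ (by simp)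
    simp only [NatExp.eval, RealExp.eval, h4]
    refine ⟨by simp [List.range_succ], fun _ => by simpa using hn₂, fun j => ?_, fun i hi => ?_⟩
    · have := congrFun h0 j
      simp only [State.storeReal_realArr, hz] at this
      simp only [State.setNat_realArr, State.storeReal_realArr, this]
      split_ifs <;> tauto
    · by_cases hik : i = k
      · subst hik
        simp only [inner_axis _ hk] at hL₂
        refine hL₂.congr fun j _ => ?_
        simp
      · refine (hL i (by omega)).congr fun j _ => ?_
        simp [hrest i hik]
  · rintro m₁ Q hf hx ⟨rfl, hn, hz, hL⟩
    exact ⟨rfl, hn hd, hL⟩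

/-- Compute in the real variable `0` a bound for the absolute values of all coordinates and for the
inverses of their differences. -/
def computeBound : Program :=
  .seq (.setReal 0 .one)
    (.forLoop 4 0 (.forLoop 5 2 (.forLoop 6 2
      (.setReal 0 (.add (.var 0)
        (.add (.mul (.arr 2 (.var 4) (.var 5)) (.arr 2 (.var 4) (.var 5)))
          (.div .one
            (.mul (.sub (.arr 2 (.var 4) (.var 5)) (.arr 2 (.var 4) (.var 6)))
              (.sub (.arr 2 (.var 4) (.var 5)) (.arr 2 (.var 4) (.var 6)))))))))))

/-- A bound for the absolute values and for the inverses of the differences of the entries of an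
array. -/
def spread (c : ℕ → ℕ → ℝ) (d n : ℕ) : ℝ :=
  1 + ∑ i ∈ Finset.range d, ∑ k ∈ Finset.range n, ∑ l ∈ Finset.range n,
    (c i k * c i k + 1 / ((c i k - c i l) * (c i k - c i l)))

theorem computes_computeBound {m : State} {n : ℕ} (hm : m.natVar 0 = d) (hn : m.natVar 2 = n) :
    Computes d O T computeBound m (10 + d * (14 + n * (14 + n * 48)))
      fun m' => m'.realVar 0 = spread (m.realArr 2) d n := by
  refine runs_setReal_seq (c := 6 + d * (6 + n * (6 + n * (40 + 8) + 8) + 8)) ?_ ?_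
  · refine Computes.mono (computes_sum (z := 0) (fun i => ∑ k ∈ Finset.range n, ∑ l ∈ Finset.range n,
      (m.realArr 2 i k * m.realArr 2 i k + 1 / ((m.realArr 2 i k - m.realArr 2 i l) *
        (m.realArr 2 i k - m.realArr 2 i l)))) hm (by decide) (by decide) (by decide)
      (fun i hi m₁ hf₁ hx₁ hy₁ => ?_) le_rfl) le_rfl fun m' _ h => ?_
    · refine computes_sum _ (N := n) ?_ (by decide) (by decide) (by decide)
        (fun k hk m₂ hf₂ hx₂ hy₂ => ?_) le_rfl
      · rw [hf₁.nat 2 (by decide)]; exact hn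
      refine computes_sum _ (N := n) hy₂ (by decide) (by decide) (by decide)
        (fun l hl m₃ hf₃ hx₃ hy₃ => ?_) le_rfl
      refine computes_setReal ?_ (by simp)
      have e4 : m₃.natVar 4 = i := by rw [hf₃.nat 4 (by decide), hf₂.nat 4 (by decide), hx₁]
      have e5 : m₃.natVar 5 = k := by rw [hf₃.nat 5 (by decide), hx₂]
      have eA : m₃.realArr 2 = m.realArr 2 := by
        rw [hf₃.realArr 2 (by decide), hf₂.realArr 2 (by decide), hf₁.realArr 2 (by decide)]
        rfl
      simp [e4, e5, hx₃, eA]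
    · rw [h]
      simp [spread]
  · simp only [RealExp.cost]
    ring_nf
    omega

end

/-- The coordinates of the unit vector proportional to `(1, b, b ^ 2, …)`. -/
def obliqueCoord (d : ℕ) (b : ℝ) (j : ℕ) : ℝ :=
  b ^ j / √(∑ i ∈ Finset.range d, b ^ i * b ^ i)

theorem sum_powers_pos {d : ℕ} (hd : 0 < d) (b : ℝ) :
    0 < ∑ i ∈ Finset.range d, b ^ i * b ^ i := by
  have := Finset.single_le_sum (f := fun i => b ^ i * b ^ i) (fun i _ => mul_self_nonneg (b ^ i))
    (Finset.mem_range.2 hd)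
  simp only [pow_zero, mul_one] at this
  linarith

theorem norm_oblique {d : ℕ} (hd : 0 < d) (b : ℝ) : ‖vectorOf d (obliqueCoord d b)‖ = 1 := by
  have h := sum_powers_pos hd b
  apply norm_vectorOf_eq_one
  simp only [obliqueCoord, div_mul_div_comm, Real.mul_self_sqrt h.le]
  rw [← Finset.sum_div, div_self h.ne']

theorem inner_oblique {V : Type*} {d : ℕ} {K : EmbeddedGraph V d} (hd : 0 < d) (v : V) (b : ℝ) :
    inner ℝ (K.pos v) (vectorOf d (obliqueCoord d b)) *
      √(∑ i ∈ Finset.range d, b ^ i * b ^ i) = tailSum (K.coord v) b d 0 := by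
  rw [EmbeddedGraph.inner_vectorOf, tailSum_zero, Finset.sum_mul]
  refine Finset.sum_congr rfl fun j _ => ?_
  rw [obliqueCoord, mul_assoc, div_mul_cancel₀ _ (Real.sqrt_pos.2 (sum_powers_pos hd b)).ne']

/-! ### The oblique direction and the decoding of the vertices. -/

section

variable {d : ℕ} {O : EuclideanSpace ℝ (Fin d) → List DiagramPoint} {T : ℕ}

/-- Compute the direction whose coordinates are the powers of a small number. -/
def computeOblique : Program :=
  .seq (.setReal 1 (.add .one (.mul (.mul (.add (.add .one .one) (.add .one .one)) (.var 0))
      (.var 0))))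
    (.seq (.setReal 2 .one)
      (.seq (.setReal 3 .zero)
        (.seq
          (.forLoop 4 0
            (.seq (.storeReal 0 (.const 0) (.var 4) (.var 2))
              (.seq (.setReal 3 (.add (.var 3) (.mul (.var 2) (.var 2))))
                (.setReal 2 (.mul (.var 2) (.div .one (.var 1)))))))
          (.seq (.setReal 4 (.sqrt (.var 3)))
            (.forLoop 4 0
              (.storeReal 0 (.const 0) (.var 4)
                (.div (.arr 0 (.const 0) (.var 4)) (.var 4))))))))

theorem computes_computeOblique {m : State} {R : ℝ} (hm : m.natVar 0 = d)
    (hR : m.realVar 0 = R) :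
    Computes d O T computeOblique m (50 + d * 60) fun m' =>
      m'.realVar 1 = 1 + 4 * R * R ∧
      m'.realVar 4 = √(∑ i ∈ Finset.range d,
        (1 / (1 + 4 * R * R)) ^ i * (1 / (1 + 4 * R * R)) ^ i) ∧
      ∀ j < d, m'.realArr 0 0 j = obliqueCoord d (1 / (1 + 4 * R * R)) j := by
  have h4 : (1 + 1 + (1 + 1) : ℝ) = 4 := by norm_num
  set B := 1 + 4 * R * R with hB
  refine runs_setReal_seq (c := 36 + d * 60) ?_ (by simp; omega)
  refine runs_setReal_seq (c := 34 + d * 60) ?_ (by simp; omega)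
  refine runs_setReal_seq (c := 32 + d * 60) ?_ (by simp; omega)
  simp only [RealExp.eval, hR, h4, ← hB]
  refine Computes.seq (c := 6 + d * (22 + 8)) (c' := 9 + d * 20)
    (P := fun m' => m'.realVar 1 = B ∧ m'.natVar 0 = d ∧
      m'.realVar 3 = ∑ j ∈ Finset.range d, (1 / B) ^ j * (1 / B) ^ j ∧
      ∀ j < d, m'.realArr 0 0 j = (1 / B) ^ j) ?_ ?_ (by omega)
  · refine computes_forLoop (fun k m' => m'.realVar 2 = (1 / B) ^ k ∧
      m'.realVar 3 = ∑ j ∈ Finset.range k, (1 / B) ^ j * (1 / B) ^ j ∧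
      ∀ j < k, m'.realArr 0 0 j = (1 / B) ^ j)
      (by simpa using hm) (by decide) (by decide) (by decide) (by simp) ?_ ?_ le_rfl
    · rintro k hk m₁ hf hx hy ⟨h2, h3, h0⟩
      have h1 : m₁.realVar 1 = B := by rw [hf.real 1 (by decide)]; simp
      refine runs_storeReal_seq (c := 16) ?_ (by simp)
      refine runs_setReal_seq (c := 8) (computes_setReal ?_ (by simp)) (by simp)
      refine ⟨?_, ?_, ?_⟩
      · simp [h1, h2, pow_succ]
      · simp [h2, h3, Finset.sum_range_succ]
      · intro j hj
        by_cases hjk : j = k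
        · simp [hjk, hx, h2]
        · simp [hjk, hx, h0 j (by omega)]
    · rintro m₁ hf hx ⟨h2, h3, h0⟩
      refine ⟨?_, ?_, h3, h0⟩
      · rw [hf.real 1 (by decide)]; simp
      · rw [hf.nat 0 (by decide)]; simpa using hm
  · rintro m₁ _ ⟨h1, hd, h3, h0⟩
    refine runs_setReal_seq (c := 6 + d * (10 + 8)) ?_ (by simp; omega)
    -- The normalization is done in place: the entries below `k` are already divided by the norm,
    -- the others are still plain powers.
    refine computes_forLoop (fun k m' => ∀ j < d, m'.realArr 0 0 j =
        if j < k then obliqueCoord d (1 / B) j else (1 / B) ^ j)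
      (by simpa using hd) (by decide) (by decide) (by decide) ?_ ?_ ?_ le_rfl
    · intro j hj
      simpa using h0 j hj
    · intro k hk m₂ hf hx hy hI
      have h4 : m₂.realVar 4 = √(∑ j ∈ Finset.range d, (1 / B) ^ j * (1 / B) ^ j) := by
        rw [hf.real 4 (by decide)]
        simp only [State.setReal_realVar, if_true, RealExp.eval, h3]
      refine computes_storeReal ?_ (by simp)
      intro j hj
      simp only [NatExp.eval, RealExp.eval, hx, h4, State.setNat_realArr, State.storeReal_realArr,
        true_and]
      by_cases hjk : j = k
      · subst hjk
        rw [hI j hj]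
        simp [obliqueCoord]
      · have : j < k + 1 ↔ j < k := by omega
        simp only [hjk, if_false, hI j hj, this]
    · intro m₂ hf hx hI
      refine ⟨?_, ?_, fun j hj => ?_⟩
      · rw [hf.real 1 (by decide)]; simpa using h1
      · rw [hf.real 4 (by decide)]
        simp only [State.setReal_realVar, if_true, RealExp.eval, h3]
      · rw [hI j hj, if_pos hj]

/-- Reset the direction to zero. -/
def clearDirection : Program :=
  .forLoop 4 0 (.storeReal 0 (.const 0) (.var 4) .zero)

/-- The planar probes overwrite only the first two entries, so the others must vanish beforehand. -/
theorem computes_clearDirection {m : State} (hm : m.natVar 0 = d) :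
    Computes d O T clearDirection m (6 + d * 12) fun m' => ∀ j < d, m'.realArr 0 0 j = 0 := by
  refine computes_forLoop (c := 4) (fun k m' => ∀ j < k, m'.realArr 0 0 j = 0)
    hm (by decide) (by decide) (by decide) (by simp) ?_ (fun m' _ _ h => h) le_rfl
  intro k hk m₁ _ hx _ h
  refine computes_storeReal ?_ (by simp)
  intro j hj
  by_cases hjk : j = k
  · simp [hx, hjk]
  · simp [hx, hjk, h j (by omega)]

/-- Decode the vertices from their heights in the oblique direction. -/
def decode : Program :=
  .forLoop 5 2
    (.seq (.setReal 5 (.mul (.arr 2 (.var 0) (.var 5)) (.var 4)))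
      (.forLoop 4 0
        (.seq
          (.forLoop 6 2
            (.branch
              (.and
                (.realLt (.mul (.sub (.var 5) (.arr 2 (.var 4) (.var 6)))
                  (.mul (.add .one .one) (.var 0))) .one)
                (.realLt (.mul (.sub (.arr 2 (.var 4) (.var 6)) (.var 5))
                  (.mul (.add .one .one) (.var 0))) .one))
              (.storeReal 1 (.var 5) (.var 4) (.arr 2 (.var 4) (.var 6)))
              .skip))
          (.setReal 5 (.mul (.sub (.var 5) (.arr 1 (.var 5) (.var 4))) (.var 1))))))

theorem computes_decode {m : State} {n : ℕ} {R N : ℝ} {x : ℕ → ℕ → ℝ}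
    (hd : m.natVar 0 = d) (hn : m.natVar 2 = n) (h0 : m.realVar 0 = R)
    (h1 : m.realVar 1 = 1 + 4 * R * R) (h4 : m.realVar 4 = N) (hR : 1 ≤ R)
    (hx : ∀ k < n, ∀ i < d, |x k i| ≤ R)
    (hmem : ∀ k < n, ∀ i < d, ∃ l < n, m.realArr 2 i l = x k i)
    (hgap : ∀ k < n, ∀ i < d, ∀ l < n, m.realArr 2 i l ≠ x k i →
      1 / |m.realArr 2 i l - x k i| ≤ R)
    (hrow : ∀ k < n, m.realArr 2 d k * N = tailSum (x k) (1 / (1 + 4 * R * R)) d 0) :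
    Computes d O T decode m (6 + n * (22 + d * (24 + n * 48))) fun m' =>
      ∀ k < n, ∀ i < d, m'.realArr 1 k i = x k i := by
  have hB : 1 + 4 * R * R ≠ 0 := by nlinarith
  refine computes_forLoop (c := 14 + d * (24 + n * 48))
    (fun k m' => ∀ k' < k, ∀ i < d, m'.realArr 1 k' i = x k' i) hn (by decide) (by decide)
    (by decide) (by simp) ?_ (fun m' _ _ h => h) (by ring_nf; omega)
  intro k hk m₁ hf₁ hx₁ hy₁ hI₁
  have hd₁ : m₁.natVar 0 = d := (hf₁.nat 0 (by decide)).trans hd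
  have hA₁ : m₁.realArr 2 = m.realArr 2 := hf₁.realArr 2 (by decide)
  have hN₁ : m₁.realVar 4 = N := (hf₁.real 4 (by decide)).trans h4
  refine runs_setReal_seq (c := 6 + d * (16 + n * 48 + 8)) ?_ (by simp; ring_nf; omega)
  -- Real variable `5` holds the tail of the series from the coordinate `i` on.
  refine computes_forLoop (c := 16 + n * 48)
    (fun i m' => m'.realVar 5 = tailSum (x k) (1 / (1 + 4 * R * R)) d i ∧
      (∀ k' < k, ∀ i < d, m'.realArr 1 k' i = x k' i) ∧ ∀ i' < i, m'.realArr 1 k i' = x k i')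
    (by simpa using hd₁) (by decide) (by decide) (by decide) ?_ ?_ ?_ le_rfl
  · refine ⟨?_, by simpa using hI₁, by simp⟩
    rw [← hrow k hk]
    simp [hd₁, hA₁, hx₁, hN₁]
  · rintro i hi m₂ hf₂ hx₂ hy₂ ⟨hH₂, hI₂, hJ₂⟩
    have hk₂ : m₂.natVar 5 = k := by rw [hf₂.nat 5 (by decide)]; simpa using hx₁
    have hA₂ : m₂.realArr 2 = m.realArr 2 := by rw [hf₂.realArr 2 (by decide), ← hA₁]; rfl
    have hn₂ : m₂.natVar 2 = n := by
      rw [hf₂.nat 2 (by decide), State.setReal_natVar, hf₁.nat 2 (by decide), hn]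
    have hR₂ : m₂.realVar 0 = R := by
      rw [hf₂.real 0 (by decide)]
      simp [hf₁.real 0 (by decide), h0]
    have hB₂ : m₂.realVar 1 = 1 + 4 * R * R := by
      rw [hf₂.real 1 (by decide)]
      simp [hf₁.real 1 (by decide), h1]
    refine Computes.seq (c := 6 + n * (40 + 8)) (c' := 10)
      (P := fun m' => (∀ k' i', ¬ (k' = k ∧ i' = i) → m'.realArr 1 k' i' = m₂.realArr 1 k' i') ∧
        m'.realArr 1 k i = x k i) ?_ ?_ (by omega)
    · refine computes_forLoop (fun l m' =>
        (∀ k' i', ¬ (k' = k ∧ i' = i) → m'.realArr 1 k' i' = m₂.realArr 1 k' i') ∧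
        ((∃ l' < l, m.realArr 2 i l' = x k i) → m'.realArr 1 k i = x k i))
        hn₂ (by decide) (by decide) (by decide) (by simp) ?_ ?_ le_rfl
      · rintro l hl m₃ hf₃ hx₃ hy₃ ⟨hI₃, hJ₃⟩
        have hi₃ : m₃.natVar 4 = i := by rw [hf₃.nat 4 (by decide), hx₂]
        have hk₃ : m₃.natVar 5 = k := by rw [hf₃.nat 5 (by decide), hk₂]
        have hA₃ : m₃.realArr 2 = m.realArr 2 := by rw [hf₃.realArr 2 (by decide), hA₂]
        have hH₃ : m₃.realVar 5 = m₂.realVar 5 := hf₃.real 5 (by decide)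
        have hR₃ : m₃.realVar 0 = R := by rw [hf₃.real 0 (by decide), hR₂]
        have key := close_tailSum_iff hR (hx k hk) hi (hgap k hk i hi l hl)
        have h2 : (1 + 1 : ℝ) = 2 := by norm_num
        refine computes_branch (c := 10) ?_ ?_ (by simp)
        · intro hb
          simp only [Test.holds, RealExp.eval, NatExp.eval, hi₃, hx₃, hA₃, hH₃, hH₂, hR₃, h2,
            key] at hb
          refine computes_storeReal ?_ (by simp)
          simp only [RealExp.eval, NatExp.eval, hi₃, hx₃, hA₃, hk₃, hb, State.setNat_realArr,
            State.storeReal_realArr, true_and]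
          refine ⟨fun k' i' h => ?_, fun _ => by simp⟩
          rw [if_neg h]
          exact hI₃ k' i' h
        · intro hb
          simp only [Test.holds, RealExp.eval, NatExp.eval, hi₃, hx₃, hA₃, hH₃, hH₂, hR₃, h2,
            key] at hb
          refine computes_skip ⟨hI₃, ?_⟩ (by simp)
          rintro ⟨l', hl', hll⟩
          refine hJ₃ ⟨l', lt_of_le_of_ne (by omega) ?_, hll⟩
          rintro rfl
          exact hb hll
      · rintro m₃ _ _ ⟨hI₃, hJ₃⟩
        exact ⟨hI₃, hJ₃ (hmem k hk i hi)⟩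
    · rintro m₃ hf₃ ⟨hI₃, hJ₃⟩
      have hi₃ : m₃.natVar 4 = i := by rw [hf₃.nat 4 (by decide), hx₂]
      have hk₃ : m₃.natVar 5 = k := by rw [hf₃.nat 5 (by decide), hk₂]
      have hH₃ : m₃.realVar 5 = m₂.realVar 5 := hf₃.real 5 (by decide)
      have hB₃ : m₃.realVar 1 = 1 + 4 * R * R := by rw [hf₃.real 1 (by decide), hB₂]
      -- Real variable `1` holds the inverse of the base, so multiplying by it shifts the series by
      -- one place.
      refine computes_setReal ⟨?_, ?_, ?_⟩ (by simp)
      · simp only [RealExp.eval, NatExp.eval, State.setNat_realVar, State.setReal_realVar, if_true,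
          hi₃, hk₃, hH₃, hH₂, hB₃, hJ₃, tailSum_succ (x k) _ hi]
        field_simp
        ring
      · intro k' hk' i' hi'
        change m₃.realArr 1 k' i' = _
        rw [hI₃ k' i' (by omega), hI₂ k' hk' i' hi']
      · intro i' hi'
        change m₃.realArr 1 k i' = _
        by_cases hii : i' = i
        · rw [hii, hJ₃]
        · rw [hI₃ k i' (by omega), hJ₂ i' (by omega)]
  · rintro m₂ hf₂ hx₂ ⟨-, hI₂, hJ₂⟩ k' hk' i hi
    change m₂.realArr 1 k' i = _
    by_cases hkk : k' = k
    · rw [hkk, hJ₂ i hi]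
    · exact hI₂ k' (by omega) i hi

end

/-- Squares take the place of absolute values in the sums that the program computes. -/
theorem abs_le_one_add {x s : ℝ} (h : x * x ≤ s) : |x| ≤ 1 + s := by
  rcases abs_cases x with ⟨h1, _⟩ | ⟨h1, _⟩ <;> rw [h1] <;>
    nlinarith [sq_nonneg (x - 1), sq_nonneg (x + 1)]

theorem one_div_abs_le_one_add {x s : ℝ} (h : 1 / (x * x) ≤ s) : 1 / |x| ≤ 1 + s := by
  have := abs_le_one_add (x := 1 / x) (s := s) (by rwa [div_mul_div_comm, one_mul])
  rwa [abs_div, abs_one] at this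

/-! ### Bounds on coordinates and their inverse differences. -/

section Spread

variable {c : ℕ → ℕ → ℝ} {d n : ℕ}

theorem spread_term_nonneg (x y : ℝ) : 0 ≤ x * x + 1 / (y * y) :=
  add_nonneg (mul_self_nonneg x) (one_div_nonneg.2 (mul_self_nonneg y))

theorem le_spread {i k l : ℕ} (hi : i < d) (hk : k < n) (hl : l < n) :
    1 + (c i k * c i k + 1 / ((c i k - c i l) * (c i k - c i l))) ≤ spread c d n := by
  unfold spread
  refine add_le_add le_rfl ?_
  refine le_trans ?_ (Finset.single_le_sum (f := fun i => ∑ k ∈ Finset.range n,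
    ∑ l ∈ Finset.range n, (c i k * c i k + 1 / ((c i k - c i l) * (c i k - c i l))))
    (fun i _ => Finset.sum_nonneg fun k _ => Finset.sum_nonneg fun l _ => spread_term_nonneg _ _)
    (Finset.mem_range.2 hi))
  refine le_trans ?_ (Finset.single_le_sum (f := fun k =>
    ∑ l ∈ Finset.range n, (c i k * c i k + 1 / ((c i k - c i l) * (c i k - c i l))))
    (fun k _ => Finset.sum_nonneg fun l _ => spread_term_nonneg _ _)
    (Finset.mem_range.2 hk))
  exact Finset.single_le_sum (f := fun l =>
    (c i k * c i k + 1 / ((c i k - c i l) * (c i k - c i l))))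
    (fun l _ => spread_term_nonneg _ _) (Finset.mem_range.2 hl)

theorem one_le_spread (c : ℕ → ℕ → ℝ) (d n : ℕ) : 1 ≤ spread c d n :=
  le_add_of_nonneg_right (Finset.sum_nonneg fun _ _ => Finset.sum_nonneg fun _ _ =>
    Finset.sum_nonneg fun _ _ => spread_term_nonneg _ _)

theorem abs_le_spread {i k : ℕ} (hi : i < d) (hk : k < n) : |c i k| ≤ spread c d n := by
  -- In the term with `l = k` the quotient is 1/0 = 0, which leaves the square alone.
  have h := le_spread (c := c) hi hk hk
  rw [sub_self, mul_zero, div_zero, add_zero] at h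
  have := abs_le_one_add (x := c i k) (le_sub_iff_add_le'.2 h)
  linarith

theorem one_div_abs_sub_le_spread {i k l : ℕ} (hi : i < d) (hk : k < n) (hl : l < n) :
    1 / |c i k - c i l| ≤ spread c d n := by
  have h := le_spread (c := c) hi hk hl
  have h' := mul_self_nonneg (c i k)
  have := one_div_abs_le_one_add (x := c i k - c i l) (s := spread c d n - 1) (by linarith)
  linarith

end Spread

/-! ### Recovery of the vertices. -/

section

variable {V : Type*} [Fintype V] {d : ℕ} {O : EuclideanSpace ℝ (Fin d) → List DiagramPoint}
  {T : ℕ} {K : EmbeddedGraph V d}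

/-- Find the number of the vertices and their coordinates. -/
def findVertices : Program :=
  .seq scanAxes (.seq computeBound (.seq computeOblique
    (.seq (.seq .query (gather 0)) (.seq clearDirection decode))))

theorem runs_findVertices (hO : K.IsOracle O) (hd : 0 < d) :
    Runs d O T findVertices (State.init d)
      (d * (T + 40 + 60 * (Fintype.card V * Fintype.card V)) +
        d * (14 + Fintype.card V * (14 + Fintype.card V * 48)) + d * 72 +
        Fintype.card V * (22 + d * (24 + Fintype.card V * 48)) +
        60 * (Fintype.card V * Fintype.card V) + T + 100)
      fun m Q => ∃ B, 0 < B ∧ m.realVar 1 = B ∧ m.natVar 2 = Fintype.card V ∧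
        Q = (List.range d).map (fun i => vectorOf d (axisCoord i)) ++
          [vectorOf d (obliqueCoord d (1 / B))] ∧
        (∀ j < d, m.realArr 0 0 j = 0) ∧
        ∃ e : Fin (Fintype.card V) ≃ V, ∀ (k : Fin (Fintype.card V)), ∀ j < d,
          m.realArr 1 k j = K.coord (e k) j := by
  set n := Fintype.card V with hn
  refine (runs_scanAxes (T := T) hO hd (m := State.init d) rfl fun _ => rfl).seq
    (c' := d * (14 + n * (14 + n * 48)) + d * 72 + n * (22 + d * (24 + n * 48)) +
      60 * (n * n) + T + 90) ?_ (by rw [← hn]; omega)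
  rintro m₁ Q₁ hf₁ ⟨rfl, hn₁, hL₁⟩
  have hd₁ : m₁.natVar 0 = d := hf₁.nat 0 (by decide)
  refine (computes_computeBound hd₁ hn₁).seq_runs
    (c' := d * 72 + n * (22 + d * (24 + n * 48)) + 60 * (n * n) + T + 80) ?_ (by rw [← hn]; omega)
  intro m₂ hf₂ hR₂
  have hd₂ : m₂.natVar 0 = d := (hf₂.nat 0 (by decide)).trans hd₁
  have hn₂ : m₂.natVar 2 = n := (hf₂.nat 2 (by decide)).trans hn₁
  refine (computes_computeOblique hd₂ hR₂).seq_runs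
    (c' := d * 12 + n * (22 + d * (24 + n * 48)) + 60 * (n * n) + T + 30) ?_ (by omega)
  rintro m₃ hf₃ ⟨hB₃, hN₃, hdir₃⟩
  set R := spread (m₁.realArr 2) d n with hR
  have hR1 : 1 ≤ R := one_le_spread _ _ _
  set B := 1 + 4 * R * R with hB
  have hd₃ : m₃.natVar 0 = d := (hf₃.nat 0 (by decide)).trans hd₂
  have hA₃ : m₃.realArr 2 = m₁.realArr 2 :=
    (hf₃.realArr 2 (by decide)).trans (hf₂.realArr 2 (by decide))
  -- Natural variable `0` holds `d`, so the oblique heights go to row `d`, just after the rows of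
  -- the axes.
  refine (runs_observe (T := T) hO (x := 0) (by decide) (by decide) (by decide) hdir₃
    (norm_oblique hd _)).seq_computes
    (c' := d * 12 + n * (22 + d * (24 + n * 48)) + 12) ?_ (by rw [← hn]; omega)
  rintro m₄ Q₄ hf₄ ⟨rfl, hdir₄, hn₄, hL₄, hA₄⟩
  rw [hd₃] at hL₄ hA₄
  have hd₄ : m₄.natVar 0 = d := (hf₄.nat 0 (by decide)).trans hd₃
  refine (computes_clearDirection hd₄).seq
    (c' := 6 + n * (22 + d * (24 + n * 48))) ?_ (by omega)
  intro m₅ hf₅ hz₅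
  have hL : ∀ i < d, Lists (m₅.realArr 2 i) (fun v => K.coord v i) := by
    intro i hi
    rw [hf₅.realArr 2 (by decide), hA₄ i hi.ne, hA₃]
    exact hL₁ i hi
  have hA₅ : ∀ i < d, m₅.realArr 2 i = m₁.realArr 2 i := by
    intro i hi
    rw [hf₅.realArr 2 (by decide), hA₄ i hi.ne, hA₃]
  -- The vertices are numbered by the order in which their oblique heights were received.
  obtain ⟨e, he⟩ := hL₄.exists_equiv
  have hmem : ∀ v, ∀ i < d, ∃ l < n, m₁.realArr 2 i l = K.coord v i := by
    intro v i hi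
    obtain ⟨f, hf⟩ := (hL i hi).exists_equiv
    refine ⟨f.symm v, (f.symm v).2, ?_⟩
    rw [← hA₅ i hi, hf, Equiv.apply_symm_apply]
  set x : ℕ → ℕ → ℝ := fun k i => if h : k < n then K.coord (e ⟨k, h⟩) i else 0 with hx
  have hxk : ∀ k (h : k < n) i, x k i = K.coord (e ⟨k, h⟩) i := fun k h i => by simp [hx, h]
  have hB0 : 0 < B := by nlinarith
  have hR₅ : m₅.realVar 0 = R := by
    rw [hf₅.real 0 (by decide), hf₄.real 0 (by decide), hf₃.real 0 (by decide), hR₂]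
  have hB₅ : m₅.realVar 1 = B := by
    rw [hf₅.real 1 (by decide), hf₄.real 1 (by decide), hB₃]
  have hN₅ : m₅.realVar 4 = √(∑ i ∈ Finset.range d, (1 / B) ^ i * (1 / B) ^ i) := by
    rw [hf₅.real 4 (by decide), hf₄.real 4 (by decide), hN₃]
  have hd₅ : m₅.natVar 0 = d := (hf₅.nat 0 (by decide)).trans hd₄
  have hn₅ : m₅.natVar 2 = n := (hf₅.nat 2 (by decide)).trans hn₄
  refine (computes_decode (T := T) (O := O) hd₅ hn₅ hR₅ hB₅ hN₅ hR1 (x := x) ?_ ?_ ?_ ?_).mono le_rfl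
    fun m₆ hf₆ hx₆ => ?_
  · intro k hk i hi
    obtain ⟨l, hl, hl'⟩ := hmem (e ⟨k, hk⟩) i hi
    rw [hxk k hk, ← hl']
    exact abs_le_spread hi hl
  · intro k hk i hi
    obtain ⟨l, hl, hl'⟩ := hmem (e ⟨k, hk⟩) i hi
    exact ⟨l, hl, by rw [hxk k hk, hA₅ i hi, hl']⟩
  · intro k hk i hi l hl _
    obtain ⟨l', hl', hl''⟩ := hmem (e ⟨k, hk⟩) i hi
    rw [hxk k hk, ← hl'', hA₅ i hi]
    exact one_div_abs_sub_le_spread hi hl hl'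
  · intro k hk
    have h1 := he ⟨k, hk⟩
    have h2 : x k = K.coord (e ⟨k, hk⟩) := funext fun i => hxk k hk i
    rw [hf₅.realArr 2 (by decide), h1, h2]
    exact inner_oblique hd _ _
  · refine ⟨B, hB0, ?_, ?_, rfl, ?_, e, ?_⟩
    · rw [hf₆.real 1 (by decide), hB₅]
    · rw [hf₆.nat 2 (by decide), hn₅]
    · intro j hj
      rw [hf₆.realArr 0 (by decide), hz₅ j hj]
    · intro k j hj
      rw [hx₆ k k.2 j hj, hxk k k.2]

end

/-! ### The critical directions -/

section

variable {d : ℕ} {O : EuclideanSpace ℝ (Fin d) → List DiagramPoint} {T : ℕ}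

/-- Compute the directions in which two vertices have the same height. -/
def computeSlopes : Program :=
  .forLoop 4 2 (.forLoop 5 2 (.storeReal 3 (.var 4) (.var 5)
    (.div (.sub (.arr 1 (.var 5) (.const 1)) (.arr 1 (.var 4) (.const 1)))
      (.sub (.arr 1 (.var 4) (.const 0)) (.arr 1 (.var 5) (.const 0))))))

theorem computes_computeSlopes {m : State} {n : ℕ} (hn : m.natVar 2 = n) :
    Computes d O T computeSlopes m (6 + n * (14 + n * 40)) fun m' => ∀ i < n, ∀ j < n,
      m'.realArr 3 i j = (m.realArr 1 j 1 - m.realArr 1 i 1) /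
        (m.realArr 1 i 0 - m.realArr 1 j 0) := by
  refine computes_forLoop (c := 6 + n * 40) (fun k m' => ∀ i < k, ∀ j < n,
      m'.realArr 3 i j = (m.realArr 1 j 1 - m.realArr 1 i 1) /
        (m.realArr 1 i 0 - m.realArr 1 j 0)) hn (by decide) (by decide) (by decide) (by simp) ?_
    (fun m' _ _ h => h) (by ring_nf; omega)
  intro k hk m₁ hf₁ hx₁ hy₁ hI₁
  refine computes_forLoop (c := 32) (fun l m' => ∀ i j, (i < k ∧ j < n ∨ i = k ∧ j < l) →
      m'.realArr 3 i j = (m.realArr 1 j 1 - m.realArr 1 i 1) /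
        (m.realArr 1 i 0 - m.realArr 1 j 0)) hy₁ (by decide) (by decide) (by decide) ?_ ?_ ?_ le_rfl
  · rintro i j (h | h)
    · exact hI₁ i h.1 j h.2
    · omega
  · intro l hl m₂ hf₂ hx₂ hy₂ hI₂
    have e4 : m₂.natVar 4 = k := (hf₂.nat 4 (by decide)).trans hx₁
    have eA : m₂.realArr 1 = m.realArr 1 :=
      (hf₂.realArr 1 (by decide)).trans (hf₁.realArr 1 (by decide))
    refine computes_storeReal ?_ (by simp)
    intro i j hij
    simp only [NatExp.eval, RealExp.eval, e4, hx₂, eA, State.setNat_realArr,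
      State.storeReal_realArr, true_and]
    by_cases h : i = k ∧ j = l
    · rw [if_pos h, h.1, h.2]
    · rw [if_neg h]
      exact hI₂ i j (by omega)
  · intro m₂ _ _ hI₂ i hi j hj
    exact hI₂ i j (by omega)

/-- A positive number that does not exceed the distances of the different critical directions, nor
their distances from `B`. -/
def separation (τ : ℕ → ℕ → ℝ) (B : ℝ) (n : ℕ) : ℝ :=
  1 / (1 + ∑ i ∈ Finset.range n, ∑ j ∈ Finset.range n, ∑ k ∈ Finset.range n, ∑ l ∈ Finset.range n,
    (1 / ((τ i j - τ k l) * (τ i j - τ k l)) + 1 / ((τ i j - B) * (τ i j - B))))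

section Separation

variable {τ : ℕ → ℕ → ℝ} {B : ℝ} {n : ℕ}

theorem separation_term_nonneg (x y : ℝ) : 0 ≤ 1 / (x * x) + 1 / (y * y) :=
  add_nonneg (one_div_nonneg.2 (mul_self_nonneg x)) (one_div_nonneg.2 (mul_self_nonneg y))

theorem separation_sum_nonneg : 0 ≤ ∑ i ∈ Finset.range n, ∑ j ∈ Finset.range n,
    ∑ k ∈ Finset.range n, ∑ l ∈ Finset.range n,
    (1 / ((τ i j - τ k l) * (τ i j - τ k l)) + 1 / ((τ i j - B) * (τ i j - B))) :=
  Finset.sum_nonneg fun _ _ => Finset.sum_nonneg fun _ _ => Finset.sum_nonneg fun _ _ =>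
    Finset.sum_nonneg fun _ _ => separation_term_nonneg _ _

theorem separation_pos : 0 < separation τ B n :=
  one_div_pos.2 (by linarith [separation_sum_nonneg (τ := τ) (B := B) (n := n)])

theorem le_separation_sum {i j k l : ℕ} (hi : i < n) (hj : j < n) (hk : k < n) (hl : l < n) :
    1 / ((τ i j - τ k l) * (τ i j - τ k l)) + 1 / ((τ i j - B) * (τ i j - B)) ≤
    ∑ i ∈ Finset.range n, ∑ j ∈ Finset.range n, ∑ k ∈ Finset.range n, ∑ l ∈ Finset.range n,
      (1 / ((τ i j - τ k l) * (τ i j - τ k l)) + 1 / ((τ i j - B) * (τ i j - B))) := by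
  refine le_trans ?_ (Finset.single_le_sum (f := fun i => ∑ j ∈ Finset.range n,
    ∑ k ∈ Finset.range n, ∑ l ∈ Finset.range n,
    (1 / ((τ i j - τ k l) * (τ i j - τ k l)) + 1 / ((τ i j - B) * (τ i j - B))))
    (fun _ _ => Finset.sum_nonneg fun _ _ => Finset.sum_nonneg fun _ _ =>
    Finset.sum_nonneg fun _ _ => separation_term_nonneg _ _) (Finset.mem_range.2 hi))
  refine le_trans ?_ (Finset.single_le_sum (f := fun j =>
    ∑ k ∈ Finset.range n, ∑ l ∈ Finset.range n,
    (1 / ((τ i j - τ k l) * (τ i j - τ k l)) + 1 / ((τ i j - B) * (τ i j - B))))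
    (fun _ _ => Finset.sum_nonneg fun _ _ =>
    Finset.sum_nonneg fun _ _ => separation_term_nonneg _ _) (Finset.mem_range.2 hj))
  refine le_trans ?_ (Finset.single_le_sum (f := fun k => ∑ l ∈ Finset.range n,
    (1 / ((τ i j - τ k l) * (τ i j - τ k l)) + 1 / ((τ i j - B) * (τ i j - B))))
    (fun _ _ => Finset.sum_nonneg fun _ _ => separation_term_nonneg _ _) (Finset.mem_range.2 hk))
  exact Finset.single_le_sum (f := fun l =>
    (1 / ((τ i j - τ k l) * (τ i j - τ k l)) + 1 / ((τ i j - B) * (τ i j - B))))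
    (fun _ _ => separation_term_nonneg _ _) (Finset.mem_range.2 hl)

/-- The inverse squared distance is one of the summands; coinciding parameters contribute only 1/0 =
0. -/
theorem separation_le {i j k l : ℕ} (hi : i < n) (hj : j < n) (hk : k < n) (hl : l < n)
    (h : τ i j ≠ τ k l) : separation τ B n ≤ |τ i j - τ k l| := by
  have h1 := le_separation_sum (τ := τ) (B := B) hi hj hk hl
  have h2 := one_div_nonneg.2 (mul_self_nonneg (τ i j - B))
  rw [separation, one_div_le (by linarith [separation_sum_nonneg (τ := τ) (B := B) (n := n)])
    (abs_pos.2 (sub_ne_zero.2 h))]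
  exact one_div_abs_le_one_add (by linarith)

/-- For `d = 2` the oblique direction is planar with parameter `B`, so the probes have to avoid it.
-/
theorem separation_le_sub {i j : ℕ} (hi : i < n) (hj : j < n)
    (h : τ i j ≠ B) : separation τ B n ≤ |τ i j - B| := by
  have h1 := le_separation_sum (τ := τ) (B := B) hi hj hi hj
  have h2 := one_div_nonneg.2 (mul_self_nonneg (τ i j - τ i j))
  rw [separation, one_div_le (by linarith [separation_sum_nonneg (τ := τ) (B := B) (n := n)])
    (abs_pos.2 (sub_ne_zero.2 h))]
  exact one_div_abs_le_one_add (by linarith)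

end Separation

/-- Compute the separation of the critical directions in the real variable `6`. -/
def computeSeparation : Program :=
  .seq (.setReal 6 .one)
    (.seq
      (.forLoop 4 2 (.forLoop 5 2 (.forLoop 6 2 (.forLoop 7 2
        (.setReal 6 (.add (.var 6)
          (.add
            (.div .one
              (.mul (.sub (.arr 3 (.var 4) (.var 5)) (.arr 3 (.var 6) (.var 7)))
                (.sub (.arr 3 (.var 4) (.var 5)) (.arr 3 (.var 6) (.var 7)))))
            (.div .one
              (.mul (.sub (.arr 3 (.var 4) (.var 5)) (.var 1))
                (.sub (.arr 3 (.var 4) (.var 5)) (.var 1)))))))))))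
      (.setReal 6 (.div .one (.var 6))))

theorem computes_computeSeparation {m : State} {n : ℕ} {B : ℝ} (hn : m.natVar 2 = n)
    (hB : m.realVar 1 = B) :
    Computes d O T computeSeparation m (20 + n * (14 + n * (14 + n * (14 + n * 60))))
      fun m' => m'.realVar 6 = separation (m.realArr 3) B n := by
  refine runs_setReal_seq (c := 18 + n * (14 + n * (14 + n * (14 + n * 60)))) ?_
    (by simp; omega)
  refine Computes.seq (c := 6 + n * (6 + n * (6 + n * (6 + n * (52 + 8) + 8) + 8) + 8)) (c' := 10)
    (computes_sum (z := 6) (fun i => ∑ j ∈ Finset.range n, ∑ k ∈ Finset.range n,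
      ∑ l ∈ Finset.range n, (1 / ((m.realArr 3 i j - m.realArr 3 k l) *
        (m.realArr 3 i j - m.realArr 3 k l)) + 1 / ((m.realArr 3 i j - B) *
        (m.realArr 3 i j - B)))) hn (by decide) (by decide) (by decide)
      (fun i hi m₁ hf₁ hx₁ hy₁ => ?_) le_rfl) ?_ ?_
  · refine computes_sum _ hy₁ (by decide) (by decide) (by decide)
      (fun j hj m₂ hf₂ hx₂ hy₂ => ?_) le_rfl
    refine computes_sum _ hy₂ (by decide) (by decide) (by decide)
      (fun k hk m₃ hf₃ hx₃ hy₃ => ?_) le_rfl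
    refine computes_sum _ hy₃ (by decide) (by decide) (by decide)
      (fun l hl m₄ hf₄ hx₄ hy₄ => ?_) le_rfl
    refine computes_setReal ?_ (by simp)
    have e4 : m₄.natVar 4 = i := by
      rw [hf₄.nat 4 (by decide), hf₃.nat 4 (by decide), hf₂.nat 4 (by decide), hx₁]
    have e5 : m₄.natVar 5 = j := by rw [hf₄.nat 5 (by decide), hf₃.nat 5 (by decide), hx₂]
    have e6 : m₄.natVar 6 = k := by rw [hf₄.nat 6 (by decide), hx₃]
    have eA : m₄.realArr 3 = m.realArr 3 := by
      rw [hf₄.realArr 3 (by decide), hf₃.realArr 3 (by decide), hf₂.realArr 3 (by decide),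
        hf₁.realArr 3 (by decide)]
      rfl
    have eB : m₄.realVar 1 = B := by
      rw [hf₄.real 1 (by decide), hf₃.real 1 (by decide), hf₂.real 1 (by decide),
        hf₁.real 1 (by decide)]
      simpa using hB
    simp only [NatExp.eval, RealExp.eval, e4, e5, e6, hx₄, eA, eB, State.setReal_realVar, if_true]
  · intro m₁ _ h
    refine computes_setReal ?_ (by simp)
    simp only [RealExp.eval, State.setReal_realVar, if_true, h, separation]
  · ring_nf
    omega

end

/-! ### Finding the edges -/

section

variable {V : Type*} [Fintype V] {d : ℕ} {O : EuclideanSpace ℝ (Fin d) → List DiagramPoint}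
  {T : ℕ} {K : EmbeddedGraph V d}

/-- Find the lower degree of the vertex whose index is in the natural variable `4`, in the planar
direction whose parameter is in the real variable `8`, and write it to the natural variable `z`. -/
def probe (z : ℕ) : Program :=
  .seq (.setReal 9 (.sqrt (.add (.mul (.var 8) (.var 8)) .one)))
    (.seq (.storeReal 0 (.const 0) (.const 0) (.div (.var 8) (.var 9)))
      (.seq (.storeReal 0 (.const 0) (.const 1) (.div .one (.var 9)))
        (.seq .query
          (.seq
            (.setReal 10 (.div
              (.add (.mul (.var 8) (.arr 1 (.var 4) (.const 0))) (.arr 1 (.var 4) (.const 1)))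
              (.var 9)))
            (countEdges z)))))

/-- Arithmetic is exact, so the recomputed height of `v` can be compared with diagram values by
equality. By `hne`, no other vertex is at this height. -/
theorem runs_probe (hO : K.IsOracle O) {hd : 2 ≤ d} (hK : K.GeneralPosition hd) {z : ℕ}
    (hz1 : 1 ≠ z) (hz6 : 6 ≠ z) {m : State} {v : V} {t : ℝ} (ht : m.realVar 8 = t)
    (hx : m.realArr 1 (m.natVar 4) 0 = K.coord v 0) (hy : m.realArr 1 (m.natVar 4) 1 = K.coord v 1)
    (h0 : ∀ j < d, 2 ≤ j → m.realArr 0 0 j = 0) (hne : ∀ w, v ≠ w → t ≠ K.slope v w) :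
    Runs d O T (probe z) m (T + 60 + 200 * (Fintype.card V * Fintype.card V)) fun m' Q =>
      Q = [vectorOf d (planeCoord t)] ∧ m'.natVar z = K.lowerDegree v t ∧
        ∀ j < d, 2 ≤ j → m'.realArr 0 0 j = 0 := by
  classical
  set n := Fintype.card V with hn
  refine runs_setReal_seq (c := T + 50 + 200 * (n * n)) ?_ (by simp; omega)
  refine runs_storeReal_seq (c := T + 40 + 200 * (n * n)) ?_ (by simp; omega)
  refine runs_storeReal_seq (c := T + 30 + 200 * (n * n)) ?_ (by simp; omega)
  simp only [RealExp.eval, NatExp.eval, ht, State.storeReal_realVar, State.setReal_realVar,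
    if_true, if_false, Nat.reduceEqDiff]
  refine (runs_query_received (a := planeCoord t) ?_ (norm_planar hd t)).seq_computes
    (c' := 30 + 200 * (n * n)) ?_ (by omega)
  · intro j hj
    by_cases hj0 : j = 0
    · simp [hj0, planeCoord]
    · by_cases hj1 : j = 1
      · simp [hj1, planeCoord]
      · simp [hj0, hj1, planeCoord, h0 j hj (by omega)]
  · rintro m₁ Q hf₁ ⟨rfl, hr, h0₁⟩
    have hl := hO.length_le (norm_planar hd t)
    rw [← hn] at hl
    have e8 : m₁.realVar 8 = t := by rw [hf₁.real 8 (by decide)]; simpa using ht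
    have e9 : m₁.realVar 9 = √(t * t + 1) := by rw [hf₁.real 9 (by decide)]; simp
    have e4 : m₁.natVar 4 = m.natVar 4 := hf₁.nat 4 (by decide)
    have eA : m₁.realArr 1 = m.realArr 1 := hf₁.realArr 1 (by decide)
    have e10 : (m₁.setReal 10 (RealExp.eval m₁ (.div
        (.add (.mul (.var 8) (.arr 1 (.var 4) (.const 0))) (.arr 1 (.var 4) (.const 1)))
        (.var 9)))).realVar 10 = inner ℝ (K.pos v) (vectorOf d (planeCoord t)) := by
      rw [EmbeddedGraph.inner_planar hd]
      simp [e8, e9, e4, eA, hx, hy]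
    refine runs_setReal_seq (c := 8 + (O (vectorOf d (planeCoord t))).length * 100) ?_
      (by simp; omega)
    refine Computes.mono (computes_countEdges hz1 hz6 (m := m₁.setReal 10 _)
      (D := O (vectorOf d (planeCoord t)))
      ⟨hr.length, hr.dim, hr.infinite, hr.birth, hr.death⟩) le_rfl fun m₂ hf₂ h₂ => ?_
    rw [e10] at h₂
    refine ⟨rfl, ?_, fun j hj hj2 => ?_⟩
    · have hlow := (hO _ (norm_planar hd t)).countP_lower v fun w hw =>
        hK.inner_ne hw.symm (hne w hw.symm)
      rw [h₂, EmbeddedGraph.lowerDegree, ← hlow, Multiset.coe_countP]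
    · have h3 : m₂.realArr 0 0 = m₁.realArr 0 0 := by
        rw [hf₂.realArr 0 (by simp [countEdges, Program.forLoop, Program.realA])]
        rfl
      rw [h3, h0₁]
      have j0 : j ≠ 0 := by omega
      have j1 : j ≠ 1 := by omega
      simp [j0, j1, h0 j hj hj2]

/-- The memory lists the pairs of indices in `L` as edges. -/
structure EdgeTable {n : ℕ} (m : State) (L : List (Fin n × Fin n)) : Prop where
  length : m.natVar 3 = L.length
  fst : ∀ (k : ℕ) (h : k < L.length), m.natArr 1 k 0 = (L[k].1 : ℕ)
  snd : ∀ (k : ℕ) (h : k < L.length), m.natArr 1 k 1 = (L[k].2 : ℕ)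

/-- Decide whether two vertices span an edge, and record the edge. -/
def testPair : Program :=
  .seq (.setReal 8 (.sub (.arr 3 (.var 4) (.var 5)) (.div (.var 6) (.var 7))))
    (.seq (probe 8)
      (.seq (.setReal 8 (.add (.arr 3 (.var 4) (.var 5)) (.div (.var 6) (.var 7))))
        (.seq (probe 9)
          (.seq
            (.branch (.or (.natLt (.var 8) (.var 9)) (.natLt (.var 9) (.var 8)))
              (.seq (.storeNat 1 (.var 3) (.const 0) (.var 4))
                (.seq (.storeNat 1 (.var 3) (.const 1) (.var 5))
                  (.setNat 3 (.add (.var 3) (.const 1)))))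
              .skip)
            (.setReal 7 (.add (.var 7) .one))))))

open Classical in
theorem runs_testPair (hO : K.IsOracle O) {hd : 2 ≤ d} (hK : K.GeneralPosition hd)
    {n : ℕ} {e : Fin n ≃ V} {m : State} {i j : Fin n} (hij : i ≠ j) {t δ r : ℝ}
    {L : List (Fin n × Fin n)}
    (hi : m.natVar 4 = i) (hj : m.natVar 5 = j) (hx : m.realArr 1 i 0 = K.coord (e i) 0)
    (hy : m.realArr 1 i 1 = K.coord (e i) 1) (ht : t = K.slope (e i) (e j))
    (hs : m.realArr 3 i j = t) (hδ : m.realVar 6 = δ)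
    (hr : m.realVar 7 = r) (hpos : 0 < δ / r)
    (hsep : ∀ z, K.slope (e i) z ≠ t → δ / r < |K.slope (e i) z - t|)
    (h0 : ∀ j < d, 2 ≤ j → m.realArr 0 0 j = 0) (hL : EdgeTable m L) :
    Runs d O T testPair m (2 * T + 200 + 400 * (Fintype.card V * Fintype.card V)) fun m' Q =>
      Q = [vectorOf d (planeCoord (t - δ / r)), vectorOf d (planeCoord (t + δ / r))] ∧
      m'.realVar 7 = r + 1 ∧ (∀ j < d, 2 ≤ j → m'.realArr 0 0 j = 0) ∧
      EdgeTable m' (if K.graph.Adj (e i) (e j) then L ++ [(i, j)] else L) := by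
  -- A probe parameter is at distance exactly δ/r from `t`, whereas a slope at the vertex is either
  -- `t` itself or farther away.
  have hne : ∀ s, (s = t - δ / r ∨ s = t + δ / r) → ∀ w, e i ≠ w → s ≠ K.slope (e i) w := by
    intro s hs w _ hsw
    by_cases h : K.slope (e i) w = t
    · rcases hs with hs | hs <;> linarith
    · have := hsep w h
      rw [← hsw] at this
      rcases hs with hs | hs
      · rw [hs, show t - δ / r - t = -(δ / r) by ring, abs_neg, abs_of_pos hpos] at this
        exact lt_irrefl _ this
      · rw [hs, add_sub_cancel_left, abs_of_pos hpos] at this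
        exact lt_irrefl _ this
  set N := Fintype.card V with hN
  refine runs_setReal_seq (c := 2 * T + 190 + 400 * (N * N)) ?_ (by simp; omega)
  simp only [RealExp.eval, NatExp.eval, hi, hj, hs, hδ, hr]
  refine (runs_probe (T := T) hO hK (z := 8) (by decide) (by decide) (v := e i) (t := t - δ / r)
    (by simp) (by simp [hi, hx]) (by simp [hi, hy]) (by simpa using h0) (hne _ (.inl rfl))).seq
    (c' := T + 130 + 200 * (N * N)) ?_ (by rw [← hN]; omega)
  rintro m₁ Q₁ hf₁ ⟨rfl, hc₁, h0₁⟩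
  have hi₁ : m₁.natVar 4 = i := (hf₁.nat 4 (by decide)).trans hi
  have hj₁ : m₁.natVar 5 = j := (hf₁.nat 5 (by decide)).trans hj
  have hA₁ : m₁.realArr 1 = m.realArr 1 := hf₁.realArr 1 (by decide)
  have hs₁ : m₁.realArr 3 = m.realArr 3 := hf₁.realArr 3 (by decide)
  have hδ₁ : m₁.realVar 6 = δ := by rw [hf₁.real 6 (by decide)]; simpa using hδ
  have hr₁ : m₁.realVar 7 = r := by rw [hf₁.real 7 (by decide)]; simpa using hr
  refine runs_setReal_seq (c := T + 120 + 200 * (N * N)) ?_ (by simp; omega)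
  simp only [RealExp.eval, NatExp.eval, hi₁, hj₁, hs₁, hs, hδ₁, hr₁]
  refine (runs_probe (T := T) hO hK (z := 9) (by decide) (by decide) (v := e i) (t := t + δ / r)
    (by simp) (by simp [hi₁, hA₁, hx]) (by simp [hi₁, hA₁, hy]) (by simpa using h0₁)
    (hne _ (.inr rfl))).seq_computes
    (c' := 60) ?_ (by rw [← hN]; omega)
  rintro m₂ Q₂ hf₂ ⟨rfl, hc₂, h0₂⟩
  have hi₂ : m₂.natVar 4 = i := (hf₂.nat 4 (by decide)).trans hi₁
  have hj₂ : m₂.natVar 5 = j := (hf₂.nat 5 (by decide)).trans hj₁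
  have hr₂ : m₂.realVar 7 = r := by rw [hf₂.real 7 (by decide)]; simpa using hr₁
  have hc₂' : m₂.natVar 8 = K.lowerDegree (e i) (t - δ / r) := by
    rw [hf₂.nat 8 (by decide), State.setReal_natVar, hc₁]
  have hm₂ : m₂.natVar 3 = m.natVar 3 := (hf₂.nat 3 (by decide)).trans (hf₁.nat 3 (by decide))
  have hT₂ : m₂.natArr 1 = m.natArr 1 :=
    (hf₂.natArr 1 (by decide)).trans (hf₁.natArr 1 (by decide))
  have hL₂ : EdgeTable m₂ L :=
    ⟨by rw [hm₂, hL.length], by rw [hT₂]; exact hL.fst, by rw [hT₂]; exact hL.snd⟩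
  have hadj := hK.adj_iff (e.injective.ne hij) hpos (by rw [← ht]; exact hsep)
  rw [← ht] at hadj
  refine Computes.seq (c := 50) (c' := 6) (P := fun m' =>
    EdgeTable m' (if K.graph.Adj (e i) (e j) then L ++ [(i, j)] else L)) ?_ ?_ (by omega)
  · refine computes_branch (c := 30) (fun hb => ?_) (fun hb => ?_) (by simp [Test.or])
    · simp only [Test.holds_or, Test.holds, NatExp.eval, hc₂', hc₂] at hb
      have : K.graph.Adj (e i) (e j) := hadj.2 (by omega)
      rw [if_pos this]
      refine runs_storeNat_seq (c := 20) ?_ (by simp)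
      refine runs_storeNat_seq (c := 10) (computes_setNat ?_ (by simp)) (by simp)
      constructor
      · simp [hL₂.length]
      · intro k hk
        simp only [NatExp.eval, State.setNat_natArr, State.storeNat_natArr, State.storeNat_natVar,
          hi₂, hL₂.length, true_and, zero_ne_one, and_false, if_false, and_true]
        by_cases h : k = L.length
        · subst h; simp
        · have hk' : k < L.length := by simp at hk; omega
          rw [if_neg h, hL₂.fst k hk', List.getElem_append_left hk']
      · intro k hk
        simp only [NatExp.eval, State.setNat_natArr, State.storeNat_natArr, State.storeNat_natVar,
          hj₂, hL₂.length, true_and, one_ne_zero, and_false, if_false, and_true]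
        by_cases h : k = L.length
        · subst h; simp
        · have hk' : k < L.length := by simp at hk; omega
          rw [if_neg h, hL₂.snd k hk', List.getElem_append_left hk']
    · simp only [Test.holds_or, Test.holds, NatExp.eval, hc₂', hc₂] at hb
      have : ¬ K.graph.Adj (e i) (e j) := fun h => hadj.1 h (by omega)
      rw [if_neg this]
      exact computes_skip hL₂ (by simp)
  · intro m₃ hf₃ hL₃
    have hr₃ : m₃.realVar 7 = r := (hf₃.real 7 (by decide)).trans hr₂
    have h0₃ : m₃.realArr 0 = m₂.realArr 0 := hf₃.realArr 0 (by decide)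
    refine computes_setReal ⟨rfl, by simp [hr₃], ?_, hL₃.length, hL₃.fst, hL₃.snd⟩ (by simp)
    intro j hj hj2
    rw [State.setReal_realArr, h0₃]
    exact h0₂ j hj hj2

/-- The parameter of a direction close to a critical one. -/
def IsOffset {n : ℕ} (τ : Fin n → Fin n → ℝ) (δ r t : ℝ) : Prop :=
  ∃ a b ρ, 3 ≤ ρ ∧ ρ < r ∧ (t = τ a b - δ / ρ ∨ t = τ a b + δ / ρ)

theorem IsOffset.mono {n : ℕ} {τ : Fin n → Fin n → ℝ} {δ r r' t : ℝ} (h : IsOffset τ δ r t)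
    (hr : r ≤ r') : IsOffset τ δ r' t := by
  obtain ⟨a, b, ρ, h1, h2, h3⟩ := h
  exact ⟨a, b, ρ, h1, h2.trans_le hr, h3⟩

/-- For equal slopes the offsets have different sizes, since ρ < r. For different slopes, at least δ
apart, the two offsets together amount to at most 2δ/3. -/
theorem IsOffset.ne {n : ℕ} {τ : Fin n → Fin n → ℝ} {δ r t s u : ℝ} (h : IsOffset τ δ r t)
    (hδ : 0 < δ) (hr : 3 ≤ r) (hs : ∀ a b, τ a b ≠ s → δ ≤ |τ a b - s|)
    (hu : u = s - δ / r ∨ u = s + δ / r) : t ≠ u := by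
  obtain ⟨a, b, ρ, h1, h2, h3⟩ := h
  have e1 : δ / r < δ / ρ := div_lt_div_of_pos_left hδ (by linarith) h2
  have e2 : 0 < δ / r := by positivity
  have e3 : δ / ρ ≤ δ / 3 := div_le_div_of_nonneg_left hδ.le (by norm_num) h1
  by_cases hc : τ a b = s
  · rw [hc] at h3
    rcases h3 with rfl | rfl <;> rcases hu with rfl | rfl <;> intro h <;> linarith
  · rcases le_abs.1 (hs a b hc) with h4 | h4 <;>
      rcases h3 with rfl | rfl <;> rcases hu with rfl | rfl <;> intro h <;> linarith

theorem IsOffset.ne_critical {n : ℕ} {τ : Fin n → Fin n → ℝ} {δ r t s : ℝ}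
    (h : IsOffset τ δ r t) (hδ : 0 < δ) (hs : ∀ a b, τ a b ≠ s → δ ≤ |τ a b - s|) : t ≠ s := by
  obtain ⟨a, b, ρ, h1, h2, h3⟩ := h
  have e1 : 0 < δ / ρ := by positivity
  have e3 : δ / ρ ≤ δ / 3 := div_le_div_of_nonneg_left hδ.le (by norm_num) h1
  by_cases hc : τ a b = s
  · rcases h3 with rfl | rfl <;> intro h <;> linarith
  · rcases le_abs.1 (hs a b hc) with h4 | h4 <;>
      rcases h3 with rfl | rfl <;> intro h <;> linarith

/-- All pairs `(a, b)` with `b < a` that precede `(i, j)` have been tested. -/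
structure Tested (K : EmbeddedGraph V d) {n : ℕ} (e : Fin n ≃ V) (δ : ℝ) (i j : ℕ) (m : State)
    (Q : List (EuclideanSpace ℝ (Fin d))) (L : List (Fin n × Fin n)) (ts : List ℝ) (r : ℝ) :
    Prop where
  table : EdgeTable m L
  nodup : L.Nodup
  mem_iff : ∀ a b, (a, b) ∈ L ↔
    b < a ∧ ((a : ℕ) < i ∨ ((a : ℕ) = i ∧ (b : ℕ) < j)) ∧ K.graph.Adj (e a) (e b)
  queries : Q = ts.map fun t => vectorOf d (planeCoord t)
  ts_nodup : ts.Nodup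
  -- Two directions for each of the i(i - 1)/2 + j pairs.
  ts_length : ts.length = i * (i - 1) + 2 * j
  offset : ∀ t ∈ ts, IsOffset (fun a b => K.slope (e a) (e b)) δ r t
  three_le : 3 ≤ r
  counter : m.realVar 7 = r
  direction : ∀ j < d, 2 ≤ j → m.realArr 0 0 j = 0

theorem Tested.setNat {V : Type*} {d : ℕ} {K : EmbeddedGraph V d} {n : ℕ} {e : Fin n ≃ V} {δ : ℝ} {i j : ℕ} {m : State}
    {Q : List (EuclideanSpace ℝ (Fin d))} {L : List (Fin n × Fin n)} {ts : List ℝ} {r : ℝ}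
    (h : Tested K e δ i j m Q L ts r) {x : ℕ} (hx : 3 ≠ x) (c : ℕ) :
    Tested K e δ i j (m.setNat x c) Q L ts r :=
  { h with
    table := ⟨by simpa [hx] using h.table.length, h.table.fst, h.table.snd⟩
    counter := h.counter
    direction := h.direction }

/-- Find the edges. -/
def findEdges : Program :=
  .seq (.setNat 3 (.const 0))
    (.seq (.setReal 7 (.add .one (.add .one .one)))
      (.forLoop 4 2 (.forLoop 5 4 testPair)))

theorem runs_findEdges (hO : K.IsOracle O) {hd : 2 ≤ d} (hK : K.GeneralPosition hd)
    {n : ℕ} {e : Fin n ≃ V} {m : State} {δ : ℝ} (hn : m.natVar 2 = n)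
    (hpos : ∀ (k : Fin n), ∀ j < d, m.realArr 1 k j = K.coord (e k) j)
    (hs : ∀ i j : Fin n, m.realArr 3 i j = K.slope (e i) (e j))
    (hδ : m.realVar 6 = δ) (hδ0 : 0 < δ)
    (hsep : ∀ a b a' b', K.slope (e a) (e b) ≠ K.slope (e a') (e b') →
      δ ≤ |K.slope (e a) (e b) - K.slope (e a') (e b')|)
    (h0 : ∀ j < d, 2 ≤ j → m.realArr 0 0 j = 0) :
    Runs d O T findEdges m
      (20 + n * (14 + n * (2 * T + 208 + 400 * (Fintype.card V * Fintype.card V)))) fun m' Q =>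
      ∃ L ts r, Tested K e δ n 0 m' Q L ts r := by
  classical
  set c := 2 * T + 200 + 400 * (Fintype.card V * Fintype.card V) with hc
  refine runs_setNat_seq (c := 18 + n * (6 + n * (c + 8) + 8)) ?_
    (by rw [show 2 * T + 208 + 400 * (Fintype.card V * Fintype.card V) = c + 8 by omega]
        simp only [NatExp.cost]
        ring_nf
        omega)
  refine runs_setReal_seq (c := 6 + n * (6 + n * (c + 8) + 8)) ?_ (by simp; omega)
  refine runs_forLoop (fun i m' Q => ∃ L ts r, Tested K e δ i 0 m' Q L ts r) (by simpa using hn)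
    (by decide) (by decide) (by decide) ?_ ?_ (fun m' Q _ _ h => h) le_rfl
  · refine ⟨[], [], 3, ⟨by simp, by simp, by simp⟩, by simp, by simp, rfl, by simp, by simp, by simp,
      le_rfl, ?_, by simpa using h0⟩
    simp
    norm_num
  rintro i hi m₁ Q₁ hf₁ hx₁ hy₁ ⟨L, ts, r, hI⟩
  have hA₁ : m₁.realArr 1 = m.realArr 1 := hf₁.realArr 1 (by decide)
  have hs₁ : m₁.realArr 3 = m.realArr 3 := hf₁.realArr 3 (by decide)
  have hδ₁ : m₁.realVar 6 = δ := by rw [hf₁.real 6 (by decide)]; simpa using hδ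
  -- The bound of the inner loop is the outer counter, so every unordered pair is tested once.
  refine runs_forLoop (c := c) (fun j m' Q => ∃ L ts r, Tested K e δ i j m' (Q₁ ++ Q) L ts r) hx₁
    (by decide) (by decide) (by decide) ?_ ?_ ?_
    (Nat.add_le_add_left (Nat.mul_le_mul_right _ hi.le) _)
  · exact ⟨L, ts, r, by simpa using hI.setNat (by decide) 0⟩
  · rintro j hj m₂ Q₂ hf₂ hx₂ hy₂ ⟨L, ts, r, hI⟩
    have hA₂ : m₂.realArr 1 = m.realArr 1 := (hf₂.realArr 1 (by decide)).trans hA₁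
    have hs₂ : m₂.realArr 3 = m.realArr 3 := (hf₂.realArr 3 (by decide)).trans hs₁
    have hδ₂ : m₂.realVar 6 = δ := (hf₂.real 6 (by decide)).trans hδ₁
    have hr3 := hI.three_le
    have hjn : j < n := hj.trans hi
    set a : Fin n := ⟨i, hi⟩ with ha
    set b : Fin n := ⟨j, hjn⟩ with hb
    have hab : a ≠ b := fun h => hj.ne' (congrArg Fin.val h)
    have hr0 : 0 < δ / r := by positivity
    have hlt : δ / r < δ := div_lt_self hδ0 (by linarith)
    refine (runs_testPair (T := T) hO hK hab (e := e) (t := K.slope (e a) (e b)) (i := a) (j := b)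
      hy₂ hx₂ (by rw [hA₂]; exact hpos a 0 (by omega)) (by rw [hA₂]; exact hpos a 1 (by omega)) rfl
      (by rw [hs₂]; exact hs a b) hδ₂ hI.counter hr0 ?_ hI.direction hI.table).mono le_rfl ?_
    · intro z hz
      obtain ⟨z, rfl⟩ := e.surjective z
      exact hlt.trans_le (hsep a z a b hz)
    · rintro m₃ Q₃ hf₃ ⟨rfl, hr₃, h0₃, hL₃⟩
      have hfresh : ∀ t ∈ ts, ∀ u, (u = K.slope (e a) (e b) - δ / r ∨
          u = K.slope (e a) (e b) + δ / r) → t ≠ u :=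
        fun t ht u hu => (hI.offset t ht).ne hδ0 hr3 (fun a' b' h => hsep a' b' a b h) hu
      refine ⟨_, ts ++ [K.slope (e a) (e b) - δ / r, K.slope (e a) (e b) + δ / r], r + 1,
        Tested.setNat ⟨hL₃, ?_, ?_, ?_, ?_, ?_, ?_, by linarith, hr₃, h0₃⟩ (by decide) _⟩
      · split_ifs
        · rw [List.nodup_append]
          refine ⟨hI.nodup, by simp, ?_⟩
          rintro x hx y hy rfl
          rw [List.mem_singleton.1 hy, hI.mem_iff] at hx
          have hai : (a : ℕ) = i := rfl
          have hbj : (b : ℕ) = j := rfl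
          omega
        · exact hI.nodup
      · intro a' b'
        have hA' : (a', b') = (a, b) ↔ (a' : ℕ) = i ∧ (b' : ℕ) = j := by
          rw [Prod.mk.injEq, Fin.ext_iff, Fin.ext_iff]
        have hcase : (a' : ℕ) < i ∨ (a' : ℕ) = i ∧ (b' : ℕ) < j + 1 ↔
            ((a' : ℕ) < i ∨ (a' : ℕ) = i ∧ (b' : ℕ) < j) ∨ ((a' : ℕ) = i ∧ (b' : ℕ) = j) := by
          omega
        by_cases heq : (a', b') = (a, b)
        · have h' := hA'.1 heq
          obtain ⟨rfl, rfl⟩ := Prod.mk.inj heq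
          by_cases hadj : K.graph.Adj (e a) (e b)
          · rw [if_pos hadj]
            exact iff_of_true (by simp) ⟨hj, .inr ⟨rfl, Nat.lt_succ_self j⟩, hadj⟩
          · simp [hadj, hI.mem_iff]
        · have h' : ¬ ((a' : ℕ) = i ∧ (b' : ℕ) = j) := fun h => heq (hA'.2 h)
          rw [hcase, or_iff_left h', ← hI.mem_iff]
          split_ifs
          · rw [List.mem_append, List.mem_singleton, or_iff_left heq]
          · rfl
      · rw [← List.append_assoc, hI.queries]
        simp
      · rw [List.nodup_append]
        refine ⟨hI.ts_nodup, ?_, ?_⟩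
        · simp only [List.nodup_cons, List.mem_singleton, List.not_mem_nil, not_false_eq_true,
            List.nodup_nil, and_true]
          intro h
          linarith
        · intro t ht u hu
          exact hfresh t ht u (by simpa using hu)
      · simp [hI.ts_length]
        ring
      · intro t ht
        rw [List.mem_append] at ht
        rcases ht with ht | ht
        · exact (hI.offset t ht).mono (by linarith)
        · exact ⟨a, b, r, hr3, by linarith, by simpa using ht⟩
  · rintro m₂ Q₂ hf₂ hx₂ ⟨L, ts, r, hI⟩
    -- The positions (i, i) and (i + 1, 0) describe the same pairs with b < a, and i(i - 1) + 2i =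
    -- (i + 1)i.
    refine ⟨L, ts, r, Tested.setNat { hI with mem_iff := ?_, ts_length := ?_ } (by decide) _⟩
    · intro a b
      rw [hI.mem_iff]
      refine and_congr_right fun hba => and_congr_left' ?_
      have : (b : ℕ) < a := hba
      omega
    · rw [hI.ts_length]
      cases i with
      | zero => rfl
      | succ i => simp; ring

end

/-! ### Distinctness of the directions, output format and total cost. -/

section

variable {V : Type*} [Fintype V] {d : ℕ} {K : EmbeddedGraph V d}

/-- The directions of the axes, the oblique direction and the directions close to the critical ones
are pairwise different. -/
theorem nodup_directions (hd : 2 ≤ d) {B : ℝ} (hB : 0 < B) {ts : List ℝ} (hts : ts.Nodup)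
    (h0 : ∀ t ∈ ts, t ≠ 0) (hne : ∀ t ∈ ts, t ≠ B) :
    ((List.range d).map (fun i => vectorOf d (axisCoord i)) ++
      [vectorOf d (obliqueCoord d (1 / B))] ++
      ts.map fun t => vectorOf d (planeCoord t)).Nodup := by
  have hob : ∀ j, 0 < obliqueCoord d (1 / B) j := fun j =>
    div_pos (by positivity) (Real.sqrt_pos.2 (sum_powers_pos (by omega) _))
  rw [List.nodup_append, List.nodup_append]
  refine ⟨⟨?_, by simp, ?_⟩, hts.map (planar_injective hd), ?_⟩
  · rw [List.nodup_map_iff_inj_on List.nodup_range]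
    intro i hi j _ h
    by_contra hij
    have := vectorOf_apply_eq h (List.mem_range.1 hi)
    simp [axisCoord, hij] at this
  · intro u hu w hw
    rw [List.mem_singleton.1 hw]
    obtain ⟨i, -, rfl⟩ := List.mem_map.1 hu
    intro h
    -- All oblique coordinates are positive, but an axis vector has a zero among its first two.
    by_cases hi : i = 0
    · have h1 := vectorOf_apply_eq h (j := 1) (by omega)
      have := hob 1
      simp only [axisCoord, hi, one_ne_zero, if_false] at h1
      linarith
    · have h1 := vectorOf_apply_eq h (j := 0) (by omega)
      have := hob 0
      simp only [axisCoord, Ne.symm hi, if_false] at h1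
      linarith
  · intro u hu w hw
    obtain ⟨t, ht, rfl⟩ := List.mem_map.1 hw
    rcases List.mem_append.1 hu with hu | hu
    · obtain ⟨i, -, rfl⟩ := List.mem_map.1 hu
      intro h
      have h1 := vectorOf_apply_eq h (j := 0) (by omega)
      have h2 := vectorOf_apply_eq h (j := 1) (by omega)
      have h3 := planar_pos t
      rw [planar_ratio] at h1
      -- The second coordinate of a planar direction is positive, so only the second axis could
      -- coincide with it, and only for t = 0.
      by_cases hi : i = 1
      · subst hi
        simp only [axisCoord, zero_ne_one, if_false] at h1
        exact mul_ne_zero (h0 t ht) h3.ne' h1.symm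
      · simp only [axisCoord, Ne.symm hi, if_false] at h2
        linarith
    · rw [List.mem_singleton.1 hu]
      intro h
      -- The ratio of the first two oblique coordinates is `B`, which forces t = B.
      have h1 := vectorOf_apply_eq h (j := 0) (by omega)
      have h2 := vectorOf_apply_eq h (j := 1) (by omega)
      rw [planar_ratio, ← h2] at h1
      have h3 := hob 0
      simp only [obliqueCoord, pow_zero, pow_one] at h1 h3
      apply hne t ht
      have h4 : (√(∑ i ∈ Finset.range d, (1 / B) ^ i * (1 / B) ^ i)) ≠ 0 :=
        (Real.sqrt_pos.2 (sum_powers_pos (by omega) _)).ne'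
      rw [div_eq_iff h4, mul_assoc, div_mul_cancel₀ _ h4, mul_one_div] at h1
      exact (div_eq_one_iff_eq hB.ne').1 h1.symm

/-- The condition b < a selects one orientation of every edge, so each edge occurs exactly once. -/
theorem describes_of_edgeTable {V : Type*} {d : ℕ} {K : EmbeddedGraph V d} {n : ℕ} {e : Fin n ≃ V} {m : State} {L : List (Fin n × Fin n)}
    (hn : m.natVar 2 = n) (hpos : ∀ (k : Fin n), ∀ j < d, m.realArr 1 k j = K.coord (e k) j)
    (hL : EdgeTable m L) (hnd : L.Nodup)
    (hmem : ∀ a b, (a, b) ∈ L ↔ b < a ∧ K.graph.Adj (e a) (e b)) : m.Describes K := by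
  subst hn
  have hl := hL.length
  let f : Fin (m.natVar 3) → K.graph.edgeSet := fun k =>
    ⟨s(e (L[(k : ℕ)]'(k.2.trans_eq hl)).1, e (L[(k : ℕ)]'(k.2.trans_eq hl)).2),
      ((hmem _ _).1 (List.getElem_mem (k.2.trans_eq hl))).2⟩
  have hf : Function.Bijective f := by
    constructor
    · intro k k' h
      have hk := ((hmem _ _).1 (List.getElem_mem (l := L) (k.2.trans_eq hl))).1
      have hk' := ((hmem _ _).1 (List.getElem_mem (l := L) (k'.2.trans_eq hl))).1
      have h' := congrArg Subtype.val h
      simp only [f, Sym2.eq_iff, e.injective.eq_iff] at h'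
      rcases h' with ⟨h1, h2⟩ | ⟨h1, h2⟩
      · exact Fin.ext ((List.Nodup.getElem_inj_iff hnd).1 (Prod.ext h1 h2))
      · simp only [List.get_eq_getElem] at hk hk'
        rw [h1, h2] at hk
        exact absurd hk hk'.not_gt
    · have key : ∀ a b, b < a → ∀ h : K.graph.Adj (e a) (e b), ∃ k, (f k : Sym2 V) = s(e a, e b) := by
        intro a b hba h
        obtain ⟨k, hk, hk'⟩ := List.getElem_of_mem ((hmem a b).2 ⟨hba, h⟩)
        exact ⟨⟨k, hl.symm ▸ hk⟩, by simp [f, hk']⟩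
      rintro ⟨z, hz⟩
      induction z using Sym2.ind with
      | _ v w =>
        obtain ⟨a, rfl⟩ := e.surjective v
        obtain ⟨b, rfl⟩ := e.surjective w
        have hadj : K.graph.Adj (e a) (e b) := hz
        rcases lt_trichotomy a b with hab | rfl | hab
        · obtain ⟨k, hk⟩ := key b a hab hadj.symm
          exact ⟨k, Subtype.ext (hk.trans Sym2.eq_swap)⟩
        · exact absurd rfl hadj.ne
        · obtain ⟨k, hk⟩ := key a b hab hadj
          exact ⟨k, Subtype.ext hk⟩
  refine ⟨e, Equiv.ofBijective f hf, fun i j => ?_, fun k => ?_⟩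
  · rw [hpos i j j.2, EmbeddedGraph.coord_eq]
  · exact ⟨_, _, hL.fst k (k.2.trans_eq hl), hL.snd k (k.2.trans_eq hl), rfl⟩

variable {O : EuclideanSpace ℝ (Fin d) → List DiagramPoint} {T : ℕ}

/-- Reconstruct an embedded graph from its directional augmented persistence diagrams. -/
def reconstruct : Program :=
  .seq findVertices (.seq computeSlopes (.seq computeSeparation findEdges))

/-- The number of steps of `reconstruct`. -/
def reconstructTime (d n T : ℕ) : ℕ :=
  (d * (T + 40 + 60 * (n * n)) + d * (14 + n * (14 + n * 48)) + d * 72 +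
    n * (22 + d * (24 + n * 48)) + 60 * (n * n) + T + 100) +
    ((6 + n * (14 + n * 40)) + ((20 + n * (14 + n * (14 + n * (14 + n * 60)))) +
      (20 + n * (14 + n * (2 * T + 208 + 400 * (n * n))))))

/-- Decoding needs only the order of d n² steps, which d n^(d+1) dominates; the terms of order n⁴
come from the separation and from reading O(n²) diagrams with O(n²) points each. Since T ≥ 1, the
term d T absorbs d and the constant. -/
theorem reconstructTime_le {d n T : ℕ} (hd : 2 ≤ d) (hT : 1 ≤ T) :
    reconstructTime d n T ≤ 3000 * (d * n ^ (d + 1) + n ^ 4 + (d + n ^ 2) * T) := by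
  have h1 : d * n ^ 2 ≤ d * n ^ (d + 1) := by
    rcases Nat.eq_zero_or_pos n with rfl | hn
    · simp
    · exact Nat.mul_le_mul_left _ (Nat.pow_le_pow_right hn (by omega))
  have h2 : n ≤ n ^ 2 := Nat.le_self_pow two_ne_zero n
  have h3 : n ^ 2 ≤ n ^ 4 := by
    rcases Nat.eq_zero_or_pos n with rfl | hn
    · simp
    · exact Nat.pow_le_pow_right hn (by omega)
  have h4 : n ^ 3 ≤ n ^ 4 := by
    rcases Nat.eq_zero_or_pos n with rfl | hn
    · simp
    · exact Nat.pow_le_pow_right hn (by omega)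
  have h5 : d ≤ d * T := Nat.le_mul_of_pos_right d hT
  have h6 : d * n ≤ d * n ^ 2 := Nat.mul_le_mul_left d h2
  have h7 : T ≤ d * T := Nat.le_mul_of_pos_left T (by omega)
  have h8 : (d + n ^ 2) * T = d * T + n ^ 2 * T := by ring
  have h9 : reconstructTime d n T = d * T + 126 * d + 156 * (d * n ^ 2) + 38 * (d * n) + T + 64 * n +
      322 * n ^ 2 + 14 * n ^ 3 + 460 * n ^ 4 + 2 * (n ^ 2 * T) + 146 := by
    unfold reconstructTime
    ring
  rw [h8, h9]
  omega

theorem runs_reconstruct (hO : K.IsOracle O) {hd : 2 ≤ d} (hK : K.GeneralPosition hd) :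
    Runs d O T reconstruct (State.init d) (reconstructTime d (Fintype.card V) T) fun m Q =>
      m.Describes K ∧ Q.Nodup ∧ Q.length = Fintype.card V ^ 2 - Fintype.card V + d + 1 := by
  have hd0 : 0 < d := by omega
  refine (runs_findVertices (T := T) hO hd0).seq ?_ le_rfl
  rintro m₁ Q₁ hf₁ ⟨B, hB0, hB₁, hn₁, rfl, hz₁, e, he⟩
  refine (computes_computeSlopes hn₁).seq_runs ?_ le_rfl
  intro m₂ hf₂ hs₂
  have hn₂ := (hf₂.nat 2 (by decide)).trans hn₁
  have hB₂ := (hf₂.real 1 (by decide)).trans hB₁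
  refine (computes_computeSeparation hn₂ hB₂).seq_runs ?_ le_rfl
  intro m₃ hf₃ hδ₃
  have hn₃ := (hf₃.nat 2 (by decide)).trans hn₂
  have hA₃ : m₃.realArr 1 = m₁.realArr 1 :=
    (hf₃.realArr 1 (by decide)).trans (hf₂.realArr 1 (by decide))
  have hz₃ : m₃.realArr 0 = m₁.realArr 0 :=
    (hf₃.realArr 0 (by decide)).trans (hf₂.realArr 0 (by decide))
  have hs : ∀ i j : Fin (Fintype.card V), m₂.realArr 3 i j = K.slope (e i) (e j) := by
    intro i j
    rw [hs₂ i i.2 j j.2, he j 1 (by omega), he i 1 (by omega), he i 0 hd0, he j 0 hd0]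
    rfl
  set δ := separation (m₂.realArr 3) B (Fintype.card V) with hδ
  have hsep : ∀ a b a' b', K.slope (e a) (e b) ≠ K.slope (e a') (e b') →
      δ ≤ |K.slope (e a) (e b) - K.slope (e a') (e b')| := by
    intro a b a' b' h
    rw [← hs, ← hs] at h ⊢
    exact separation_le a.2 b.2 a'.2 b'.2 h
  have hsepB : ∀ a b, K.slope (e a) (e b) ≠ B → δ ≤ |K.slope (e a) (e b) - B| := by
    intro a b h
    rw [← hs] at h ⊢
    exact separation_le_sub a.2 b.2 h
  refine (runs_findEdges (T := T) hO hK hn₃ (e := e) (by rw [hA₃]; exact he)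
    (fun i j => by rw [hf₃.realArr 3 (by decide)]; exact hs i j) hδ₃ separation_pos hsep
    (fun j hj _ => by rw [hz₃]; exact hz₁ j hj)).mono le_rfl ?_
  rintro m₄ Q₄ hf₄ ⟨L, ts, r, hI⟩
  have hA₄ : m₄.realArr 1 = m₁.realArr 1 := (hf₄.realArr 1 (by decide)).trans hA₃
  refine ⟨describes_of_edgeTable ((hf₄.nat 2 (by decide)).trans hn₃) (e := e)
    (by rw [hA₄]; exact he) hI.table hI.nodup fun a b => ?_, ?_, ?_⟩
  · rw [hI.mem_iff]
    have := a.2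
    constructor
    · exact fun h => ⟨h.1, h.2.2⟩
    · exact fun h => ⟨h.1, .inl a.2, h.2⟩
  · rw [hI.queries]
    refine nodup_directions hd hB0 hI.ts_nodup (fun t ht => ?_) fun t ht => ?_
    · refine (hI.offset t ht).ne_critical separation_pos fun a b h => ?_
      -- By the convention 0/0 = 0, the diagonal slopes put 0, the parameter of the second axis,
      -- among the values that δ separates.
      have h0 : K.slope (e a) (e a) = 0 := by simp [EmbeddedGraph.slope]
      rw [← h0] at h ⊢
      exact hsep a b a a h
    · exact (hI.offset t ht).ne_critical separation_pos hsepB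
  · rw [hI.queries]
    simp only [List.length_append, List.length_map, List.length_range, List.length_singleton,
      hI.ts_length]
    rw [sq, Nat.mul_sub_one]
    omega

end

end GraphReconstruction

end

/-- There are a single program and an absolute constant `C` such that, for every `d > 1` and every
straight-line embedded graph in general position in `ℝ^d` with `n` vertices, the program computes
the vertices, the edges and the embedding from the augmented persistence diagrams in exactly
`n ^ 2 - n + d + 1` different directions, in the stated time. -/
theorem mainTheorem1 :
    ∃ (p : GraphReconstruction.Program) (C : ℕ),
      ∀ (d : ℕ) (hd : 2 ≤ d) (V : Type*) [Fintype V]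
        (K : GraphReconstruction.EmbeddedGraph V d), K.GeneralPosition hd →
      ∀ O : EuclideanSpace ℝ (Fin d) → List GraphReconstruction.DiagramPoint, K.IsOracle O →
      ∀ T : ℕ, 1 ≤ T →
      ∃ (m : GraphReconstruction.State) (t : ℕ) (Q : List (EuclideanSpace ℝ (Fin d))),
        GraphReconstruction.Exec d O T p (GraphReconstruction.State.init d) m t Q ∧
        m.Describes K ∧
        Q.Nodup ∧ Q.length = Fintype.card V ^ 2 - Fintype.card V + d + 1 ∧
        t ≤ C * (d * Fintype.card V ^ (d + 1) + Fintype.card V ^ 4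
          + (d + Fintype.card V ^ 2) * T) := by
  refine ⟨GraphReconstruction.reconstruct, 3000, ?_⟩
  intro d hd V _ K hK O hO T hT
  obtain ⟨m, t, Q, h, ht, h1, h2, h3⟩ :=
    GraphReconstruction.runs_reconstruct (T := T) hO hK
  exact ⟨m, t, Q, h, h1, h2, h3, ht.trans (GraphReconstruction.reconstructTime_le hd hT)⟩
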